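/- Notation. For a complex vector space $V$, let $V[\nu^{-1},\nu]]$ be the space of formal Laurent series in $\nu$ with finite principal part; $\mathbb K=\mathbb C[\nu^{-1},\nu]]$ is the field of formal numbers. Let $U$ be a (Hausdorff, second countable) smooth manifold of real dimension $2n$, for instance an open subset of a complex manifold of dimension $n$, and put $\mathcal F(U)=C^\infty(U)[\nu^{-1},\nu]]$ (complex-valued functions). If a family $v(m)\in\mathbb C$ has an asymptotic expansion $v(m)\sim\sum_{r\ge r_0}m^{-r}v_r$ as $m\to+\infty$, put $\mathbb F(v(m))=\sum_{r\ge r_0}\nu^r v_r\in\mathbb K$. Formal integrals. Let $\Phi=\nu^{-1}\Phi_{-1}+\Phi_0+\nu\Phi_1+\dots\in\mathcal F(U)$ and let $\mu=\mu_0+\nu\mu_1+\dots$ be a formal smooth volume form on $U$. Let $x\in U$ be a nondegenerate critical point of $\Phi_{-1}$ with $\mu_0(x)\neq0$. A formal integral at $x$ associated to $(\Phi,\mu)$ is a $\mathbb K$-linear functional $K:\mathcal F(U)\to\mathbb K$ such that (a) $K=K_0+\nu K_1+\dots$, where each $K_r$ is a distribution supported at $x$; (b) $K_0=\delta_x$;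 (c) $K(1)=1$; (d) $K\bigl(\xi f+(\xi\Phi+\operatorname{div}_\mu\xi)f\bigr)=0$ for every vector field $\xi$ on $U$ and every $f\in\mathcal F(U)$. Here $\operatorname{div}_\mu\xi$ is given near $x$ by $L_\xi\mu=(\operatorname{div}_\mu\xi)\mu$; by (a), only its germ at $x$ matters. Proposition. Let $\phi\in C^\infty(U)$ satisfy $\operatorname{Re}\phi\le0$ and have exactly one critical point $x_c$ in $U$; suppose that $x_c$ is nondegenerate and $\phi(x_c)=0$. Let $dx$ be a nowhere vanishing smooth volume form on $U$. Let $\rho(x,m)\in S^0(U\times\mathbb R)$ be a classical symbol with $\rho\sim\sum_{r\ge0}m^{-r}\rho_r(x)$ as $m\to+\infty$, where $\rho_r\in C^\infty(U)$ and $\rho_0(x_c)\ne0$. Put $\mu(m)=\rho(x,m)\,dx$, $\mathbb F(\mu)=\sum_{r\ge0}\nu^r\rho_r\,dx$ and, for $f\in C_0^\infty(U)$, $$S_m(f)=\int_U e^{m\phi}f\,\mu(m).$$ Then there is exactly one formal integral $K$ at $x_c$ associated to the pair $(\nu^{-1}\phi,\mathbb F(\mu))$, and there is a nonzero formal constant $c(\nu)\in\mathbb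 K$, independent of $f$, such that for every $f\in C_0^\infty(U)$ the integral $S_m(f)$ expands in an asymptotic series in $1/m$ as $m\to+\infty$ and $$\mathbb F\bigl(S_m(f)\bigr)=c(\nu)K(f).$$ -/

import Mathlib

open scoped Manifold ContDiff Topology

noncomputable section

/-- The real coordinate space of dimension `2 n`, with its Euclidean norm and Lebesgue measure. -/
abbrev Coord (n : ℕ) : Type := EuclideanSpace ℝ (Fin (2 * n))

section Manifold

variable (n : ℕ) (U : Type*) [TopologicalSpace U] [ChartedSpace (Coord n) U]

/-- `C^∞(U)`: the `ℂ`-algebra of smooth complex-valued functions on the manifold `U`. -/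
def smoothFunctions : Subalgebra ℂ (U → ℂ) where
  carrier := {f | ContMDiff (𝓡 (2 * n)) 𝓘(ℝ, ℂ) ∞ f}
  mul_mem' := fun hf hg =>
    (contDiff_mul (𝕜 := ℝ) (𝔸 := ℂ)).comp_contMDiff (ContMDiff.prodMk_space hf hg)
  add_mem' := fun hf hg =>
    (contDiff_add (𝕜 := ℝ) (F := ℂ)).comp_contMDiff (ContMDiff.prodMk_space hf hg)
  algebraMap_mem' := fun _ => contMDiff_const

/-- The type `C^∞(U)`. -/
abbrev SmoothFn : Type _ := smoothFunctions n U

/-- A smooth (real) vector field on `U`: a smooth section of the tangent bundle. -/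
abbrev SmoothVectorField [IsManifold (𝓡 (2 * n)) ∞ U] : Type _ :=
  Cₛ^∞⟮𝓡 (2 * n); Coord n, (TangentSpace (𝓡 (2 * n)) : U → Type _)⟯

/-- The field `𝕂 = ℂ[ν⁻¹, ν]]` of formal numbers. -/
abbrev FormalNumber : Type := LaurentSeries ℂ

/-- The ring `𝓕(U) = C^∞(U)[ν⁻¹, ν]]` of formal functions; the coefficient of `ν ^ s` of `F`
is `F.coeff s`. -/
abbrev FormalFn : Type _ := LaurentSeries (SmoothFn n U)

/-- The same formal functions `C^∞(U)[ν⁻¹, ν]]`, with their structure of vector space over `𝕂`;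
`HahnModule.of ℂ` is the identification with `FormalFn n U`. -/
abbrev FormalFnSpace : Type _ := HahnModule ℤ ℂ (SmoothFn n U)

/-- A nowhere vanishing smooth complex volume form (density) `dx = factor · |dx|` on `U`.
Here `|dx|` is a smooth positive density, given as a measure `base` which in the chart at `p`
reads `baseDensity p (y) dy` with a smooth positive function `baseDensity p`, and `factor` is a
nowhere vanishing smooth function (on an oriented manifold every nowhere vanishing smooth volume
form, real or complex, is of this kind). -/
structure VolumeForm [MeasurableSpace U] where
  base : MeasureTheory.Measure U
  baseDensity : U → Coord n → ℝ
  smooth_baseDensity : ∀ p : U,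
    ContDiffOn ℝ ∞ (baseDensity p) (chartAt (Coord n) p).target
  baseDensity_pos : ∀ p : U, ∀ y ∈ (chartAt (Coord n) p).target, 0 < baseDensity p y
  map_base : ∀ p : U,
    (base.restrict (chartAt (Coord n) p).source).map (chartAt (Coord n) p) =
      ((MeasureTheory.volume : MeasureTheory.Measure (Coord n)).restrict
        (chartAt (Coord n) p).target).withDensity (fun y => ENNReal.ofReal (baseDensity p y))
  factor : SmoothFn n U
  factor_ne_zero : ∀ x : U, factor.1 x ≠ 0

variable {n U}

/-- The integral `∫_U f dx`. -/
def VolumeForm.integral [MeasurableSpace U] (dx : VolumeForm n U) (f : U → ℂ) : ℂ :=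
  ∫ x, f x * dx.factor.1 x ∂dx.base

/-- The coefficient `w` of the volume form `a dx = w(y) dy¹ ⋯ dy²ⁿ` in the chart at `p`. -/
def VolumeForm.coeff [MeasurableSpace U] (dx : VolumeForm n U) (a : SmoothFn n U) (p : U)
    (y : Coord n) : ℂ :=
  a.1 ((chartAt (Coord n) p).symm y) * dx.factor.1 ((chartAt (Coord n) p).symm y) *
    (dx.baseDensity p y : ℂ)

/-! ### Critical points -/

/-- `x` is a critical point of `f`: the differential of `f` vanishes at `x`. -/
def IsCriticalPoint (f : SmoothFn n U) (x : U) : Prop :=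
  mfderiv (𝓡 (2 * n)) 𝓘(ℝ, ℂ) f.1 x = 0

/-- The (complex symmetric) matrix of second partial derivatives at `x` of `f` in the chart
at `x`. -/
def hessian (f : SmoothFn n U) (x : U) : Matrix (Fin (2 * n)) (Fin (2 * n)) ℂ :=
  fun i j => iteratedFDeriv ℝ 2 (fun y => f.1 ((chartAt (Coord n) x).symm y))
    (chartAt (Coord n) x x) ![EuclideanSpace.single i 1, EuclideanSpace.single j 1]

/-- `x` is a nondegenerate critical point of `f`. -/
def IsNondegenerateCriticalPoint (f : SmoothFn n U) (x : U) : Prop :=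
  IsCriticalPoint f x ∧ (hessian f x).det ≠ 0

/-! ### Symbols -/

/-- The mixed derivative `∂_m^l D_y^j` of `a(x, m)`, with `x` in the coordinates `y` of the chart
at `p`. -/
def mixedDeriv (a : U → ℝ → ℂ) (p : U) (j l : ℕ) (y : Coord n) (m : ℝ) :
    ContinuousMultilinearMap ℝ (fun _ : Fin j => Coord n) ℂ :=
  iteratedDeriv l
    (fun t => iteratedFDeriv ℝ j (fun z => a ((chartAt (Coord n) p).symm z) t) y) m

variable (n) in
/-- `a ∈ S^d(U × ℝ)`: `a` is smooth on `U × ℝ`, and on every compact subset of a chart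
`|∂_m^l D_x^j a| ≤ C (1 + |m|)^(d - l)`. -/
def IsSymbol (d : ℤ) (a : U → ℝ → ℂ) : Prop :=
  ContMDiff ((𝓡 (2 * n)).prod 𝓘(ℝ, ℝ)) 𝓘(ℝ, ℂ) ∞ (fun q : U × ℝ => a q.1 q.2) ∧
  ∀ (p : U) (L : Set (Coord n)), IsCompact L → L ⊆ (chartAt (Coord n) p).target →
    ∀ j l : ℕ, ∃ C : ℝ, ∀ y ∈ L, ∀ m : ℝ,
      ‖mixedDeriv a p j l y m‖ ≤ C * (1 + |m|) ^ (d - l)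

/-- The symbol expansion `a ∼ ∑_{r ≥ 0} m^(-r) s_r` as `m → +∞`: each remainder
`a - ∑_{r < N} m^(-r) s_r` satisfies the estimates of a symbol of order `-N` for `m ≥ 1`. -/
def HasSymbolExpansion (a : U → ℝ → ℂ) (s : ℕ → SmoothFn n U) : Prop :=
  ∀ (N : ℕ) (p : U) (L : Set (Coord n)), IsCompact L → L ⊆ (chartAt (Coord n) p).target →
    ∀ j l : ℕ, ∃ C : ℝ, ∀ y ∈ L, ∀ m : ℝ, 1 ≤ m →
      ‖mixedDeriv (fun x t => a x t - ∑ r ∈ Finset.range N, (t : ℂ) ^ (-(r : ℤ)) * (s r).1 x)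
        p j l y m‖ ≤ C * m ^ (-(N : ℤ) - (l : ℤ))

/-! ### Asymptotic expansions and the formalizer -/

/-- `v(m) ∼ ∑_r m^(-r) a_r` as `m → +∞`, that is, `v` has an asymptotic expansion in powers of
`1/m` and the formalizer sends it to the formal number `a = ∑_r ν^r a_r`. -/
def HasAsymptoticExpansion (v : ℝ → ℂ) (a : FormalNumber) : Prop :=
  ∀ N : ℤ, (fun m : ℝ => v m - ∑ r ∈ Finset.Ico a.order N, a.coeff r * (m : ℂ) ^ (-r))
    =O[Filter.atTop] (fun m : ℝ => m ^ (-N))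

/-! ### Formal integrals -/

/-- A distribution on `U` supported at the point `x`, as a functional on `C^∞(U)`: it vanishes on
every function that vanishes near `x`, and it is continuous, that is, bounded by the derivatives
up to some order on some compact subset of the chart at `x` (by locality one chart suffices). -/
def IsDistributionSupportedAt (x : U) (T : SmoothFn n U →ₗ[ℂ] ℂ) : Prop :=
  (∀ f : SmoothFn n U, (∀ᶠ y in 𝓝 x, f.1 y = 0) → T f = 0) ∧
  ∃ (L : Set (Coord n)) (N : ℕ) (C : ℝ),
    IsCompact L ∧ L ⊆ (chartAt (Coord n) x).target ∧
    ∀ (f : SmoothFn n U) (B : ℝ),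
      (∀ j ≤ N, ∀ y ∈ L,
        ‖iteratedFDeriv ℝ j (fun z => f.1 ((chartAt (Coord n) x).symm z)) y‖ ≤ B) →
      ‖T f‖ ≤ C * B

variable [IsManifold (𝓡 (2 * n)) ∞ U]

/-- The derivative `ξ f` of the function `f` along the vector field `ξ`. -/
def SmoothVectorField.apply (ξ : SmoothVectorField n U) (f : SmoothFn n U) (x : U) : ℂ :=
  mfderiv (𝓡 (2 * n)) 𝓘(ℝ, ℂ) f.1 x (ξ x)

theorem SmoothVectorField.contMDiff_apply (ξ : SmoothVectorField n U) (f : SmoothFn n U) :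
    ContMDiff (𝓡 (2 * n)) 𝓘(ℝ, ℂ) ∞ (ξ.apply f) := by
  have h1 : ContMDiff (𝓡 (2 * n)) (𝓘(ℝ, ℂ)).tangent ∞
      (tangentMap (𝓡 (2 * n)) 𝓘(ℝ, ℂ) f.1 ∘
        fun x : U => (⟨x, ξ x⟩ : TangentBundle (𝓡 (2 * n)) U)) :=
    (ContMDiff.contMDiff_tangentMap (show ContMDiff (𝓡 (2 * n)) 𝓘(ℝ, ℂ) ∞ f.1 from f.2)
      (by simp)).comp ξ.contMDiff
  exact (contMDiff_snd_tangentBundle_modelSpace ℂ 𝓘(ℝ, ℂ)).comp h1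

/-- The vector field `ξ` as a linear operator `f ↦ ξ f` on `C^∞(U)`. -/
def SmoothVectorField.op (ξ : SmoothVectorField n U) : SmoothFn n U →ₗ[ℂ] SmoothFn n U where
  toFun f := ⟨ξ.apply f, ξ.contMDiff_apply f⟩
  map_add' f g := by
    ext x
    have hf := ContMDiff.mdifferentiable (n := ∞)
      (show ContMDiff (𝓡 (2 * n)) 𝓘(ℝ, ℂ) ∞ f.1 from f.2) (by simp) x
    have hg := ContMDiff.mdifferentiable (n := ∞)
      (show ContMDiff (𝓡 (2 * n)) 𝓘(ℝ, ℂ) ∞ g.1 from g.2) (by simp) x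
    exact congrArg (fun A => A (ξ x)) (mfderiv_add hf hg)
  map_smul' c f := by
    ext x
    have hf := (ContMDiff.mdifferentiable (n := ∞)
      (show ContMDiff (𝓡 (2 * n)) 𝓘(ℝ, ℂ) ∞ f.1 from f.2) (by simp) x).hasMFDerivAt
    have hc := (c • ContinuousLinearMap.id ℝ ℂ).hasMFDerivAt (x := f.1 x)
    exact congrArg (fun A => A (ξ x)) (hc.comp x hf).mfderiv

/-- The components of the vector field `ξ` in the chart at `p`. -/
def SmoothVectorField.component (ξ : SmoothVectorField n U) (p : U) (k : Fin (2 * n))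
    (y : Coord n) : ℝ :=
  (show Coord n from mfderiv (𝓡 (2 * n)) (𝓡 (2 * n)) (chartAt (Coord n) p)
    ((chartAt (Coord n) p).symm y) (ξ ((chartAt (Coord n) p).symm y))) k

/-- The coefficient `∑_k ∂_k (ξ^k w)` of the Lie derivative of the volume form `w dy¹ ⋯ dy²ⁿ` along
`ξ`, in the chart at `p`. -/
def lieDerivCoeff (ξ : SmoothVectorField n U) (p : U) (w : Coord n → ℂ) (y : Coord n) : ℂ :=
  ∑ k : Fin (2 * n),
    fderiv ℝ (fun z => (ξ.component p k z : ℂ) * w z) y (EuclideanSpace.single k 1)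

/-- For the formal volume form `μ = ∑_{r ≥ 0} ν^r (s_r dx)`: the formal function `h` is equal to the
divergence `div_μ ξ` in a neighbourhood of `x`, that is, `L_ξ μ = h μ` there. (The divergence is
defined only where the leading form `s_0 dx` does not vanish.) -/
def IsDivergenceNear [MeasurableSpace U] (dx : VolumeForm n U) (s : ℕ → SmoothFn n U)
    (ξ : SmoothVectorField n U) (x : U) (h : FormalFn n U) : Prop :=
  (∀ r < 0, h.coeff r = 0) ∧
  ∀ᶠ y in 𝓝 (chartAt (Coord n) x x), ∀ r : ℕ,
    lieDerivCoeff ξ x (dx.coeff (s r) x) y =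
      ∑ i ∈ Finset.range (r + 1),
        (h.coeff (i : ℤ)).1 ((chartAt (Coord n) x).symm y) * dx.coeff (s (r - i)) x y

/-- The `𝕂`-linear functional `K` on `𝓕(U)` is a (normalized) formal integral at the point `x`
associated to the pair `(Φ, μ)`, where `Φ = ν⁻¹ Φ_{-1} + Φ_0 + ν Φ_1 + ⋯` is a formal function such
that `x` is a nondegenerate critical point of `Φ_{-1}`, and `μ = ∑_{r ≥ 0} ν^r (s_r dx)` is a formal
volume form with `s_0(x) ≠ 0`. -/
structure IsFormalIntegral [MeasurableSpace U] (x : U) (Φ : FormalFn n U) (dx : VolumeForm n U)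
    (s : ℕ → SmoothFn n U) (K : FormalFnSpace n U →ₗ[FormalNumber] FormalNumber) : Prop where
  coeff_eq_zero : ∀ r < -1, Φ.coeff r = 0
  nondegenerate : IsNondegenerateCriticalPoint (Φ.coeff (-1)) x
  leading_ne_zero : (s 0).1 x ≠ 0
  /-- `K = K_0 + ν K_1 + ⋯` is a formal distribution supported at `x`, with `K_0 = δ_x`. -/
  expansion : ∃ T : ℕ → (SmoothFn n U →ₗ[ℂ] ℂ),
    (∀ r, IsDistributionSupportedAt x (T r)) ∧
    (∀ (F : FormalFn n U) (k : ℤ),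
      (K (HahnModule.of ℂ F)).coeff k = ∑ᶠ r : ℕ, T r (F.coeff (k - (r : ℤ)))) ∧
    ∀ f : SmoothFn n U, T 0 f = f.1 x
  normalized : K (HahnModule.of ℂ (1 : FormalFn n U)) = 1
  /-- `K (ξ F + (ξ Φ + div_μ ξ) F) = 0`. -/
  stokes : ∀ (ξ : SmoothVectorField n U) (F h : FormalFn n U), IsDivergenceNear dx s ξ x h →
    K (HahnModule.of ℂ (F.map ξ.op + (Φ.map ξ.op + h) * F)) = 0

/-! ### The oscillatory integral -/

/-- `S_m(f) = ∫_U e^{m φ} f μ(m)` with `μ(m) = ρ(x, m) dx`. -/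
def oscillatoryIntegral {n : ℕ} {U : Type*} [TopologicalSpace U] [ChartedSpace (Coord n) U]
    [MeasurableSpace U] (dx : VolumeForm n U) (φ : SmoothFn n U) (ρ : U → ℝ → ℂ)
    (f : SmoothFn n U) (m : ℝ) : ℂ :=
  dx.integral (fun x => Complex.exp ((m : ℂ) * φ.1 x) * f.1 x * ρ x m)

end Manifold

end

/-! The expansion is obtained without a complex Morse lemma. In the chart at the critical point `o`,
the phase `φ` is joined to `-|y - o|²` by convex combinations. Since `Re φ ≤ 0` and `φ(o) = 0`, the
Hessian has nonpositive real part, and this keeps the Hessian nondegenerate along the whole path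
(`det_deformed_ne_zero`). By Hadamard's lemma the gradient of each phase is an invertible matrix
applied to `y - o`, so near `o` every function vanishing at `o` is a combination of the derivatives
of the phase (`exists_phaseFamily`).

Write an amplitude as its value at `o` times a cutoff plus such a combination. Integration by parts
turns the combination into `-1/m` times an integral of the same kind. Iterating (`osc_expansion`),
every integral becomes a power series in `1/m` times the integral of the cutoff, up to any order.
The derivative of the cutoff integral along the deformation has an amplitude vanishing at `o`, so
the same reduction gives a linear differential equation with coefficients polynomial in `1/m`, up to
a small error. Solving it compares the given phase with the Gaussian, whose integral is `(π/m)^n` up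
to exponentially small terms (`powerAsymp_osc_cutoff`). Away from the critical point, nonstationary
phase makes the integral negligible.

Hence `m^n ∫ e^{mφ} f dx` expands into a formal series `S(f)`, whose coefficients are distributions
supported at the critical point and whose leading term is a nonzero multiple of the delta function
(`exists_expIntegral_expansion`). Inserting the symbol gives `s(f) = ∑ ν^i S(ρ_i f)`, with `s(1)`
invertible. The formal integral is `K = s(1)⁻¹ s`, extended `𝕂`-linearly, and `c = ν^n s(1)`.
Property (d) is the expansion of the divergence theorem for `e^{mφ} f μ(m)`.

Uniqueness is an induction on the order (`IsFormalIntegral.unique`). Property (d) determines `K_r`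
on the functions `(ξφ) f` from the earlier `K_i`. Near the critical point these products span the
functions vanishing there, and the value of `K_r` on constants is fixed by the normalization. -/

open scoped Manifold ContDiff Topology

/-! ### Smoothness and derivative bounds for integrals over `[0, 1]` depending on a parameter. -/

section ParametricIntegral

variable {H G : Type} [NormedAddCommGroup H] [NormedSpace ℝ H] [ProperSpace H]
  [NormedAddCommGroup G] [NormedSpace ℝ G]

omit [ProperSpace H] in
theorem hasFDerivAt_slice_left {F : H × ℝ → G} (hF : ContDiff ℝ 1 F) (x : H) (t : ℝ) :
    HasFDerivAt (fun x => F (x, t))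
      ((fderiv ℝ F (x, t)).comp (ContinuousLinearMap.inl ℝ H ℝ)) x := by
  have h1 : HasFDerivAt F (fderiv ℝ F (x, t)) (x, t) :=
    (hF.differentiable one_ne_zero (x, t)).hasFDerivAt
  exact h1.comp x (hasFDerivAt_prodMk_left x t)

theorem hasFDerivAt_integral_Icc {F : H × ℝ → G} (hF : ContDiff ℝ 1 F) (x₀ : H) :
    HasFDerivAt (fun x => ∫ t in (0 : ℝ)..1, F (x, t))
      (∫ t in (0 : ℝ)..1, (fderiv ℝ F (x₀, t)).comp (ContinuousLinearMap.inl ℝ H ℝ)) x₀ := by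
  have hc : Continuous fun z : H × ℝ =>
      (fderiv ℝ F z).comp (ContinuousLinearMap.inl ℝ H ℝ) :=
    (hF.continuous_fderiv one_ne_zero).clm_comp continuous_const
  obtain ⟨C, hC⟩ := ((isCompact_closedBall x₀ 1).prod
    (isCompact_Icc (a := (0 : ℝ)) (b := 1))).exists_bound_of_continuousOn hc.continuousOn
  refine intervalIntegral.hasFDerivAt_integral_of_dominated_of_fderiv_le
    (s := Metric.closedBall x₀ 1) (bound := fun _ => C)
    (F' := fun x t => (fderiv ℝ F (x, t)).comp (ContinuousLinearMap.inl ℝ H ℝ))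
    (Metric.closedBall_mem_nhds _ one_pos) ?_ ?_ ?_ ?_ ?_ ?_
  · exact Filter.Eventually.of_forall fun x =>
      (hF.continuous.comp (by fun_prop : Continuous fun t : ℝ => (x, t))).aestronglyMeasurable
  · exact (hF.continuous.comp (by fun_prop : Continuous fun t : ℝ => (x₀, t))).intervalIntegrable _ _
  · exact (hc.comp (by fun_prop : Continuous fun t : ℝ => (x₀, t))).aestronglyMeasurable
  · refine Filter.Eventually.of_forall fun t ht x hx => hC (x, t) ⟨hx, ?_⟩
    rw [Set.uIoc_of_le zero_le_one] at ht
    exact ⟨ht.1.le, ht.2⟩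
  · exact intervalIntegrable_const
  · exact Filter.Eventually.of_forall fun t _ x _ => hasFDerivAt_slice_left hF x t

/-- The derivative of the integral is again an integral of this form, with values in a space of
linear maps. The induction therefore has to range over all target spaces `G`. -/
theorem contDiff_integral_Icc {n : ℕ} {F : H × ℝ → G} (hF : ContDiff ℝ n F) :
    ContDiff ℝ n (fun x => ∫ t in (0 : ℝ)..1, F (x, t)) := by
  induction n generalizing G with
  | zero =>
    rw [Nat.cast_zero, contDiff_zero] at *
    exact intervalIntegral.continuous_parametric_intervalIntegral_of_continuous'
      (f := fun x t => F (x, t)) hF 0 1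
  | succ n ih =>
    rw [Nat.cast_add, Nat.cast_one, contDiff_succ_iff_fderiv]
    have h1 : ContDiff ℝ 1 F := hF.of_le (by exact_mod_cast Nat.le_add_left 1 n)
    refine ⟨fun x => (hasFDerivAt_integral_Icc h1 x).differentiableAt, by simp, ?_⟩
    have h2 : fderiv ℝ (fun x => ∫ t in (0 : ℝ)..1, F (x, t)) =
        fun x => ∫ t in (0 : ℝ)..1,
          (fderiv ℝ F (x, t)).comp (ContinuousLinearMap.inl ℝ H ℝ) :=
      funext fun x => (hasFDerivAt_integral_Icc h1 x).fderiv
    rw [h2]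
    refine ih (F := fun z => (fderiv ℝ F z).comp (ContinuousLinearMap.inl ℝ H ℝ)) ?_
    exact (hF.fderiv_right (m := n) (by simp)).clm_comp contDiff_const

theorem contDiff_infty_integral_Icc {F : H × ℝ → G} (hF : ContDiff ℝ ∞ F) :
    ContDiff ℝ ∞ (fun x => ∫ t in (0 : ℝ)..1, F (x, t)) :=
  contDiff_infty.2 fun n => contDiff_integral_Icc (hF.of_le (by exact_mod_cast le_top))

/-- Differentiation commutes with the integral and the interval has length one, so no constant is
lost. This controls the coefficients in Hadamard's lemma. -/
theorem norm_iteratedFDeriv_integral_Icc_le {F : H × ℝ → G} (hF : ContDiff ℝ ∞ F) (j : ℕ)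
    (x₀ : H) {B : ℝ}
    (hB : ∀ t ∈ Set.Icc (0 : ℝ) 1, ‖iteratedFDeriv ℝ j (fun x => F (x, t)) x₀‖ ≤ B) :
    ‖iteratedFDeriv ℝ j (fun x => ∫ t in (0 : ℝ)..1, F (x, t)) x₀‖ ≤ B := by
  induction j generalizing G with
  | zero =>
    simp only [norm_iteratedFDeriv_zero] at *
    have := intervalIntegral.norm_integral_le_of_norm_le_const (a := (0 : ℝ)) (b := 1)
      (f := fun t => F (x₀, t)) (C := B) (fun t ht => by
        rw [Set.uIoc_of_le zero_le_one] at ht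
        exact hB t ⟨ht.1.le, ht.2⟩)
    simpa using this
  | succ j ih =>
    have h1 : ContDiff ℝ 1 F := hF.of_le (by simp)
    rw [← norm_iteratedFDeriv_fderiv]
    have h2 : fderiv ℝ (fun x => ∫ t in (0 : ℝ)..1, F (x, t)) =
        fun x => ∫ t in (0 : ℝ)..1,
          (fderiv ℝ F (x, t)).comp (ContinuousLinearMap.inl ℝ H ℝ) :=
      funext fun x => (hasFDerivAt_integral_Icc h1 x).fderiv
    rw [h2]
    refine ih (F := fun z => (fderiv ℝ F z).comp (ContinuousLinearMap.inl ℝ H ℝ)) ?_ ?_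
    · exact (hF.fderiv_right (m := ∞) (by simp)).clm_comp contDiff_const
    · intro t ht
      have h3 : (fun x => (fderiv ℝ F (x, t)).comp (ContinuousLinearMap.inl ℝ H ℝ)) =
          fderiv ℝ (fun x => F (x, t)) :=
        funext fun x => (hasFDerivAt_slice_left h1 x t).fderiv.symm
      simp only [h3, norm_iteratedFDeriv_fderiv]
      exact hB t ht

end ParametricIntegral

/-! ### Hadamard's lemma with a parameter, and operators of finite order on a compact set. -/

section ParametrizedFunctions

variable {n : ℕ}

/-- The derivative of a function of `(s, y)` along the `k`-th coordinate of `y`. -/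
noncomputable def pd (k : Fin (2 * n)) (u : ℝ × Coord n → ℂ) : ℝ × Coord n → ℂ :=
  fun z => fderiv ℝ u z (0, EuclideanSpace.single k 1)

/-- The contraction towards `o` by the factor `t` in the variable `y`. -/
def contraction (o : Coord n) (t : ℝ) (z : ℝ × Coord n) : ℝ × Coord n :=
  (z.1, o + t • (z.2 - o))

/-- The coefficient of `y_k - o_k` in Hadamard's lemma. -/
noncomputable def hadamard (o : Coord n) (k : Fin (2 * n)) (u : ℝ × Coord n → ℂ) :
    ℝ × Coord n → ℂ :=
  fun z => ∫ t in (0 : ℝ)..1, pd k u (contraction o t z)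

theorem contDiff_pd {k : Fin (2 * n)} {u : ℝ × Coord n → ℂ} (hu : ContDiff ℝ ∞ u) :
    ContDiff ℝ ∞ (pd k u) :=
  (hu.fderiv_right (m := ∞) (by simp)).clm_apply contDiff_const

theorem contDiff_contraction (o : Coord n) :
    ContDiff ℝ ∞ (fun p : (ℝ × Coord n) × ℝ => contraction o p.2 p.1) := by
  unfold contraction; fun_prop

theorem contDiff_contraction_right (o : Coord n) (t : ℝ) : ContDiff ℝ ∞ (contraction o t) := by
  unfold contraction; fun_prop

theorem contDiff_hadamard (o : Coord n) {k : Fin (2 * n)} {u : ℝ × Coord n → ℂ}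
    (hu : ContDiff ℝ ∞ u) : ContDiff ℝ ∞ (hadamard o k u) :=
  contDiff_infty_integral_Icc (F := fun p : (ℝ × Coord n) × ℝ => pd k u (contraction o p.2 p.1))
    ((contDiff_pd hu).comp (contDiff_contraction o))

theorem Coord.sum_smul_single (y : Coord n) :
    y = ∑ k, y k • EuclideanSpace.single k (1 : ℝ) := by
  ext i
  simp [Pi.single_apply]

theorem clm_apply_eq_sum (A : Coord n →L[ℝ] ℂ) (y : Coord n) :
    A y = ∑ k, (y k : ℂ) * A (EuclideanSpace.single k 1) := by
  conv_lhs => rw [Coord.sum_smul_single y]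
  simp

theorem hasFDerivAt_slice {u : ℝ × Coord n → ℂ} (hu : ContDiff ℝ ∞ u) (s : ℝ) (y : Coord n) :
    HasFDerivAt (fun y => u (s, y))
      ((fderiv ℝ u (s, y)).comp (ContinuousLinearMap.inr ℝ ℝ (Coord n))) y :=
  ((hu.differentiable (by simp) (s, y)).hasFDerivAt).comp y (hasFDerivAt_prodMk_right s y)

theorem fderiv_slice {u : ℝ × Coord n → ℂ} (hu : ContDiff ℝ ∞ u) (k : Fin (2 * n)) (s : ℝ)
    (y : Coord n) :
    fderiv ℝ (fun y => u (s, y)) y (EuclideanSpace.single k 1) = pd k u (s, y) := by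
  rw [(hasFDerivAt_slice hu s y).fderiv]; rfl

/-- Hadamard's lemma: the fundamental theorem of calculus along the segment from `o` to `y`, with
`s` as an inert parameter. -/
theorem eq_add_sum_hadamard (o : Coord n) {u : ℝ × Coord n → ℂ} (hu : ContDiff ℝ ∞ u) (s : ℝ)
    (y : Coord n) :
    u (s, y) = u (s, o) + ∑ k, ((y k - o k : ℝ) : ℂ) * hadamard o k u (s, y) := by
  have hd : ∀ t ∈ Set.uIcc (0 : ℝ) 1, HasDerivAt (fun t : ℝ => u (s, o + t • (y - o)))
      (∑ k, ((y k - o k : ℝ) : ℂ) * pd k u (s, o + t • (y - o))) t := by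
    intro t _
    have h1 : HasDerivAt (fun t : ℝ => o + t • (y - o)) (y - o) t := by
      simpa using ((hasDerivAt_id t).smul_const (y - o)).const_add o
    have h2 := (hasFDerivAt_slice hu s (o + t • (y - o))).comp_hasDerivAt t h1
    rw [clm_apply_eq_sum] at h2
    exact h2
  have hc : ∀ k, Continuous fun t : ℝ => ((y k - o k : ℝ) : ℂ) * pd k u (s, o + t • (y - o)) :=
    fun k => continuous_const.mul ((contDiff_pd hu).continuous.comp (by fun_prop))
  have h := intervalIntegral.integral_eq_sub_of_hasDerivAt hd
    ((continuous_finsetSum _ fun k _ => hc k).intervalIntegrable _ _)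
  rw [intervalIntegral.integral_finsetSum (fun k _ => (hc k).intervalIntegrable _ _)] at h
  simp only [intervalIntegral.integral_const_mul, one_smul, zero_smul, add_zero,
    add_sub_cancel] at h
  rw [← sub_eq_iff_eq_add']
  exact h.symm

/-- All derivatives of `u` of order at most `N` are bounded by `B` on `D`. -/
def DerivBound (D : Set (ℝ × Coord n)) (N : ℕ) (B : ℝ) (u : ℝ × Coord n → ℂ) : Prop :=
  ∀ j ≤ N, ∀ z ∈ D, ‖iteratedFDeriv ℝ j u z‖ ≤ B

/-- `A` maps smooth functions to smooth functions and is bounded of order `k` on `D`. -/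
structure BoundedOfOrder (D : Set (ℝ × Coord n)) (k : ℕ)
    (A : (ℝ × Coord n → ℂ) → ℝ × Coord n → ℂ) : Prop where
  smooth : ∀ u, ContDiff ℝ ∞ u → ContDiff ℝ ∞ (A u)
  bound : ∀ N : ℕ, ∃ C : ℝ, 0 ≤ C ∧ ∀ u, ContDiff ℝ ∞ u → ∀ B, 0 ≤ B →
    DerivBound D (N + k) B u → DerivBound D N (C * B) (A u)

variable {D : Set (ℝ × Coord n)}

theorem BoundedOfOrder.id : BoundedOfOrder D 0 (fun u => u) :=
  ⟨fun _ h => h, fun N => ⟨1, zero_le_one, fun u _ B _ h => by simpa using h⟩⟩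

theorem BoundedOfOrder.mono {k l : ℕ} (h : k ≤ l) {A : (ℝ × Coord n → ℂ) → ℝ × Coord n → ℂ}
    (hA : BoundedOfOrder D k A) : BoundedOfOrder D l A := by
  refine ⟨hA.smooth, fun N => ?_⟩
  obtain ⟨C, hC, hb⟩ := hA.bound N
  exact ⟨C, hC, fun u hu B hB hD => hb u hu B hB fun j hj => hD j (by omega)⟩

/-- Losses of derivatives add up. This bookkeeping later shows that the coefficients of the
asymptotic expansion are distributions of finite order. -/
theorem BoundedOfOrder.comp {k l : ℕ} {A A' : (ℝ × Coord n → ℂ) → ℝ × Coord n → ℂ}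
    (hA : BoundedOfOrder D k A) (hA' : BoundedOfOrder D l A') :
    BoundedOfOrder D (k + l) (fun u => A (A' u)) := by
  refine ⟨fun u hu => hA.smooth _ (hA'.smooth u hu), fun N => ?_⟩
  obtain ⟨C, hC, hb⟩ := hA.bound N
  obtain ⟨C', hC', hb'⟩ := hA'.bound (N + k)
  refine ⟨C * C', by positivity, fun u hu B hB hD => ?_⟩
  rw [mul_assoc]
  exact hb _ (hA'.smooth u hu) _ (by positivity) (hb' u hu B hB (by rwa [add_assoc]))

theorem BoundedOfOrder.iterate {k : ℕ} {A : (ℝ × Coord n → ℂ) → ℝ × Coord n → ℂ}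
    (hA : BoundedOfOrder D k A) (r : ℕ) : BoundedOfOrder D (r * k) (A^[r]) := by
  induction r with
  | zero => exact (BoundedOfOrder.id (D := D)).mono (Nat.zero_le _)
  | succ r ih =>
    have := hA.comp ih
    rw [show (r + 1) * k = k + r * k by ring]
    convert this using 2 with u
    exact Function.iterate_succ_apply' A r u

theorem BoundedOfOrder.add {k : ℕ} {A A' : (ℝ × Coord n → ℂ) → ℝ × Coord n → ℂ}
    (hA : BoundedOfOrder D k A) (hA' : BoundedOfOrder D k A') :
    BoundedOfOrder D k (fun u z => A u z + A' u z) := by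
  refine ⟨fun u hu => (hA.smooth u hu).add (hA'.smooth u hu), fun N => ?_⟩
  obtain ⟨C, hC, hb⟩ := hA.bound N
  obtain ⟨C', hC', hb'⟩ := hA'.bound N
  refine ⟨C + C', by positivity, fun u hu B hB hD j hj z hz => ?_⟩
  have e := iteratedFDeriv_add_apply (i := j) (x := z)
    ((hA.smooth u hu).of_le (by exact_mod_cast le_top) |>.contDiffAt)
    ((hA'.smooth u hu).of_le (by exact_mod_cast le_top) |>.contDiffAt)
  change ‖iteratedFDeriv ℝ j (A u + A' u) z‖ ≤ _
  rw [e, add_mul]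
  exact (norm_add_le _ _).trans (add_le_add (hb u hu B hB hD j hj z hz) (hb' u hu B hB hD j hj z hz))

theorem BoundedOfOrder.zero {k : ℕ} : BoundedOfOrder D k (fun _ _ => 0) :=
  ⟨fun _ _ => contDiff_const, fun N => ⟨0, le_rfl, fun u _ B _ _ j _ z _ => by
    simp⟩⟩

theorem BoundedOfOrder.sum {ι : Type*} (t : Finset ι) {k : ℕ}
    {A : ι → (ℝ × Coord n → ℂ) → ℝ × Coord n → ℂ}
    (hA : ∀ i ∈ t, BoundedOfOrder D k (A i)) :
    BoundedOfOrder D k (fun u z => ∑ i ∈ t, A i u z) := by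
  classical
  induction t using Finset.induction_on with
  | empty => simpa using BoundedOfOrder.zero
  | insert a t ha ih =>
    simp only [Finset.sum_insert ha]
    exact (hA a (Finset.mem_insert_self a t)).add
      (ih fun i hi => hA i (Finset.mem_insert_of_mem hi))

theorem BoundedOfOrder.mul_left (hD : IsCompact D) {a : ℝ × Coord n → ℂ} (ha : ContDiff ℝ ∞ a)
    {k : ℕ} {A : (ℝ × Coord n → ℂ) → ℝ × Coord n → ℂ} (hA : BoundedOfOrder D k A) :
    BoundedOfOrder D k (fun u z => a z * A u z) := by
  refine ⟨fun u hu => ha.mul (hA.smooth u hu), fun N => ?_⟩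
  obtain ⟨C, hC, hb⟩ := hA.bound N
  have h1 : ∀ j : ℕ, ∃ M : ℝ, 0 ≤ M ∧ ∀ z ∈ D, ‖iteratedFDeriv ℝ j a z‖ ≤ M := by
    intro j
    obtain ⟨M, hM⟩ := hD.exists_bound_of_continuousOn
      (ha.continuous_iteratedFDeriv (m := j) (by exact_mod_cast le_top)).continuousOn
    exact ⟨max M 0, le_max_right _ _, fun z hz => (hM z hz).trans (le_max_left _ _)⟩
  choose M hM0 hM using h1
  refine ⟨∑ j ∈ Finset.range (N + 1), ∑ i ∈ Finset.range (j + 1), (j.choose i : ℝ) * M i * C,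
    ?_, fun u hu B hB hDu j hj z hz => ?_⟩
  · exact Finset.sum_nonneg fun j _ => Finset.sum_nonneg fun i _ => by
      have := hM0 i; positivity
  · refine (norm_iteratedFDeriv_mul_le ha (hA.smooth u hu) z
      (n := j) (by exact_mod_cast le_top)).trans ?_
    have h2 : ∀ j, 0 ≤ ∑ i ∈ Finset.range (j + 1), (j.choose i : ℝ) * M i * C := fun j =>
      Finset.sum_nonneg fun i _ => by have := hM0 i; positivity
    refine le_trans ?_ (mul_le_mul_of_nonneg_right (Finset.single_le_sum (fun j _ => h2 j)
      (Finset.mem_range.2 (Nat.lt_succ_of_le hj))) hB)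
    rw [Finset.sum_mul]
    refine Finset.sum_le_sum fun i hi => ?_
    have h3 := hb u hu B hB hDu (j - i) (by omega) z hz
    have h4 := hM i z hz
    have h5 := hM0 i
    calc _ ≤ (j.choose i : ℝ) * M i * (C * B) := by gcongr
      _ = _ := by ring

theorem BoundedOfOrder.pd (k : Fin (2 * n)) : BoundedOfOrder D 1 (pd k) := by
  refine ⟨fun u hu => contDiff_pd hu, fun N => ⟨1, zero_le_one, fun u hu B hB h j hj z hz => ?_⟩⟩
  have h1 := norm_iteratedFDeriv_clm_apply_const (𝕜 := ℝ) (f := fderiv ℝ u)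
    (c := ((0 : ℝ), EuclideanSpace.single k (1 : ℝ))) (x := z) (n := j) (N := ∞)
    (hu.fderiv_right (m := ∞) (by simp)).contDiffAt (by exact_mod_cast le_top)
  have h2 : ‖((0 : ℝ), (EuclideanSpace.single k (1 : ℝ) : Coord n))‖ = 1 := by
    simp [Prod.norm_def]
  rw [h2, one_mul, norm_iteratedFDeriv_fderiv] at h1
  rw [one_mul]
  exact h1.trans (h (j + 1) (by omega) z hz)

/-- The contraction is an affine map whose linear part has norm at most one. -/
theorem norm_iteratedFDeriv_comp_contraction_le (o : Coord n) {t : ℝ} (ht : t ∈ Set.Icc (0 : ℝ) 1)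
    {u : ℝ × Coord n → ℂ} (hu : ContDiff ℝ ∞ u) (j : ℕ) (z : ℝ × Coord n) :
    ‖iteratedFDeriv ℝ j (fun z => u (contraction o t z)) z‖ ≤
      ‖iteratedFDeriv ℝ j u (contraction o t z)‖ := by
  let g : ℝ × Coord n →L[ℝ] ℝ × Coord n :=
    (ContinuousLinearMap.fst ℝ ℝ (Coord n)).prod (t • ContinuousLinearMap.snd ℝ ℝ (Coord n))
  let c : ℝ × Coord n := (0, o - t • o)
  have hg : ‖g‖ ≤ 1 := by
    refine ContinuousLinearMap.opNorm_le_bound _ zero_le_one fun z => ?_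
    rw [one_mul]
    refine max_le (le_max_left _ _) ?_
    change ‖t • z.2‖ ≤ ‖z‖
    rw [norm_smul, Real.norm_of_nonneg ht.1]
    exact (mul_le_of_le_one_left (norm_nonneg _) ht.2).trans (le_max_right _ _)
  have e1 : ∀ z, contraction o t z = g z + c := fun z => by
    ext
    · simp [contraction, g, c]
    · simp [contraction, g, c, mul_sub]; ring
  have e2 : (fun z => u (contraction o t z)) = (fun w => u (w + c)) ∘ g := by
    funext z; simp [e1]
  have hu' : ContDiff ℝ ∞ (fun w => u (w + c)) := hu.comp (contDiff_id.add contDiff_const)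
  rw [e2, g.iteratedFDeriv_comp_right hu' z (by exact_mod_cast le_top),
    iteratedFDeriv_comp_add_right, ← e1]
  refine (ContinuousMultilinearMap.norm_compContinuousLinearMap_le _ _).trans ?_
  refine mul_le_of_le_one_right (norm_nonneg _) ?_
  exact Finset.prod_le_one (fun _ _ => norm_nonneg _) fun _ _ => hg

theorem BoundedOfOrder.comp_contraction (o : Coord n) {t : ℝ} (ht : t ∈ Set.Icc (0 : ℝ) 1)
    (hD : ∀ z ∈ D, contraction o t z ∈ D) :
    BoundedOfOrder D 0 (fun u z => u (contraction o t z)) :=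
  ⟨fun _ hu => hu.comp (contDiff_contraction_right o t), fun N => ⟨1, zero_le_one,
    fun u hu B _ h j hj z hz => (norm_iteratedFDeriv_comp_contraction_le o ht hu j z).trans
      (by simpa using h j hj _ (hD z hz))⟩⟩

/-- The coefficient at `z` involves derivatives on the whole segment from `z` towards the central
line, so `D` has to be star-shaped about that line. The one derivative lost is the `pd k` under the
integral. -/
theorem BoundedOfOrder.hadamard (o : Coord n) (k : Fin (2 * n))
    (hD : ∀ t ∈ Set.Icc (0 : ℝ) 1, ∀ z ∈ D, contraction o t z ∈ D) :
    BoundedOfOrder D 1 (hadamard o k) := by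
  refine ⟨fun u hu => contDiff_hadamard o hu, fun N => ?_⟩
  obtain ⟨C, hC, hb⟩ := (BoundedOfOrder.pd (D := D) k).bound N
  refine ⟨C, hC, fun u hu B hB h j hj z hz => ?_⟩
  refine norm_iteratedFDeriv_integral_Icc_le
    (F := fun p : (ℝ × Coord n) × ℝ => _root_.pd k u (contraction o p.2 p.1))
    ((contDiff_pd hu).comp (contDiff_contraction o)) j z fun t ht => ?_
  exact (norm_iteratedFDeriv_comp_contraction_le o ht (contDiff_pd hu) j z).trans
    (hb u hu B hB h j hj _ (hD t ht z hz))

end ParametrizedFunctions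

/-! ### Integration by parts against `e^{mφ}` in coordinates. -/

section IntegrationByParts

variable {n : ℕ}

theorem integral_fderiv_apply_eq_zero {h : Coord n → ℂ} (hh : ContDiff ℝ 1 h)
    (hc : HasCompactSupport h) (v : Coord n) : ∫ y, fderiv ℝ h y v = 0 := by
  have hd : Continuous fun y => fderiv ℝ h y v :=
    (hh.continuous_fderiv one_ne_zero).clm_apply continuous_const
  have hdc : HasCompactSupport fun y => fderiv ℝ h y v := hc.fderiv_apply ℝ v
  have := integral_mul_fderiv_eq_neg_fderiv_mul_of_integrable (μ := MeasureTheory.volume)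
    (f := fun _ : Coord n => (1 : ℂ)) (g := h) (v := v) (by simp)
    (by simpa using hd.integrable_of_hasCompactSupport hdc)
    (by simpa using hh.continuous.integrable_of_hasCompactSupport hc)
    (fun _ _ => differentiableAt_const _)
    (fun x _ => hh.differentiable one_ne_zero x)
  simpa using this

theorem contDiff_of_tsupport_subset {F : Type*} [NormedAddCommGroup F] [NormedSpace ℝ F]
    {E : Type*} [NormedAddCommGroup E] [NormedSpace ℝ E] {k : ℕ∞ω} {g : E → F} {O : Set E}
    (hO : IsOpen O) (hg : ContDiffOn ℝ k g O) (hs : tsupport g ⊆ O) : ContDiff ℝ k g := by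
  rw [contDiff_iff_contDiffAt]
  intro x
  by_cases hx : x ∈ tsupport g
  · exact hg.contDiffAt (hO.mem_nhds (hs hx))
  · have : g =ᶠ[𝓝 x] fun _ => 0 := by
      filter_upwards [(isClosed_tsupport g).isOpen_compl.mem_nhds hx] with y hy
      exact image_eq_zero_of_notMem_tsupport hy
    exact contDiffAt_const.congr_of_eventuallyEq this

/-- The phase is smooth only on `O`. Off the support of `g` the product vanishes locally, so the
formula survives there although `φ` need not be differentiable. -/
theorem fderiv_exp_mul_apply {O : Set (Coord n)} (hO : IsOpen O)
    {φ g : Coord n → ℂ} (hφ : ContDiffOn ℝ ∞ φ O) (hg : ContDiffOn ℝ ∞ g O)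
    (hs : tsupport g ⊆ O) (m : ℝ) (v : Coord n) :
    ContDiff ℝ ∞ (fun y => Complex.exp (m * φ y) * g y) ∧
      ∀ y, fderiv ℝ (fun y => Complex.exp (m * φ y) * g y) y v =
        Complex.exp (m * φ y) * (m * fderiv ℝ φ y v * g y + fderiv ℝ g y v) := by
  have h1 : ContDiffOn ℝ ∞ (fun y => Complex.exp (m * φ y) * g y) O :=
    (Complex.contDiff_exp.comp_contDiffOn (contDiffOn_const.mul hφ)).mul hg
  have hsub : tsupport (fun y => Complex.exp (m * φ y) * g y) ⊆ tsupport g :=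
    tsupport_mul_subset_right
  refine ⟨contDiff_of_tsupport_subset hO h1 (hsub.trans hs), fun y => ?_⟩
  by_cases hy : y ∈ tsupport g
  · have hyO := hO.mem_nhds (hs hy)
    have d1 := ((hφ.contDiffAt hyO).differentiableAt (by simp)).hasFDerivAt
    have d2 := ((hg.contDiffAt hyO).differentiableAt (by simp)).hasFDerivAt
    have d3 : HasFDerivAt (fun y => Complex.exp (m * φ y) * g y) _ y :=
      ((d1.const_mul (m : ℂ)).cexp).mul d2
    rw [d3.fderiv]
    simp
    ring
  · have hz : g =ᶠ[𝓝 y] fun _ => 0 := by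
      filter_upwards [(isClosed_tsupport g).isOpen_compl.mem_nhds hy] with y hy
      exact image_eq_zero_of_notMem_tsupport hy
    have hz' : (fun y => Complex.exp (m * φ y) * g y) =ᶠ[𝓝 y] fun _ => 0 := by
      filter_upwards [hz] with x hx
      simp [hx]
    rw [hz.fderiv_eq, hz'.fderiv_eq, hz.eq_of_nhds]
    simp

/-- The integrand is a total derivative with compact support. This identity trades a factor `m`
times a derivative of the phase for a derivative of the amplitude. -/
theorem integral_exp_mul_divergence_eq_zero {O : Set (Coord n)} (hO : IsOpen O)
    {φ g : Coord n → ℂ} (hφ : ContDiffOn ℝ ∞ φ O) (hg : ContDiffOn ℝ ∞ g O)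
    (hs : tsupport g ⊆ O) (hc : HasCompactSupport g) (m : ℝ) (v : Coord n) :
    ∫ y, Complex.exp (m * φ y) * (m * fderiv ℝ φ y v * g y + fderiv ℝ g y v) = 0 := by
  obtain ⟨h1, h2⟩ := fderiv_exp_mul_apply hO hφ hg hs m v
  simp only [← h2]
  exact integral_fderiv_apply_eq_zero (h1.of_le (by simp)) hc.mul_left v

theorem integral_exp_mul_sum_divergence_eq_zero {O : Set (Coord n)} (hO : IsOpen O)
    {φ : Coord n → ℂ} (hφ : ContDiffOn ℝ ∞ φ O) {ι : Type*} (t : Finset ι)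
    {g : ι → Coord n → ℂ} (hg : ∀ k, ContDiffOn ℝ ∞ (g k) O) (hs : ∀ k, tsupport (g k) ⊆ O)
    (hc : ∀ k, HasCompactSupport (g k)) (m : ℝ) (v : ι → Coord n) :
    ∫ y, ∑ k ∈ t, Complex.exp (m * φ y) *
      (m * fderiv ℝ φ y (v k) * g k y + fderiv ℝ (g k) y (v k)) = 0 := by
  rw [MeasureTheory.integral_finsetSum]
  · exact Finset.sum_eq_zero fun k _ =>
      integral_exp_mul_divergence_eq_zero hO hφ (hg k) (hs k) (hc k) m (v k)
  · intro k _
    obtain ⟨h1, h2⟩ := fderiv_exp_mul_apply hO hφ (hg k) (hs k) m (v k)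
    simp only [← h2]
    exact ((h1.continuous_fderiv (by simp)).clm_apply
      continuous_const).integrable_of_hasCompactSupport
        (HasCompactSupport.fderiv_apply ℝ (hc k).mul_left (v k))

end IntegrationByParts

/-! ### Reduction of an arbitrary amplitude to the cutoff function. -/

section Reduction

variable {n : ℕ}

/-- A smooth family of phases `Φ (s, ·)` with nonpositive real part, such that near `o` the
coordinates `y_k - o_k` are smooth combinations of the derivatives of the phase. -/
structure PhaseFamily (n : ℕ) where
  o : Coord n
  bump : ContDiffBump o
  Φ : ℝ × Coord n → ℂ
  smooth : ContDiff ℝ ∞ Φ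
  re_nonpos : ∀ z, (Φ z).re ≤ 0
  inv : Fin (2 * n) → Fin (2 * n) → ℝ × Coord n → ℂ
  smooth_inv : ∀ k j, ContDiff ℝ ∞ (inv k j)
  coord_eq : ∀ z : ℝ × Coord n, z.2 ∈ Metric.closedBall o bump.rOut →
    ∀ k, ((z.2 k - o k : ℝ) : ℂ) = ∑ j, inv k j z * pd j Φ z

namespace PhaseFamily

variable (P : PhaseFamily n)

/-- The cutoff function, as a function of `(s, y)`. -/
noncomputable def cutoff (z : ℝ × Coord n) : ℂ := (P.bump z.2 : ℂ)

theorem contDiff_cutoff : ContDiff ℝ ∞ P.cutoff :=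
  Complex.ofRealCLM.contDiff.comp (P.bump.contDiff.comp contDiff_snd)

/-- The coefficients expressing `1 - cutoff` in the ideal generated by the coordinates. -/
noncomputable def radial (k : Fin (2 * n)) (z : ℝ × Coord n) : ℂ :=
  (((1 - P.bump z.2) * (z.2 k - P.o k) / ‖z.2 - P.o‖ ^ 2 : ℝ) : ℂ)

/-- The bump function is `1` near the centre, so the numerator vanishes in a neighbourhood of the
only zero of the denominator. -/
theorem contDiff_radial (k : Fin (2 * n)) : ContDiff ℝ ∞ (P.radial k) := by
  refine Complex.ofRealCLM.contDiff.comp (contDiff_iff_contDiffAt.2 fun z => ?_)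
  by_cases hz : z.2 = P.o
  · have h1 : ∀ᶠ w in 𝓝 z, (1 - P.bump w.2) * (w.2 k - P.o k) / ‖w.2 - P.o‖ ^ 2 = 0 := by
      have : ∀ᶠ w : ℝ × Coord n in 𝓝 z, w.2 ∈ Metric.closedBall P.o P.bump.rIn :=
        continuousAt_snd.eventually_mem
          (by rw [hz]; exact Metric.closedBall_mem_nhds _ P.bump.rIn_pos)
      filter_upwards [this] with w hw
      rw [P.bump.one_of_mem_closedBall hw]
      simp
    exact contDiffAt_const.congr_of_eventuallyEq h1
  · have h2 : ‖z.2 - P.o‖ ^ 2 ≠ 0 := by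
      simpa [sub_eq_zero] using hz
    have h3 : ContDiff ℝ ∞ fun w : ℝ × Coord n => w.2 k :=
      (EuclideanSpace.proj (𝕜 := ℝ) k).contDiff.comp contDiff_snd
    refine ContDiffAt.div ?_ ?_ h2
    · exact ((contDiff_const.sub (P.bump.contDiff.comp contDiff_snd)).mul
        (h3.sub contDiff_const)).contDiffAt
    · exact ((contDiff_snd.sub contDiff_const).norm_sq ℝ).contDiffAt

theorem sum_radial (z : ℝ × Coord n) :
    ∑ k, ((z.2 k - P.o k : ℝ) : ℂ) * P.radial k z = 1 - P.cutoff z := by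
  have h0 : ‖z.2 - P.o‖ ^ 2 = ∑ k, (z.2 k - P.o k) ^ 2 := by
    rw [EuclideanSpace.norm_sq_eq]; simp
  have : ∑ k, (z.2 k - P.o k) * ((1 - P.bump z.2) * (z.2 k - P.o k) / ‖z.2 - P.o‖ ^ 2) =
      1 - P.bump z.2 := by
    by_cases hz : z.2 = P.o
    · have : P.bump z.2 = 1 :=
        P.bump.one_of_mem_closedBall (by rw [hz]; exact Metric.mem_closedBall_self P.bump.rIn_pos.le)
      simp [this]
    · have h2 : ‖z.2 - P.o‖ ^ 2 ≠ 0 := by simpa [sub_eq_zero] using hz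
      calc _ = ∑ k, (z.2 k - P.o k) ^ 2 * ((1 - P.bump z.2) / ‖z.2 - P.o‖ ^ 2) :=
            Finset.sum_congr rfl fun k _ => by ring
        _ = _ := by rw [← Finset.sum_mul, ← h0, mul_div_cancel₀ _ h2]
  have h := congrArg Complex.ofReal this
  simp only [radial, cutoff]
  push_cast at h ⊢
  exact h

/-- The function `u` minus its value on the central line times the cutoff. -/
noncomputable def resid (u : ℝ × Coord n → ℂ) (z : ℝ × Coord n) : ℂ :=
  u z + (-P.cutoff z) * u (contraction P.o 0 z)

/-- The coefficients of `resid u` with respect to the coordinates `y_k - o_k`. -/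
noncomputable def coordCoeff (k : Fin (2 * n)) (u : ℝ × Coord n → ℂ) (z : ℝ × Coord n) : ℂ :=
  P.cutoff z * hadamard P.o k (P.resid u) z + P.radial k z * P.resid u z

/-- The coefficients of `resid u` with respect to the derivatives of the phase. -/
noncomputable def gradCoeff (j : Fin (2 * n)) (u : ℝ × Coord n → ℂ) (z : ℝ × Coord n) : ℂ :=
  ∑ k, P.inv k j z * P.coordCoeff k u z

/-- The operator that lowers the order in `1 / m`. -/
noncomputable def lower (u : ℝ × Coord n → ℂ) (z : ℝ × Coord n) : ℂ :=
  ∑ j, pd j (P.gradCoeff j u) z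

/-- `u` vanishes outside of the support of the cutoff. -/
def Supported (u : ℝ × Coord n → ℂ) : Prop :=
  ∀ z : ℝ × Coord n, z.2 ∉ Metric.closedBall P.o P.bump.rOut → u z = 0

theorem boundedOfOrder_resid {D : Set (ℝ × Coord n)} (hD : IsCompact D)
    (hs : ∀ t ∈ Set.Icc (0 : ℝ) 1, ∀ z ∈ D, contraction P.o t z ∈ D) :
    BoundedOfOrder D 0 P.resid :=
  BoundedOfOrder.id.add
    ((BoundedOfOrder.comp_contraction P.o (t := 0) (by simp) (hs 0 (by simp))).mul_left hD
      P.contDiff_cutoff.neg)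

theorem boundedOfOrder_coordCoeff {D : Set (ℝ × Coord n)} (hD : IsCompact D)
    (hs : ∀ t ∈ Set.Icc (0 : ℝ) 1, ∀ z ∈ D, contraction P.o t z ∈ D) (k : Fin (2 * n)) :
    BoundedOfOrder D 1 (P.coordCoeff k) :=
  (((BoundedOfOrder.hadamard P.o k hs).comp (P.boundedOfOrder_resid hD hs)).mul_left hD
    P.contDiff_cutoff).add
    (((P.boundedOfOrder_resid hD hs).mono zero_le_one).mul_left hD (P.contDiff_radial k))

theorem boundedOfOrder_gradCoeff {D : Set (ℝ × Coord n)} (hD : IsCompact D)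
    (hs : ∀ t ∈ Set.Icc (0 : ℝ) 1, ∀ z ∈ D, contraction P.o t z ∈ D) (j : Fin (2 * n)) :
    BoundedOfOrder D 1 (P.gradCoeff j) :=
  BoundedOfOrder.sum _ fun k _ => (P.boundedOfOrder_coordCoeff hD hs k).mul_left hD
    (P.smooth_inv k j)

theorem boundedOfOrder_lower {D : Set (ℝ × Coord n)} (hD : IsCompact D)
    (hs : ∀ t ∈ Set.Icc (0 : ℝ) 1, ∀ z ∈ D, contraction P.o t z ∈ D) :
    BoundedOfOrder D 2 P.lower :=
  BoundedOfOrder.sum _ fun j _ =>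
    (BoundedOfOrder.pd j).comp (P.boundedOfOrder_gradCoeff hD hs j)

variable {P} {u : ℝ × Coord n → ℂ}

theorem contDiff_resid (hu : ContDiff ℝ ∞ u) : ContDiff ℝ ∞ (P.resid u) :=
  (P.boundedOfOrder_resid isCompact_empty (by simp)).smooth u hu

theorem contDiff_gradCoeff (hu : ContDiff ℝ ∞ u) (j : Fin (2 * n)) :
    ContDiff ℝ ∞ (P.gradCoeff j u) :=
  (P.boundedOfOrder_gradCoeff isCompact_empty (by simp) j).smooth u hu

theorem contDiff_lower (hu : ContDiff ℝ ∞ u) : ContDiff ℝ ∞ (P.lower u) :=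
  (P.boundedOfOrder_lower isCompact_empty (by simp)).smooth u hu

theorem contDiff_lower_iterate (hu : ContDiff ℝ ∞ u) (r : ℕ) : ContDiff ℝ ∞ (P.lower^[r] u) :=
  ((P.boundedOfOrder_lower isCompact_empty (by simp)).iterate r).smooth u hu

theorem contraction_zero (o : Coord n) (z : ℝ × Coord n) : contraction o 0 z = (z.1, o) := by
  simp [contraction]

theorem bump_center : P.bump P.o = 1 :=
  P.bump.one_of_mem_closedBall (Metric.mem_closedBall_self P.bump.rIn_pos.le)

/-- The Hadamard coefficients of a compactly supported function need not have compact support. They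
are therefore used only under the cutoff; on the complementary part one divides by `|y - o|²`
instead (`sum_radial`). The resulting coefficients keep the support of `u`. -/
theorem resid_eq_coord (hu : ContDiff ℝ ∞ u) (z : ℝ × Coord n) :
    P.resid u z = ∑ k, ((z.2 k - P.o k : ℝ) : ℂ) * P.coordCoeff k u z := by
  have h1 : P.resid u (z.1, P.o) = 0 := by
    simp [resid, contraction_zero, cutoff, bump_center]
  have h2 := eq_add_sum_hadamard P.o (contDiff_resid (P := P) hu) z.1 z.2
  rw [h1, zero_add] at h2
  have h3 := P.sum_radial z
  calc P.resid u z = P.cutoff z * P.resid u z + (1 - P.cutoff z) * P.resid u z := by ring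
    _ = P.cutoff z * (∑ k, ((z.2 k - P.o k : ℝ) : ℂ) * hadamard P.o k (P.resid u) z) +
        (∑ k, ((z.2 k - P.o k : ℝ) : ℂ) * P.radial k z) * P.resid u z := by rw [h3, ← h2]
    _ = _ := by
      rw [Finset.mul_sum, Finset.sum_mul, ← Finset.sum_add_distrib]
      exact Finset.sum_congr rfl fun k _ => by unfold coordCoeff; ring

/-- The coordinates lie in the ideal generated by the derivatives of the phase by `coord_eq`, which
is substituted in the coordinate expansion. -/
theorem resid_eq_of_mem (hu : ContDiff ℝ ∞ u) {z : ℝ × Coord n}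
    (hz : z.2 ∈ Metric.closedBall P.o P.bump.rOut) :
    P.resid u z = ∑ j, pd j P.Φ z * P.gradCoeff j u z := by
  rw [resid_eq_coord hu]
  simp only [P.coord_eq z hz, gradCoeff, Finset.sum_mul, Finset.mul_sum]
  rw [Finset.sum_comm]
  exact Finset.sum_congr rfl fun j _ => Finset.sum_congr rfl fun k _ => by ring

theorem supported_cutoff : P.Supported P.cutoff := fun z hz => by
  have := P.bump.zero_of_le_dist (x := z.2)
    (le_of_lt (by simpa [Metric.mem_closedBall] using hz))
  simp [cutoff, this]

theorem Supported.mul_left (hs : P.Supported u) (a : ℝ × Coord n → ℂ) :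
    P.Supported (fun z => a z * u z) := fun z hz => by simp [hs z hz]

theorem Supported.resid (hs : P.Supported u) : P.Supported (P.resid u) := fun z hz => by
  simp [PhaseFamily.resid, hs z hz, supported_cutoff z hz]

theorem Supported.gradCoeff (hs : P.Supported u) (j : Fin (2 * n)) :
    P.Supported (P.gradCoeff j u) := fun z hz => by
  simp [PhaseFamily.gradCoeff, coordCoeff, hs.resid z hz, supported_cutoff z hz]

theorem Supported.pd (hs : P.Supported u) (j : Fin (2 * n)) :
    P.Supported (pd j u) := fun z hz => by
  have : u =ᶠ[𝓝 z] fun _ => 0 := by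
    filter_upwards [(Metric.isClosed_closedBall.isOpen_compl.preimage continuous_snd).mem_nhds hz]
      with w hw using hs w hw
  simp [_root_.pd, this.fderiv_eq]

theorem Supported.lower (hs : P.Supported u) : P.Supported (P.lower u) := fun z hz =>
  Finset.sum_eq_zero fun j _ => (hs.gradCoeff j).pd j z hz

theorem Supported.lower_iterate (hs : P.Supported u) (r : ℕ) : P.Supported (P.lower^[r] u) := by
  induction r with
  | zero => exact hs
  | succ r ih => rw [Function.iterate_succ_apply']; exact ih.lower

theorem Supported.hasCompactSupport (hs : P.Supported u) (s : ℝ) :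
    HasCompactSupport fun y => u (s, y) :=
  HasCompactSupport.intro (isCompact_closedBall P.o P.bump.rOut) fun y hy => hs (s, y) hy

theorem resid_eq (hu : ContDiff ℝ ∞ u) (hs : P.Supported u) (z : ℝ × Coord n) :
    P.resid u z = ∑ j, pd j P.Φ z * P.gradCoeff j u z := by
  by_cases hz : z.2 ∈ Metric.closedBall P.o P.bump.rOut
  · exact resid_eq_of_mem hu hz
  · rw [hs.resid z hz]
    exact (Finset.sum_eq_zero fun j _ => by rw [hs.gradCoeff j z hz, mul_zero]).symm

variable (P) in
/-- The oscillatory integral with the phase `Φ (s, ·)`. -/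
noncomputable def osc (s m : ℝ) (u : ℝ × Coord n → ℂ) : ℂ :=
  ∫ y, Complex.exp (m * P.Φ (s, y)) * u (s, y)

theorem contDiff_slice (hu : ContDiff ℝ ∞ u) (s : ℝ) : ContDiff ℝ ∞ fun y => u (s, y) :=
  hu.comp (contDiff_const.prodMk contDiff_id)

theorem integrable_osc (hu : ContDiff ℝ ∞ u) (hs : P.Supported u) (s m : ℝ) :
    MeasureTheory.Integrable fun y => Complex.exp (m * P.Φ (s, y)) * u (s, y) :=
  ((Complex.continuous_exp.comp (continuous_const.mul
    (contDiff_slice P.smooth s).continuous)).mul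
      (contDiff_slice hu s).continuous).integrable_of_hasCompactSupport
        (hs.hasCompactSupport s).mul_left

/-- Since `resid u = ∑ ∂_jΦ g_j`, the product `m e^{mΦ} resid u` equals `∑ ∂_j(e^{mΦ}) g_j`.
Integrating by parts moves the derivatives onto the `g_j`, and the sum of the `∂_j g_j` is `lower
u`. -/
theorem osc_lower (hu : ContDiff ℝ ∞ u) (hs : P.Supported u) (s m : ℝ) :
    m * P.osc s m (P.resid u) = - P.osc s m (P.lower u) := by
  have h1 : ∀ j, ∫ y, Complex.exp (m * P.Φ (s, y)) *
      (m * pd j P.Φ (s, y) * P.gradCoeff j u (s, y) + pd j (P.gradCoeff j u) (s, y)) = 0 := by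
    intro j
    have := integral_exp_mul_divergence_eq_zero isOpen_univ
      (contDiff_slice P.smooth s).contDiffOn
      (contDiff_slice (contDiff_gradCoeff (P := P) hu j) s).contDiffOn (Set.subset_univ _)
      ((hs.gradCoeff j).hasCompactSupport s) m (EuclideanSpace.single j 1)
    simpa only [fderiv_slice P.smooth, fderiv_slice (contDiff_gradCoeff (P := P) hu j)] using this
  have h2 : ∫ y, ∑ j, Complex.exp (m * P.Φ (s, y)) *
      (m * pd j P.Φ (s, y) * P.gradCoeff j u (s, y) + pd j (P.gradCoeff j u) (s, y)) = 0 := by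
    rw [MeasureTheory.integral_finsetSum]
    · exact Finset.sum_eq_zero fun j _ => h1 j
    · intro j _
      refine integrable_osc (P := P) (u := fun z => m * pd j P.Φ z * P.gradCoeff j u z +
        pd j (P.gradCoeff j u) z) ?_ ?_ s m
      · exact ((contDiff_const.mul (contDiff_pd P.smooth)).mul (contDiff_gradCoeff hu j)).add
          (contDiff_pd (contDiff_gradCoeff hu j))
      · intro z hz
        simp [hs.gradCoeff j z hz, (hs.gradCoeff j).pd j z hz]
  rw [eq_neg_iff_add_eq_zero, ← h2]
  unfold osc
  rw [← MeasureTheory.integral_const_mul, ← MeasureTheory.integral_add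
    ((integrable_osc (contDiff_resid hu) hs.resid s m).const_mul _)
    (integrable_osc (contDiff_lower hu) hs.lower s m)]
  congr 1
  funext y
  rw [resid_eq hu hs, lower, Finset.mul_sum, Finset.mul_sum, Finset.mul_sum,
    ← Finset.sum_add_distrib]
  exact Finset.sum_congr rfl fun j _ => by ring

theorem osc_resid (hu : ContDiff ℝ ∞ u) (hs : P.Supported u) (s m : ℝ) :
    P.osc s m u = u (s, P.o) * P.osc s m P.cutoff + P.osc s m (P.resid u) := by
  unfold osc
  rw [← MeasureTheory.integral_const_mul, ← MeasureTheory.integral_add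
    ((integrable_osc P.contDiff_cutoff supported_cutoff s m).const_mul _)
    (integrable_osc (contDiff_resid hu) hs.resid s m)]
  congr 1
  funext y
  simp only [resid, contraction_zero]
  ring

theorem osc_eq (hu : ContDiff ℝ ∞ u) (hs : P.Supported u) (s : ℝ) {m : ℝ} (hm : m ≠ 0) :
    P.osc s m u = u (s, P.o) * P.osc s m P.cutoff + -(m : ℂ)⁻¹ * P.osc s m (P.lower u) := by
  have h := osc_lower hu hs s m
  have hm' : (m : ℂ) ≠ 0 := by exact_mod_cast hm
  rw [osc_resid hu hs, neg_mul, ← mul_neg, ← h, inv_mul_cancel_left₀ hm']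

/-- Iteration of `osc_eq`: each step records the value of the current amplitude on the central line
and gains a factor `-1/m`. The identity is exact, and the integral of the cutoff is the only unknown
left besides the remainder. -/
theorem osc_expansion (hu : ContDiff ℝ ∞ u) (hs : P.Supported u) (s : ℝ) {m : ℝ} (hm : m ≠ 0)
    (N : ℕ) :
    P.osc s m u = (∑ r ∈ Finset.range N, (-(m : ℂ)⁻¹) ^ r * (P.lower^[r] u) (s, P.o)) *
      P.osc s m P.cutoff + (-(m : ℂ)⁻¹) ^ N * P.osc s m (P.lower^[N] u) := by
  induction N with
  | zero => simp
  | succ N ih =>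
    rw [ih, osc_eq (contDiff_lower_iterate hu N) (hs.lower_iterate N) s hm,
      Finset.sum_range_succ, Function.iterate_succ_apply']
    ring

theorem norm_exp_mul_le_one {m : ℝ} (hm : 0 ≤ m) {w : ℂ} (hw : w.re ≤ 0) :
    ‖Complex.exp (m * w)‖ ≤ 1 := by
  rw [Complex.norm_exp, Complex.re_ofReal_mul]
  exact Real.exp_le_one_iff.2 (mul_nonpos_of_nonneg_of_nonpos hm hw)

/-- The exponential has modulus at most one because `Re Φ ≤ 0`, so the bound is uniform both in `m`
and in the deformation parameter. -/
theorem exists_norm_osc_le (hu : ContDiff ℝ ∞ u) (hs : P.Supported u) (a b : ℝ) :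
    ∃ C, 0 ≤ C ∧ ∀ s ∈ Set.Icc a b, ∀ m : ℝ, 0 ≤ m → ‖P.osc s m u‖ ≤ C := by
  obtain ⟨C, hC⟩ := ((isCompact_Icc (a := a) (b := b)).prod
    (isCompact_closedBall P.o P.bump.rOut)).exists_bound_of_continuousOn hu.continuous.continuousOn
  refine ⟨max C 0 * MeasureTheory.volume.real (Metric.closedBall P.o P.bump.rOut), by positivity,
    fun s hs' m hm => ?_⟩
  have h1 : P.osc s m u = ∫ y in Metric.closedBall P.o P.bump.rOut,
      Complex.exp (m * P.Φ (s, y)) * u (s, y) := by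
    refine (MeasureTheory.setIntegral_eq_integral_of_forall_compl_eq_zero fun y hy => ?_).symm
    rw [hs (s, y) hy, mul_zero]
  rw [h1]
  refine MeasureTheory.norm_setIntegral_le_of_norm_le_const
    (isCompact_closedBall P.o P.bump.rOut).measure_lt_top fun y hy => ?_
  rw [norm_mul]
  calc _ ≤ 1 * max C 0 := mul_le_mul (norm_exp_mul_le_one hm (P.re_nonpos _))
        ((hC (s, y) ⟨hs', hy⟩).trans (le_max_left _ _)) (norm_nonneg _) zero_le_one
    _ = _ := one_mul _

end PhaseFamily

end Reduction

/-! ### Calculus of asymptotic power series in `1/m`. -/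

section PowerAsymptotics

open Filter Asymptotics

/-- The partial sum of the power series `a` in powers of `1 / m`. -/
noncomputable def partialSum (a : PowerSeries ℂ) (N : ℕ) (m : ℝ) : ℂ :=
  ∑ r ∈ Finset.range N, PowerSeries.coeff r a * (m : ℂ)⁻¹ ^ r

/-- `v(m) ∼ ∑_r a_r m^(-r)` as `m → +∞`. -/
def PowerAsymp (v : ℝ → ℂ) (a : PowerSeries ℂ) : Prop :=
  ∀ N : ℕ, (fun m => v m - partialSum a N m) =O[atTop] fun m : ℝ => m⁻¹ ^ N

theorem isBigO_inv_pow_real_of_le {N r : ℕ} (h : N ≤ r) :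
    (fun m : ℝ => m⁻¹ ^ r) =O[atTop] fun m : ℝ => m⁻¹ ^ N := by
  refine IsBigO.of_bound 1 ?_
  filter_upwards [eventually_ge_atTop 1] with m hm
  have h0 : (0 : ℝ) ≤ m⁻¹ := inv_nonneg.2 (by linarith)
  rw [norm_pow, norm_pow, Real.norm_of_nonneg h0, one_mul]
  exact pow_le_pow_of_le_one h0 (inv_le_one_of_one_le₀ hm) h

theorem isBigO_inv_pow_self (r : ℕ) :
    (fun m : ℝ => (m : ℂ)⁻¹ ^ r) =O[atTop] fun m : ℝ => m⁻¹ ^ r :=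
  isBigO_of_le _ fun m => by simp

theorem isBigO_inv_pow_of_le {N r : ℕ} (h : N ≤ r) :
    (fun m : ℝ => (m : ℂ)⁻¹ ^ r) =O[atTop] fun m : ℝ => m⁻¹ ^ N :=
  (isBigO_inv_pow_self r).trans (isBigO_inv_pow_real_of_le h)

theorem isBigO_one_inv_pow_zero {v : ℝ → ℂ} {C : ℝ} (h : ∀ᶠ m in atTop, ‖v m‖ ≤ C) :
    v =O[atTop] fun m : ℝ => m⁻¹ ^ 0 :=
  IsBigO.of_bound C (by simpa using h)

/-- If the coefficients below `r` vanish, division by `m^(-r)` leaves `d r` plus terms tending to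
zero, so `d r = 0`. -/
theorem eq_zero_of_sum_isBigO {N : ℕ} {d : ℕ → ℂ}
    (h : (fun m : ℝ => ∑ r ∈ Finset.range N, d r * (m : ℂ)⁻¹ ^ r) =O[atTop]
      fun m : ℝ => m⁻¹ ^ N) : ∀ r < N, d r = 0 := by
  intro r
  induction r using Nat.strong_induction_on with
  | _ r ih =>
    intro hr
    have e : ∀ m : ℝ, ∑ i ∈ Finset.range N, d i * (m : ℂ)⁻¹ ^ i =
        d r * (m : ℂ)⁻¹ ^ r + ∑ i ∈ Finset.Ico (r + 1) N, d i * (m : ℂ)⁻¹ ^ i := by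
      intro m
      rw [Finset.range_eq_Ico, ← Finset.sum_Ico_consecutive _ (Nat.zero_le (r + 1)) hr,
        ← Finset.range_eq_Ico, Finset.sum_range_succ, Finset.sum_eq_zero, zero_add]
      intro i hi
      rw [ih i (Finset.mem_range.1 hi) ((Finset.mem_range.1 hi).trans hr), zero_mul]
    have h1 : (fun m : ℝ => ∑ i ∈ Finset.Ico (r + 1) N, d i * (m : ℂ)⁻¹ ^ i) =O[atTop]
        fun m : ℝ => m⁻¹ ^ (r + 1) :=
      IsBigO.fun_sum fun i hi => (isBigO_inv_pow_of_le (Finset.mem_Ico.1 hi).1).const_mul_left _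
    have h2 : (fun m : ℝ => d r * (m : ℂ)⁻¹ ^ r) =O[atTop] fun m : ℝ => m⁻¹ ^ (r + 1) := by
      refine ((h.trans (isBigO_inv_pow_real_of_le hr)).sub h1).congr_left fun m => ?_
      rw [e m]; ring
    obtain ⟨C, hC⟩ := h2.bound
    have h3 : ∀ᶠ m : ℝ in atTop, ‖d r‖ ≤ C * m⁻¹ := by
      filter_upwards [hC, eventually_gt_atTop 0] with m hm hm0
      have h0 : 0 < m⁻¹ := inv_pos.2 hm0
      rw [norm_mul, norm_pow, norm_inv, Complex.norm_real, norm_pow, norm_inv,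
        Real.norm_of_nonneg hm0.le, pow_succ, ← mul_assoc, mul_right_comm] at hm
      exact le_of_mul_le_mul_right hm (pow_pos h0 r)
    have h4 : Tendsto (fun m : ℝ => C * m⁻¹) atTop (𝓝 (C * 0)) :=
      tendsto_inv_atTop_zero.const_mul C
    rw [mul_zero] at h4
    exact norm_le_zero_iff.1 (ge_of_tendsto h4 h3)

theorem coeff_eq_of_isBigO {v w : ℝ → ℂ} {a b : PowerSeries ℂ} {N : ℕ}
    (ha : (fun m => v m - partialSum a N m) =O[atTop] fun m : ℝ => m⁻¹ ^ N)
    (hb : (fun m => w m - partialSum b N m) =O[atTop] fun m : ℝ => m⁻¹ ^ N)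
    (h : (fun m => v m - w m) =O[atTop] fun m : ℝ => m⁻¹ ^ N) {r : ℕ} (hr : r < N) :
    PowerSeries.coeff r a = PowerSeries.coeff r b := by
  have := eq_zero_of_sum_isBigO (N := N)
    (d := fun r => PowerSeries.coeff r a - PowerSeries.coeff r b) ?_ r hr
  · exact sub_eq_zero.1 this
  · refine ((hb.sub ha).add h).congr_left fun m => ?_
    simp only [partialSum, sub_mul, Finset.sum_sub_distrib]
    ring

namespace PowerAsymp

theorem unique {v : ℝ → ℂ} {a b : PowerSeries ℂ} (ha : PowerAsymp v a) (hb : PowerAsymp v b) :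
    a = b := by
  ext r
  exact coeff_eq_of_isBigO (ha (r + 1)) (hb (r + 1))
    ((isBigO_zero _ _).congr_left fun m => (sub_self _).symm) (Nat.lt_succ_self r)

/-- Approximation up to each order by functions with an expansion. -/
theorem of_forall_approx {v : ℝ → ℂ} {a : PowerSeries ℂ}
    (h : ∀ N, ∃ w b, PowerAsymp w b ∧
      ((fun m => v m - w m) =O[atTop] fun m : ℝ => m⁻¹ ^ N) ∧
      ∀ r < N, PowerSeries.coeff r a = PowerSeries.coeff r b) : PowerAsymp v a := by
  intro N
  obtain ⟨w, b, hw, hvw, hab⟩ := h N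
  refine ((hw N).add hvw).congr_left fun m => ?_
  have : partialSum a N m = partialSum b N m :=
    Finset.sum_congr rfl fun r hr => by rw [hab r (Finset.mem_range.1 hr)]
  rw [this]; ring

theorem congr {v w : ℝ → ℂ} {a : PowerSeries ℂ} (hw : PowerAsymp w a)
    (h : ∀ N : ℕ, (fun m => v m - w m) =O[atTop] fun m : ℝ => m⁻¹ ^ N) : PowerAsymp v a :=
  of_forall_approx fun N => ⟨w, a, hw, h N, fun _ _ => rfl⟩

/-- A function approximable to every order by functions with expansions has one itself: by
uniqueness, approximants of order at least `N` agree in their first `N` coefficients. -/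
theorem exists_of_forall_approx {v : ℝ → ℂ}
    (h : ∀ N : ℕ, ∃ w b, PowerAsymp w b ∧
      ((fun m => v m - w m) =O[atTop] fun m : ℝ => m⁻¹ ^ N)) : ∃ a, PowerAsymp v a := by
  choose w b hw hvw using h
  -- An error of order `r + 1` is the first that determines the coefficient of index `r`.
  refine ⟨PowerSeries.mk fun r => PowerSeries.coeff r (b (r + 1)),
    of_forall_approx fun N => ⟨w N, b N, hw N, hvw N, fun r hr => ?_⟩⟩
  rw [PowerSeries.coeff_mk]
  refine coeff_eq_of_isBigO (hw (r + 1) (r + 1)) (hw N (r + 1)) ?_ (Nat.lt_succ_self r)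
  refine (((hvw N).trans (isBigO_inv_pow_real_of_le hr)).sub (hvw (r + 1))).congr_left
    fun m => by ring

theorem add {v w : ℝ → ℂ} {a b : PowerSeries ℂ} (hv : PowerAsymp v a) (hw : PowerAsymp w b) :
    PowerAsymp (fun m => v m + w m) (a + b) := fun N => by
  refine ((hv N).add (hw N)).congr_left fun m => ?_
  simp only [partialSum, map_add, add_mul, Finset.sum_add_distrib]
  ring

theorem const_mul {v : ℝ → ℂ} {a : PowerSeries ℂ} (c : ℂ) (hv : PowerAsymp v a) :
    PowerAsymp (fun m => c * v m) (c • a) := fun N => by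
  refine ((hv N).const_mul_left c).congr_left fun m => ?_
  simp only [partialSum, PowerSeries.coeff_smul, mul_sub, Finset.mul_sum, smul_eq_mul, mul_assoc]

theorem zero : PowerAsymp (fun _ => 0) 0 := fun N => by
  simpa [partialSum] using isBigO_zero _ _

theorem of_isBigO {v : ℝ → ℂ} (h : ∀ N : ℕ, v =O[atTop] fun m : ℝ => m⁻¹ ^ N) :
    PowerAsymp v 0 :=
  zero.congr fun N => by simpa using h N

theorem sum {ι : Type*} (t : Finset ι) {v : ι → ℝ → ℂ} {a : ι → PowerSeries ℂ}
    (h : ∀ i ∈ t, PowerAsymp (v i) (a i)) :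
    PowerAsymp (fun m => ∑ i ∈ t, v i m) (∑ i ∈ t, a i) := by
  classical
  induction t using Finset.induction_on with
  | empty => simpa using zero
  | insert i t hi ih =>
    simp only [Finset.sum_insert hi]
    exact (h i (Finset.mem_insert_self i t)).add
      (ih fun j hj => h j (Finset.mem_insert_of_mem hj))

theorem partialSum_eq_eval (a : PowerSeries ℂ) (N : ℕ) (m : ℝ) :
    partialSum a N m = (PowerSeries.trunc N a).eval (m : ℂ)⁻¹ := by
  cases N with
  | zero => simp [partialSum]
  | succ N =>
    rw [Polynomial.eval_eq_sum_range' (PowerSeries.natDegree_trunc_lt a N)]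
    exact Finset.sum_congr rfl fun r hr => by
      rw [PowerSeries.coeff_trunc, if_pos (Finset.mem_range.1 hr)]

theorem isBigO_eval (p : Polynomial ℂ) :
    (fun m : ℝ => p.eval (m : ℂ)⁻¹) =O[atTop] fun m : ℝ => m⁻¹ ^ 0 := by
  simp only [Polynomial.eval_eq_sum_range]
  exact IsBigO.fun_sum fun r _ => (isBigO_inv_pow_of_le (Nat.zero_le r)).const_mul_left _

/-- With `a_N`, `b_N` the partial sums, the error is `(v - a_N) w + a_N (w - b_N) + (a_N b_N -
(ab)_N)`. In the last bracket stands a polynomial in `1/m` divisible by the `N`-th power of its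
variable. -/
theorem mul {v w : ℝ → ℂ} {a b : PowerSeries ℂ} (hv : PowerAsymp v a) (hw : PowerAsymp w b) :
    PowerAsymp (fun m => v m * w m) (a * b) := fun N => by
  have h1 : w =O[atTop] fun m : ℝ => m⁻¹ ^ 0 := by
    simpa [partialSum] using hw 0
  have h2 : (fun m => partialSum a N m) =O[atTop] fun m : ℝ => m⁻¹ ^ 0 := by
    simp only [partialSum_eq_eval]; exact isBigO_eval _
  have h3 : (fun m => partialSum a N m * partialSum b N m - partialSum (a * b) N m) =O[atTop]
      fun m : ℝ => m⁻¹ ^ N := by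
    have hd : Polynomial.X ^ N ∣ PowerSeries.trunc N a * PowerSeries.trunc N b -
        PowerSeries.trunc N (a * b) := by
      rw [Polynomial.X_pow_dvd_iff]
      intro d hd
      rw [Polynomial.coeff_sub, PowerSeries.coeff_trunc, if_pos hd, sub_eq_zero,
        Polynomial.coeff_mul, PowerSeries.coeff_mul]
      refine Finset.sum_congr rfl fun p hp => ?_
      have := Finset.HasAntidiagonal.mem_antidiagonal.1 hp
      rw [PowerSeries.coeff_trunc, PowerSeries.coeff_trunc, if_pos (by omega), if_pos (by omega)]
    obtain ⟨q, hq⟩ := hd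
    refine (((isBigO_inv_pow_self N).mul (isBigO_eval q)).congr_left fun m => ?_).congr_right
      fun m => by simp
    rw [partialSum_eq_eval, partialSum_eq_eval, partialSum_eq_eval, ← Polynomial.eval_mul,
      ← Polynomial.eval_sub, hq]
    simp
  have h4 := (((hv N).mul h1).congr_right fun m => by simp : _ =O[atTop] fun m : ℝ => m⁻¹ ^ N)
  have h5 := ((h2.mul (hw N)).congr_right fun m => by simp : _ =O[atTop] fun m : ℝ => m⁻¹ ^ N)
  refine ((h4.add h5).add h3).congr_left fun m => ?_
  ring

theorem polynomial (p : Polynomial ℂ) : PowerAsymp (fun m => p.eval (m : ℂ)⁻¹) p := fun N => by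
  have hd : Polynomial.X ^ N ∣ p - PowerSeries.trunc N (p : PowerSeries ℂ) := by
    rw [Polynomial.X_pow_dvd_iff]
    intro d hd
    rw [Polynomial.coeff_sub, PowerSeries.coeff_trunc, if_pos hd, Polynomial.coeff_coe, sub_self]
  obtain ⟨q, hq⟩ := hd
  refine (((isBigO_inv_pow_self N).mul (isBigO_eval q)).congr_left fun m => ?_).congr_right
    fun m => by simp
  rw [partialSum_eq_eval, ← Polynomial.eval_sub, hq]
  simp

theorem inv_pow_mul {v : ℝ → ℂ} {a : PowerSeries ℂ} (r : ℕ) (hv : PowerAsymp v a) :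
    PowerAsymp (fun m => (m : ℂ)⁻¹ ^ r * v m) (PowerSeries.X ^ r * a) := by
  have := (polynomial (Polynomial.X ^ r)).mul hv
  simpa using this

theorem analytic {f : ℂ → ℂ} (hf : AnalyticAt ℂ f 0) :
    ∃ a, PowerAsymp (fun m => f (m : ℂ)⁻¹) a ∧ PowerSeries.constantCoeff a = f 0 := by
  obtain ⟨p, hp⟩ := hf
  have ht : Tendsto (fun m : ℝ => (m : ℂ)⁻¹) atTop (𝓝 0) := by
    have h := (Complex.continuous_ofReal.tendsto 0).comp tendsto_inv_atTop_zero
    rw [Complex.ofReal_zero] at h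
    exact h.congr fun m => by simp
  refine ⟨PowerSeries.mk fun r => p.coeff r, fun N => ?_, ?_⟩
  · have := (hp.isBigO_sub_partialSum_pow N).comp_tendsto ht
    refine (this.congr_left fun m => ?_).trans (isBigO_of_le _ fun m => by simp)
    simp [partialSum, FormalMultilinearSeries.partialSum, mul_comm]
  · rw [← PowerSeries.coeff_zero_eq_constantCoeff_apply, PowerSeries.coeff_mk]
    exact hp.coeff_zero _

end PowerAsymp

end PowerAsymptotics

/-! ### The Gaussian integral with a cutoff. -/

section Gaussian

open Filter Asymptotics

variable {n : ℕ}

theorem PowerAsymp.const (c : ℂ) : PowerAsymp (fun _ => c) (PowerSeries.C c) := by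
  have := PowerAsymp.polynomial (Polynomial.C c)
  simpa using this

theorem isBigO_pow_mul_exp_neg {a : ℝ} (ha : 0 < a) (n N : ℕ) :
    (fun m : ℝ => m ^ n * Real.exp (-a * m)) =O[atTop] fun m : ℝ => m⁻¹ ^ N := by
  have h := (isLittleO_exp_neg_mul_rpow_atTop ha (-((N + n : ℕ) : ℝ))).isBigO
  have h2 := (isBigO_refl (fun m : ℝ => m ^ n) atTop).mul h
  refine h2.congr' (Filter.EventuallyEq.rfl) ?_
  filter_upwards [eventually_gt_atTop 0] with m hm
  rw [Real.rpow_neg hm.le, Real.rpow_natCast, pow_add, inv_pow]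
  field_simp

/-- The real dimension is `2 n`, so the usual power `dim / 2` is the integer `n` and no choice of
square root occurs. -/
theorem integral_gaussian_centered (o : Coord n) {m : ℝ} (hm : 0 < m) :
    ∫ y : Coord n, Complex.exp (m * ((-‖y - o‖ ^ 2 : ℝ) : ℂ)) = ((Real.pi : ℂ) / m) ^ n := by
  rw [MeasureTheory.integral_sub_right_eq_self
    (fun y : Coord n => Complex.exp (m * ((-‖y‖ ^ 2 : ℝ) : ℂ))) o]
  have h := GaussianFourier.integral_cexp_neg_mul_sq_norm (V := Coord n) (b := (m : ℂ))
    (by simpa using hm)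
  have e : (Module.finrank ℝ (Coord n) / 2 : ℂ) = (n : ℂ) := by
    simp
  rw [e, Complex.cpow_natCast] at h
  rw [← h]
  congr 1
  funext y
  push_cast
  ring_nf

theorem integrable_gaussian (o : Coord n) {m : ℝ} (hm : 0 < m) :
    MeasureTheory.Integrable fun y : Coord n => Complex.exp (m * ((-‖y - o‖ ^ 2 : ℝ) : ℂ)) := by
  have h := GaussianFourier.integrable_cexp_neg_mul_sq_norm_add (V := Coord n) (b := (m : ℂ))
    (by simpa using hm) 0 0
  have h2 : MeasureTheory.Integrable
      fun y : Coord n => Complex.exp (m * ((-‖y‖ ^ 2 : ℝ) : ℂ)) := by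
    refine h.congr (Eventually.of_forall fun y => ?_)
    simp
  exact h2.comp_sub_right o

/-- The cutoff changes the integral only outside the ball of radius `rIn`, where the Gaussian is
exponentially small in `m`. Hence the expansion is that of the full Gaussian integral and consists
of its constant term. -/
theorem powerAsymp_gaussian_bump (o : Coord n) (b : ContDiffBump o) :
    PowerAsymp (fun m => (m : ℂ) ^ n *
      ∫ y : Coord n, Complex.exp (m * ((-‖y - o‖ ^ 2 : ℝ) : ℂ)) * (b y : ℂ))
      (PowerSeries.C ((Real.pi : ℂ) ^ n)) := by
  refine (PowerAsymp.const _).congr fun N => ?_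
  have hr : 0 < b.rIn ^ 2 := pow_pos b.rIn_pos 2
  set G : ℝ := ∫ y : Coord n, Real.exp (-‖y - o‖ ^ 2)
  refine IsBigO.trans (IsBigO.of_bound (Real.exp (b.rIn ^ 2) * G) ?_)
    (isBigO_pow_mul_exp_neg hr n N)
  filter_upwards [eventually_ge_atTop 1] with m hm
  have hm0 : 0 < m := by linarith
  have hbc : Continuous fun y => (b y : ℂ) := Complex.continuous_ofReal.comp b.continuous
  have hi1 : MeasureTheory.Integrable fun y : Coord n =>
      Complex.exp (m * ((-‖y - o‖ ^ 2 : ℝ) : ℂ)) * (b y : ℂ) := by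
    refine (integrable_gaussian o hm0).mul_bdd (c := 1) hbc.aestronglyMeasurable
      (Eventually.of_forall fun y => ?_)
    rw [Complex.norm_real, Real.norm_of_nonneg b.nonneg]
    exact b.le_one
  have e1 : (m : ℂ) ^ n * (∫ y : Coord n, Complex.exp (m * ((-‖y - o‖ ^ 2 : ℝ) : ℂ)) * (b y : ℂ)) -
      (Real.pi : ℂ) ^ n = (m : ℂ) ^ n *
        ∫ y : Coord n, (Complex.exp (m * ((-‖y - o‖ ^ 2 : ℝ) : ℂ)) * (b y : ℂ) -
          Complex.exp (m * ((-‖y - o‖ ^ 2 : ℝ) : ℂ))) := by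
    rw [MeasureTheory.integral_sub hi1 (integrable_gaussian o hm0),
      integral_gaussian_centered o hm0, mul_sub, ← mul_pow,
      mul_div_cancel₀ _ (by exact_mod_cast hm0.ne' : (m : ℂ) ≠ 0)]
  rw [e1, norm_mul, norm_pow, Complex.norm_real, Real.norm_of_nonneg hm0.le, norm_mul,
    Real.norm_of_nonneg (Real.exp_nonneg _), norm_pow, Real.norm_of_nonneg hm0.le]
  -- Of the exponent `-m |y - o|²`, the part with factor `m - 1` is bounded by its value at radius
  -- `rIn`; the remaining unit keeps the integral convergent.
  have h2 : ‖∫ y : Coord n, (Complex.exp (m * ((-‖y - o‖ ^ 2 : ℝ) : ℂ)) * (b y : ℂ) -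
      Complex.exp (m * ((-‖y - o‖ ^ 2 : ℝ) : ℂ)))‖ ≤
        ∫ y : Coord n, Real.exp (-(m - 1) * b.rIn ^ 2) * Real.exp (-‖y - o‖ ^ 2) := by
    have hg := (integrable_gaussian o one_pos).norm
    refine MeasureTheory.norm_integral_le_of_norm_le (MeasureTheory.Integrable.const_mul ?_ _)
      (Eventually.of_forall fun y => ?_)
    · refine hg.congr (Eventually.of_forall fun y => ?_)
      simp only [Complex.norm_exp, Complex.ofReal_one, one_mul, Complex.ofReal_re]
    · rw [show Complex.exp (m * ((-‖y - o‖ ^ 2 : ℝ) : ℂ)) * (b y : ℂ) -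
        Complex.exp (m * ((-‖y - o‖ ^ 2 : ℝ) : ℂ)) =
        Complex.exp (m * ((-‖y - o‖ ^ 2 : ℝ) : ℂ)) * (((b y - 1 : ℝ)) : ℂ) by push_cast; ring]
      rw [norm_mul, Complex.norm_exp, Complex.re_ofReal_mul, Complex.ofReal_re, Complex.norm_real]
      by_cases hy : y ∈ Metric.closedBall o b.rIn
      · rw [b.one_of_mem_closedBall hy]
        simp; positivity
      · have hy' : b.rIn ≤ ‖y - o‖ := by
          rw [Metric.mem_closedBall, dist_eq_norm] at hy
          linarith
        have h3 : ‖b y - 1‖ ≤ 1 := by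
          rw [Real.norm_eq_abs, abs_le]
          constructor <;> linarith [b.nonneg (x := y), b.le_one (x := y)]
        refine (mul_le_of_le_one_right (Real.exp_nonneg _) h3).trans ?_
        rw [← Real.exp_add, Real.exp_le_exp]
        have : b.rIn ^ 2 ≤ ‖y - o‖ ^ 2 := pow_le_pow_left₀ b.rIn_pos.le hy' 2
        nlinarith
  rw [MeasureTheory.integral_const_mul] at h2
  calc _ ≤ m ^ n * (Real.exp (-(m - 1) * b.rIn ^ 2) * G) := by gcongr
    _ = _ := by
      rw [show -(m - 1) * b.rIn ^ 2 = b.rIn ^ 2 + -b.rIn ^ 2 * m by ring, Real.exp_add]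
      ring

end Gaussian

/-! ### The differential equation along the deformation of the phase. -/

section Deformation

open Filter Asymptotics

variable {n : ℕ}

namespace PhaseFamily

variable {P : PhaseFamily n}

variable (P) in
/-- The derivative of the phase with respect to the parameter. -/
noncomputable def velocity (z : ℝ × Coord n) : ℂ := fderiv ℝ P.Φ z (1, 0)

theorem contDiff_velocity : ContDiff ℝ ∞ P.velocity :=
  (P.smooth.fderiv_right (m := ∞) (by simp)).clm_apply contDiff_const

theorem hasDerivAt_phase (s : ℝ) (y : Coord n) :
    HasDerivAt (fun s => P.Φ (s, y)) (P.velocity (s, y)) s := by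
  have h := (P.smooth.differentiable (by simp) (s, y)).hasFDerivAt
  have h2 : HasDerivAt (fun s : ℝ => (s, y)) (1, 0) s :=
    (hasDerivAt_id s).prodMk (hasDerivAt_const s y)
  exact h.comp_hasDerivAt s h2

/-- The amplitude of the derivative of the oscillatory integral along the deformation. -/
noncomputable def velocityAmplitude (P : PhaseFamily n) (z : ℝ × Coord n) : ℂ :=
  P.velocity z * P.cutoff z

theorem contDiff_velocityAmplitude : ContDiff ℝ ∞ P.velocityAmplitude :=
  contDiff_velocity.mul P.contDiff_cutoff

theorem supported_velocityAmplitude : P.Supported P.velocityAmplitude :=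
  supported_cutoff.mul_left _

/-- Differentiation under the integral sign. On the support of the cutoff the derivative is
dominated by a constant multiple of `m`, as the exponential is bounded by one. -/
theorem hasDerivAt_osc_cutoff {m : ℝ} (hm : 0 ≤ m) (s₀ : ℝ) :
    HasDerivAt (fun s => P.osc s m P.cutoff) (m * P.osc s₀ m P.velocityAmplitude) s₀ := by
  obtain ⟨C, hC⟩ := ((isCompact_closedBall s₀ 1).prod
    (isCompact_closedBall P.o P.bump.rOut)).exists_bound_of_continuousOn
      (contDiff_velocityAmplitude (P := P)).continuous.continuousOn
  unfold osc
  rw [← MeasureTheory.integral_const_mul]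
  refine (hasDerivAt_integral_of_dominated_loc_of_deriv_le
    (F := fun s y => Complex.exp (m * P.Φ (s, y)) * P.cutoff (s, y))
    (F' := fun s y => m * (Complex.exp (m * P.Φ (s, y)) * P.velocityAmplitude (s, y)))
    (bound := (Metric.closedBall P.o P.bump.rOut).indicator fun _ => m * C)
    (Metric.closedBall_mem_nhds s₀ one_pos) ?_ ?_ ?_ ?_ ?_ ?_).2
  · exact Eventually.of_forall fun s =>
      (integrable_osc P.contDiff_cutoff supported_cutoff s m).aestronglyMeasurable
  · exact integrable_osc P.contDiff_cutoff supported_cutoff s₀ m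
  · exact ((integrable_osc contDiff_velocityAmplitude supported_velocityAmplitude
      s₀ m).const_mul _).aestronglyMeasurable
  · refine Eventually.of_forall fun y s hs => ?_
    by_cases hy : y ∈ Metric.closedBall P.o P.bump.rOut
    · rw [Set.indicator_of_mem hy, norm_mul, norm_mul, Complex.norm_real, Real.norm_of_nonneg hm]
      refine mul_le_mul_of_nonneg_left ?_ hm
      calc _ ≤ 1 * C := mul_le_mul (norm_exp_mul_le_one hm (P.re_nonpos _)) (hC (s, y) ⟨hs, hy⟩)
            (norm_nonneg _) zero_le_one
        _ = _ := one_mul _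
    · rw [Set.indicator_of_notMem hy, supported_velocityAmplitude (s, y) hy]
      simp
  · exact (MeasureTheory.integrable_indicator_iff Metric.isClosed_closedBall.measurableSet).2
      (MeasureTheory.integrableOn_const (isCompact_closedBall P.o P.bump.rOut).measure_lt_top.ne)
  · refine Eventually.of_forall fun y s _ => ?_
    have h := (((hasDerivAt_phase (P := P) s y).const_mul (m : ℂ)).cexp).mul_const (P.cutoff (s, y))
    refine h.congr_deriv ?_
    unfold velocityAmplitude
    ring

variable (P) in
/-- The coefficients of the differential equation satisfied along the deformation. -/
noncomputable def deformCoeff (r : ℕ) (s : ℝ) : ℂ :=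
  (P.lower^[r] P.velocityAmplitude) (s, P.o)

theorem continuous_deformCoeff (r : ℕ) : Continuous (P.deformCoeff r) :=
  (contDiff_lower_iterate contDiff_velocityAmplitude r).continuous.comp
    (continuous_id.prodMk continuous_const)

variable (P) in
/-- The truncated coefficient of the differential equation satisfied along the deformation. -/
noncomputable def deformRate (N : ℕ) (m s : ℝ) : ℂ :=
  ∑ i ∈ Finset.range N, (-(-(m : ℂ)⁻¹) ^ i) * P.deformCoeff (i + 1) s

theorem continuous_deformRate (N : ℕ) (m : ℝ) : Continuous (P.deformRate N m) :=
  continuous_finsetSum _ fun i _ => continuous_const.mul (continuous_deformCoeff (i + 1))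

/-- The velocity vanishes at the centre, so the zeroth term of the reduction drops out and the
factor `m` is absorbed by the first gain `1/m`. This is why `N + 1` reductions are made, and why the
rate stays bounded as `m → +∞`. -/
theorem osc_velocityAmplitude (h0 : ∀ s, P.velocity (s, P.o) = 0) (N : ℕ) {m : ℝ} (hm : m ≠ 0)
    (s : ℝ) :
    m * P.osc s m P.velocityAmplitude = P.deformRate N m s * P.osc s m P.cutoff +
      -(-(m : ℂ)⁻¹) ^ N * P.osc s m (P.lower^[N + 1] P.velocityAmplitude) := by
  have hm' : (m : ℂ) ≠ 0 := by exact_mod_cast hm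
  rw [osc_expansion contDiff_velocityAmplitude supported_velocityAmplitude s hm (N + 1),
    Finset.sum_range_succ']
  have h1 : P.velocityAmplitude (s, P.o) = 0 := by simp [velocityAmplitude, h0]
  have h2 : ∀ i : ℕ, (m : ℂ) * (-(m : ℂ)⁻¹) ^ (i + 1) = -(-(m : ℂ)⁻¹) ^ i := fun i => by
    rw [pow_succ]; field_simp
  simp only [Function.iterate_zero, id_eq, h1, mul_zero, add_zero]
  rw [mul_add, ← mul_assoc, ← mul_assoc, h2, Finset.mul_sum]
  congr 2
  exact Finset.sum_congr rfl fun i _ => by rw [← mul_assoc, h2, deformCoeff]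

/-- Along the deformation the cutoff integral `J` satisfies `J' = rate · J + O(m^(-N))`. After
multiplication by the integrating factor only the error term is left in the derivative; the factor
is bounded uniformly for `m ≥ 1`, so the mean value inequality applies. -/
theorem exists_norm_osc_sub_le (h0 : ∀ s, P.velocity (s, P.o) = 0) (N : ℕ) :
    ∃ C, ∀ m : ℝ, 1 ≤ m →
      ‖Complex.exp (-∫ s in (0 : ℝ)..1, P.deformRate N m s) * P.osc 1 m P.cutoff -
        P.osc 0 m P.cutoff‖ ≤ C * m⁻¹ ^ N := by
  obtain ⟨C, hC0, hC⟩ := exists_norm_osc_le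
    (contDiff_lower_iterate (P := P) contDiff_velocityAmplitude (N + 1))
    (supported_velocityAmplitude.lower_iterate (N + 1)) 0 1
  have hB : ∀ i, ∃ B, ∀ s ∈ Set.Icc (0 : ℝ) 1, ‖P.deformCoeff (i + 1) s‖ ≤ B := fun i =>
    isCompact_Icc.exists_bound_of_continuousOn (continuous_deformCoeff (i + 1)).continuousOn
  choose B hB using hB
  have hB0 : ∀ i, 0 ≤ B i := fun i => (norm_nonneg _).trans (hB i 0 (by simp))
  set A : ℝ := ∑ i ∈ Finset.range N, B i
  have hA0 : 0 ≤ A := Finset.sum_nonneg fun i _ => hB0 i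
  refine ⟨Real.exp A * C, fun m hm => ?_⟩
  have hm0 : 0 < m := by linarith
  have hinv : ‖-(m : ℂ)⁻¹‖ = m⁻¹ := by
    rw [norm_neg, norm_inv, Complex.norm_real, Real.norm_of_nonneg hm0.le]
  have hrate : ∀ s ∈ Set.Icc (0 : ℝ) 1, ‖P.deformRate N m s‖ ≤ A := fun s hs => by
    refine norm_sum_le_of_le _ fun i _ => ?_
    rw [norm_mul, norm_neg, norm_pow, hinv]
    refine (mul_le_of_le_one_left (norm_nonneg _) ?_).trans (hB i s hs)
    exact pow_le_one₀ (inv_nonneg.2 hm0.le) (inv_le_one_of_one_le₀ hm)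
  have hI : ∀ s ∈ Set.Icc (0 : ℝ) 1, ‖Complex.exp (-∫ t in (0 : ℝ)..s, P.deformRate N m t)‖ ≤
      Real.exp A := fun s hs => by
    rw [Complex.norm_exp, Real.exp_le_exp]
    refine (Complex.re_le_norm _).trans ?_
    rw [norm_neg]
    have := intervalIntegral.norm_integral_le_of_norm_le_const (a := (0 : ℝ)) (b := s)
      (f := P.deformRate N m) (C := A) fun t ht => by
        rw [Set.uIoc_of_le hs.1] at ht
        exact hrate t ⟨ht.1.le, ht.2.trans hs.2⟩
    refine this.trans (mul_le_of_le_one_right hA0 ?_)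
    rw [sub_zero, abs_of_nonneg hs.1]
    exact hs.2
  have hder : ∀ s ∈ Set.Icc (0 : ℝ) 1, HasDerivWithinAt
      (fun s => Complex.exp (-∫ t in (0 : ℝ)..s, P.deformRate N m t) * P.osc s m P.cutoff)
      (Complex.exp (-∫ t in (0 : ℝ)..s, P.deformRate N m t) *
        (-(-(m : ℂ)⁻¹) ^ N * P.osc s m (P.lower^[N + 1] P.velocityAmplitude)))
      (Set.Icc 0 1) s := fun s hs => by
    have h1 : HasDerivAt (fun s => Complex.exp (-∫ t in (0 : ℝ)..s, P.deformRate N m t))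
        (Complex.exp (-∫ t in (0 : ℝ)..s, P.deformRate N m t) * -P.deformRate N m s) s :=
      (intervalIntegral.integral_hasDerivAt_right (a := (0 : ℝ)) (b := s)
        ((continuous_deformRate N m).intervalIntegrable _ _)
        ((continuous_deformRate N m).stronglyMeasurableAtFilter _ _)
        (continuous_deformRate (P := P) N m).continuousAt).neg.cexp
    have h2 := hasDerivAt_osc_cutoff (P := P) hm0.le s
    rw [osc_velocityAmplitude h0 N hm0.ne'] at h2
    refine ((h1.mul h2).congr_deriv ?_).hasDerivWithinAt
    ring
  have := norm_image_sub_le_of_norm_deriv_le_segment' (a := (0 : ℝ)) (b := 1) hder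
    (C := Real.exp A * C * m⁻¹ ^ N) (fun s hs => by
      have hs' : s ∈ Set.Icc (0 : ℝ) 1 := ⟨hs.1, hs.2.le⟩
      rw [norm_mul, norm_mul, norm_neg, norm_pow, hinv]
      calc _ ≤ Real.exp A * (m⁻¹ ^ N * C) := by
            refine mul_le_mul (hI s hs') ?_ (by positivity) (Real.exp_nonneg _)
            exact mul_le_mul_of_nonneg_left (hC s hs' m hm0.le) (by positivity)
        _ = _ := by ring) 1 (by simp)
  simpa using this

/-- The integral of the truncated rate is a polynomial `p` in `1/m`, so the integrating factor is
analytic in `1/m` at zero. Multiplied by the expansion of the Gaussian end of the path, it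
approximates the integral to every order. The constant term is `exp(-p(0)) π^n`, hence not zero. -/
theorem powerAsymp_osc_cutoff (h0 : ∀ s, P.velocity (s, P.o) = 0)
    (h1 : ∀ y, P.Φ (1, y) = ((-‖y - P.o‖ ^ 2 : ℝ) : ℂ)) :
    ∃ a, PowerAsymp (fun m => (m : ℂ) ^ n * P.osc 0 m P.cutoff) a ∧
      PowerSeries.constantCoeff a ≠ 0 := by
  have hJ : PowerAsymp (fun m => (m : ℂ) ^ n * P.osc 1 m P.cutoff)
      (PowerSeries.C ((Real.pi : ℂ) ^ n)) := by
    simpa only [osc, h1, cutoff] using powerAsymp_gaussian_bump P.o P.bump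
  have key : ∀ N : ℕ, ∃ w b, PowerAsymp w b ∧
      ((fun m : ℝ => (m : ℂ) ^ n * P.osc 0 m P.cutoff - w m) =O[atTop] fun m : ℝ => m⁻¹ ^ N) ∧
      PowerSeries.constantCoeff b ≠ 0 := by
    intro N
    -- The `n` extra orders compensate for the factor `m ^ n`.
    obtain ⟨C, hC⟩ := exists_norm_osc_sub_le h0 (N + n)
    set p : Polynomial ℂ := ∑ i ∈ Finset.range (N + n),
      Polynomial.C (-(-1) ^ i * ∫ s in (0 : ℝ)..1, P.deformCoeff (i + 1) s) * Polynomial.X ^ i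
      with hp
    have hpe : ∀ m : ℝ, ∫ s in (0 : ℝ)..1, P.deformRate (N + n) m s = p.eval (m : ℂ)⁻¹ := by
      intro m
      unfold deformRate
      rw [intervalIntegral.integral_finsetSum (f := fun i s =>
        (-(-(m : ℂ)⁻¹) ^ i) * P.deformCoeff (i + 1) s) fun i _ =>
        (continuous_const.mul (continuous_deformCoeff (i + 1))).intervalIntegrable _ _]
      simp only [intervalIntegral.integral_const_mul, hp, Polynomial.eval_finsetSum,
        Polynomial.eval_mul, Polynomial.eval_C, Polynomial.eval_pow, Polynomial.eval_X]
      exact Finset.sum_congr rfl fun i _ => by rw [neg_pow]; ring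
    obtain ⟨b, hb, hb0⟩ := PowerAsymp.analytic (f := fun t => Complex.exp (-p.eval t))
      (by
        have : Differentiable ℂ fun t => Complex.exp (-p.eval t) :=
          (Polynomial.differentiable p).neg.cexp
        exact this.analyticAt 0)
    refine ⟨_, _, hb.mul hJ, ?_, ?_⟩
    · refine IsBigO.of_bound C ?_
      filter_upwards [eventually_ge_atTop 1] with m hm
      have hm0 : 0 < m := by linarith
      have := hC m hm
      rw [hpe, norm_sub_rev] at this
      rw [show (m : ℂ) ^ n * P.osc 0 m P.cutoff - Complex.exp (-p.eval (m : ℂ)⁻¹) *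
        ((m : ℂ) ^ n * P.osc 1 m P.cutoff) = (m : ℂ) ^ n * (P.osc 0 m P.cutoff -
          Complex.exp (-p.eval (m : ℂ)⁻¹) * P.osc 1 m P.cutoff) by ring, norm_mul, norm_pow,
        norm_pow, Complex.norm_real, Real.norm_of_nonneg hm0.le,
        Real.norm_of_nonneg (inv_nonneg.2 hm0.le)]
      calc _ ≤ m ^ n * (C * m⁻¹ ^ (N + n)) := by gcongr
        _ = C * m⁻¹ ^ N * (m * m⁻¹) ^ n := by rw [pow_add, mul_pow]; ring
        _ = _ := by rw [mul_inv_cancel₀ hm0.ne', one_pow, mul_one]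
    · rw [map_mul, hb0, PowerSeries.constantCoeff_C]
      exact mul_ne_zero (Complex.exp_ne_zero _)
        (pow_ne_zero _ (by exact_mod_cast Real.pi_ne_zero))
  obtain ⟨a, ha⟩ := PowerAsymp.exists_of_forall_approx fun N =>
    let ⟨w, b, h1, h2, _⟩ := key N; ⟨w, b, h1, h2⟩
  refine ⟨a, ha, ?_⟩
  -- An approximation of order one already determines the constant coefficient.
  obtain ⟨w, b, hw, hvw, hb⟩ := key 1
  rw [← PowerSeries.coeff_zero_eq_constantCoeff_apply] at hb ⊢
  rwa [coeff_eq_of_isBigO (ha 1) (hw 1) hvw zero_lt_one]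

/-- The expansion of the oscillatory integral of an amplitude relative to that of the cutoff. -/
noncomputable def relSeries (P : PhaseFamily n) (u : ℝ × Coord n → ℂ) : PowerSeries ℂ :=
  PowerSeries.mk fun r => (-1) ^ r * (P.lower^[r] u) (0, P.o)

/-- This is `osc_expansion` read asymptotically: the partial sums of `relSeries` multiply the cutoff
integral and the remainder is bounded uniformly in `m`. Again `n` further terms are taken because of
the factor `m ^ n`. -/
theorem powerAsymp_osc {a : PowerSeries ℂ}
    (ha : PowerAsymp (fun m => (m : ℂ) ^ n * P.osc 0 m P.cutoff) a) {u : ℝ × Coord n → ℂ}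
    (hu : ContDiff ℝ ∞ u) (hs : P.Supported u) :
    PowerAsymp (fun m => (m : ℂ) ^ n * P.osc 0 m u) (P.relSeries u * a) := by
  refine PowerAsymp.of_forall_approx fun N => ?_
  obtain ⟨C, hC0, hC⟩ := exists_norm_osc_le (contDiff_lower_iterate (P := P) hu (N + n))
    (hs.lower_iterate (N + n)) 0 0
  refine ⟨_, _, (PowerAsymp.polynomial (PowerSeries.trunc (N + n) (P.relSeries u))).mul ha,
    IsBigO.of_bound C ?_, fun r hr => ?_⟩
  · filter_upwards [eventually_ge_atTop 1] with m hm
    have hm0 : 0 < m := by linarith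
    rw [← PowerAsymp.partialSum_eq_eval, osc_expansion hu hs 0 hm0.ne' (N + n)]
    have e : partialSum (P.relSeries u) (N + n) m = ∑ r ∈ Finset.range (N + n),
        (-(m : ℂ)⁻¹) ^ r * (P.lower^[r] u) (0, P.o) :=
      Finset.sum_congr rfl fun r _ => by
        rw [relSeries, PowerSeries.coeff_mk, neg_pow (m : ℂ)⁻¹]; ring
    rw [e]
    have h := hC 0 (by simp) m hm0.le
    rw [mul_add, ← mul_assoc, mul_comm ((m : ℂ) ^ n), mul_assoc, add_sub_cancel_left, norm_mul,
      norm_mul, norm_pow, norm_pow, norm_neg, norm_inv, Complex.norm_real,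
      Real.norm_of_nonneg hm0.le, norm_pow, norm_inv, Real.norm_of_nonneg hm0.le]
    calc _ ≤ m ^ n * (m⁻¹ ^ (N + n) * C) := by gcongr
      _ = C * m⁻¹ ^ N * (m * m⁻¹) ^ n := by rw [pow_add, mul_pow]; ring
      _ = _ := by rw [mul_inv_cancel₀ hm0.ne', one_pow, mul_one]
  · rw [PowerSeries.coeff_mul, PowerSeries.coeff_mul]
    refine Finset.sum_congr rfl fun q hq => ?_
    have := Finset.HasAntidiagonal.mem_antidiagonal.1 hq
    rw [Polynomial.coeff_coe, PowerSeries.coeff_trunc, if_pos (by omega)]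

end PhaseFamily

end Deformation

/-! ### Nondegeneracy of the Hessian along the deformation. -/

section Hessian

variable {n : ℕ}

/-- The Hessian matrix of a function on the coordinate space. -/
noncomputable def hessianMatrix (φ : Coord n → ℂ) (o : Coord n) :
    Matrix (Fin (2 * n)) (Fin (2 * n)) ℂ :=
  fun i j => iteratedFDeriv ℝ 2 φ o ![EuclideanSpace.single i 1, EuclideanSpace.single j 1]

theorem hessianMatrix_apply (φ : Coord n → ℂ) (o : Coord n) (i j : Fin (2 * n)) :
    hessianMatrix φ o i j =
      fderiv ℝ (fderiv ℝ φ) o (EuclideanSpace.single i 1) (EuclideanSpace.single j 1) := by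
  rw [hessianMatrix, iteratedFDeriv_two_apply]; simp

theorem hessianMatrix_symm {φ : Coord n → ℂ} (hφ : ContDiff ℝ ∞ φ) (o : Coord n)
    (i j : Fin (2 * n)) : hessianMatrix φ o i j = hessianMatrix φ o j i := by
  rw [hessianMatrix_apply, hessianMatrix_apply]
  exact (hφ.contDiffAt.isSymmSndFDerivAt
    (by simpa using (WithTop.coe_le_coe.2 le_top : ((2 : ℕ∞) : ℕ∞ω) ≤ ∞))).eq _ _

/-- The real part of the phase is maximal at `o`. If its second derivative along a line were
positive, `o` would also be a local minimum on that line, so the real part would vanish near `o`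
there, contradicting positivity. -/
theorem re_hessian_nonpos {φ : Coord n → ℂ} (hφ : ContDiff ℝ ∞ φ) {o : Coord n}
    (hre : ∀ y, (φ y).re ≤ 0) (h0 : φ o = 0) (h1 : fderiv ℝ φ o = 0) (a : Coord n) :
    (∑ j, ∑ k, hessianMatrix φ o j k * a j * a k).re ≤ 0 := by
  have hsum : ∑ j, ∑ k, hessianMatrix φ o j k * a j * a k = fderiv ℝ (fderiv ℝ φ) o a a := by
    conv_rhs => rw [Coord.sum_smul_single a]
    simp only [map_sum, map_smul, sum_apply, smul_apply]
    rw [Finset.sum_comm]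
    refine Finset.sum_congr rfl fun k _ => ?_
    rw [Finset.smul_sum]
    refine Finset.sum_congr rfl fun j _ => ?_
    rw [hessianMatrix_apply, Complex.real_smul, Complex.real_smul]
    ring
  rw [hsum]
  by_contra! hq
  have hline : ∀ t : ℝ, HasDerivAt (fun t : ℝ => o + t • a) a t := fun t => by
    simpa using ((hasDerivAt_id t).smul_const a).const_add o
  have hφ1 : ContDiff ℝ ∞ (fderiv ℝ φ) := hφ.fderiv_right (by simp)
  have hd1 : ∀ t : ℝ, HasDerivAt (fun t : ℝ => (φ (o + t • a)).re)
      (fderiv ℝ φ (o + t • a) a).re t := fun t =>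
    Complex.reCLM.hasFDerivAt.comp_hasDerivAt t
      (((hφ.differentiable (by simp) _).hasFDerivAt).comp_hasDerivAt t (hline t))
  have hd2 : HasDerivAt (fun t : ℝ => (fderiv ℝ φ (o + t • a) a).re)
      (fderiv ℝ (fderiv ℝ φ) o a a).re 0 := by
    have h := ((hφ1.differentiable (by simp) (o + (0 : ℝ) • a)).hasFDerivAt).comp_hasDerivAt 0
      (hline 0)
    have h2 := Complex.reCLM.hasFDerivAt.comp_hasDerivAt 0
      ((ContinuousLinearMap.apply ℝ ℂ a).hasFDerivAt.comp_hasDerivAt 0 h)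
    rw [zero_smul, add_zero] at h2
    exact h2
  have hdd : deriv (fun t : ℝ => (φ (o + t • a)).re) =
      fun t : ℝ => (fderiv ℝ φ (o + t • a) a).re := funext fun t => (hd1 t).deriv
  have hmin : IsLocalMin (fun t : ℝ => (φ (o + t • a)).re) 0 := by
    refine isLocalMin_of_deriv_deriv_pos ?_ ?_ (hd1 0).continuousAt
    · rw [hdd, hd2.deriv]; exact hq
    · rw [hdd]; simp [h1]
  have hev : (fun t : ℝ => (φ (o + t • a)).re) =ᶠ[𝓝 0] fun _ => 0 := by
    filter_upwards [hmin] with t ht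
    refine le_antisymm (hre _) ?_
    simpa [h0] using ht
  have : deriv (deriv (fun t : ℝ => (φ (o + t • a)).re)) 0 = 0 := by
    rw [(hev.deriv).deriv_eq]; simp
  rw [hdd, hd2.deriv] at this
  exact hq.ne' this

/-- Pair a kernel vector `v = a + i b` with its conjugate to get `(1 - τ) v̄ᵀHv = 2τ |v|²`. As `H`
is symmetric, `v̄ᵀHv = aᵀHa + bᵀHb`, whose real part is nonpositive. Thus `v = 0` when `τ > 0`; for
`τ = 0` the matrix is `H` itself. -/
theorem det_deformed_ne_zero {ι : Type*} [Fintype ι] [DecidableEq ι] {H : Matrix ι ι ℂ}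
    (hsymm : ∀ i j, H i j = H j i)
    (hre : ∀ a : ι → ℝ, (∑ j, ∑ k, H j k * a j * a k).re ≤ 0) (hdet : H.det ≠ 0) {τ : ℝ}
    (hτ : τ ∈ Set.Icc (0 : ℝ) 1) :
    (((1 - τ : ℝ) : ℂ) • H - ((2 * τ : ℝ) : ℂ) • (1 : Matrix ι ι ℂ)).det ≠ 0 := by
  rcases hτ.1.eq_or_lt with h0 | h0
  · simpa [← h0] using hdet
  intro hd
  obtain ⟨v, hv, hMv⟩ := Matrix.exists_mulVec_eq_zero_iff.2 hd
  have e1 : ∀ j, ((1 - τ : ℝ) : ℂ) * ∑ k, H j k * v k = ((2 * τ : ℝ) : ℂ) * v j := by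
    intro j
    have := congrFun hMv j
    rw [Matrix.sub_mulVec, Matrix.smul_mulVec, Matrix.smul_mulVec, Matrix.one_mulVec] at this
    simpa [sub_eq_zero, Matrix.mulVec, dotProduct] using this
  have e2 : ∑ j, (starRingEnd ℂ) (v j) * (((1 - τ : ℝ) : ℂ) * ∑ k, H j k * v k) =
      ((2 * τ * ∑ j, Complex.normSq (v j) : ℝ) : ℂ) := by
    simp only [e1]
    push_cast
    rw [Finset.mul_sum]
    refine Finset.sum_congr rfl fun j _ => ?_
    rw [Complex.normSq_eq_conj_mul_self]
    ring
  have e3 : (∑ j, (starRingEnd ℂ) (v j) * ∑ k, H j k * v k) =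
      (∑ j, ∑ k, H j k * ((v j).re : ℂ) * ((v k).re : ℂ)) +
        ∑ j, ∑ k, H j k * ((v j).im : ℂ) * ((v k).im : ℂ) := by
    -- The bracket is antisymmetric in `j` and `k`, while `H` is symmetric.
    have hanti : ∑ j, ∑ k, H j k * (((v j).re : ℂ) * (v k).im - (v j).im * (v k).re) = 0 := by
      have h : ∑ j, ∑ k, H j k * (((v j).re : ℂ) * (v k).im - (v j).im * (v k).re) =
          -∑ j, ∑ k, H j k * (((v j).re : ℂ) * (v k).im - (v j).im * (v k).re) := by
        conv_lhs => rw [Finset.sum_comm]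
        rw [← Finset.sum_neg_distrib]
        refine Finset.sum_congr rfl fun j _ => ?_
        rw [← Finset.sum_neg_distrib]
        exact Finset.sum_congr rfl fun k _ => by rw [hsymm k j]; ring
      exact self_eq_neg.1 h
    have h : ∀ j k, (starRingEnd ℂ) (v j) * (H j k * v k) =
        H j k * ((v j).re : ℂ) * ((v k).re : ℂ) + H j k * ((v j).im : ℂ) * ((v k).im : ℂ) +
          Complex.I * (H j k * (((v j).re : ℂ) * (v k).im - (v j).im * (v k).re)) := by
      intro j k
      have hk := (Complex.re_add_im (v k)).symm
      have hj : (starRingEnd ℂ) (v j) = (v j).re - (v j).im * Complex.I := by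
        apply Complex.ext <;> simp
      rw [hj]
      conv_lhs => rw [hk]
      linear_combination (-(H j k) * ((v j).im : ℂ) * ((v k).im : ℂ)) * Complex.I_sq
    simp only [Finset.mul_sum, h, Finset.sum_add_distrib]
    simp only [← Finset.mul_sum, hanti, mul_zero, add_zero]
  have e4 : (∑ j, (starRingEnd ℂ) (v j) * (((1 - τ : ℝ) : ℂ) * ∑ k, H j k * v k)).re ≤ 0 := by
    have : ∑ j, (starRingEnd ℂ) (v j) * (((1 - τ : ℝ) : ℂ) * ∑ k, H j k * v k) =
        ((1 - τ : ℝ) : ℂ) * ∑ j, (starRingEnd ℂ) (v j) * ∑ k, H j k * v k := by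
      rw [Finset.mul_sum]; exact Finset.sum_congr rfl fun j _ => by ring
    rw [this, Complex.re_ofReal_mul, e3, Complex.add_re]
    refine mul_nonpos_of_nonneg_of_nonpos (by linarith [hτ.2]) ?_
    linarith [hre fun j => (v j).re, hre fun j => (v j).im]
  rw [e2, Complex.ofReal_re] at e4
  have e5 : ∑ j, Complex.normSq (v j) ≤ 0 := by
    by_contra! h
    have := mul_pos (mul_pos two_pos h0) h
    linarith
  have e6 := (Finset.sum_eq_zero_iff_of_nonneg fun j _ => Complex.normSq_nonneg (v j)).1
    (le_antisymm e5 (Finset.sum_nonneg fun j _ => Complex.normSq_nonneg (v j)))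
  exact hv (funext fun j => Complex.normSq_eq_zero.1 (e6 j (Finset.mem_univ j)))

theorem contDiff_det {X : Type*} [NormedAddCommGroup X] [NormedSpace ℝ X] {ι : Type*} [Fintype ι]
    [DecidableEq ι] {A : X → Matrix ι ι ℂ} (hA : ∀ i j, ContDiff ℝ ∞ fun x => A x i j) :
    ContDiff ℝ ∞ fun x => (A x).det := by
  simp only [Matrix.det_apply']
  exact ContDiff.sum fun σ _ => contDiff_const.mul (contDiff_prod fun i _ => hA _ _)

theorem contDiff_adjugate {X : Type*} [NormedAddCommGroup X] [NormedSpace ℝ X] {ι : Type*}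
    [Fintype ι] [DecidableEq ι] {A : X → Matrix ι ι ℂ}
    (hA : ∀ i j, ContDiff ℝ ∞ fun x => A x i j) (i j : ι) :
    ContDiff ℝ ∞ fun x => (A x).adjugate i j := by
  simp only [Matrix.adjugate_apply]
  refine contDiff_det fun k l => ?_
  by_cases hk : k = j
  · simp only [hk, Matrix.updateRow_self]; exact contDiff_const
  · simp only [Matrix.updateRow_ne hk]; exact hA k l

end Hessian

/-! ### Construction of the deformation from the phase to the Gaussian. -/

section Deformation

variable {n : ℕ}

open Real in
theorem pd_deformed {φ : Coord n → ℂ} (hφ : ContDiff ℝ ∞ φ) (o : Coord n) {τ : ℝ → ℝ}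
    (hτ : ContDiff ℝ ∞ τ) (j : Fin (2 * n)) (s : ℝ) (y : Coord n) :
    pd j (fun z : ℝ × Coord n => ((1 - τ z.1 : ℝ) : ℂ) * φ z.2 +
      ((-(τ z.1 * ‖z.2 - o‖ ^ 2) : ℝ) : ℂ)) (s, y) =
      ((1 - τ s : ℝ) : ℂ) * fderiv ℝ φ y (EuclideanSpace.single j 1) -
        ((2 * τ s : ℝ) : ℂ) * ((y j - o j : ℝ) : ℂ) := by
  have hsm : ContDiff ℝ ∞ (fun z : ℝ × Coord n => ((1 - τ z.1 : ℝ) : ℂ) * φ z.2 +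
      ((-(τ z.1 * ‖z.2 - o‖ ^ 2) : ℝ) : ℂ)) := by
    have h1 : ContDiff ℝ ∞ fun z : ℝ × Coord n => ((1 - τ z.1 : ℝ) : ℂ) :=
      Complex.ofRealCLM.contDiff.comp (contDiff_const.sub (hτ.comp contDiff_fst))
    have h2 : ContDiff ℝ ∞ fun z : ℝ × Coord n => ((-(τ z.1 * ‖z.2 - o‖ ^ 2) : ℝ) : ℂ) :=
      Complex.ofRealCLM.contDiff.comp
        ((hτ.comp contDiff_fst).mul ((contDiff_snd.sub contDiff_const).norm_sq ℝ)).neg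
    exact (h1.mul (hφ.comp contDiff_snd)).add h2
  rw [← fderiv_slice hsm]
  have h1 : HasFDerivAt (fun y : Coord n => ‖y - o‖ ^ 2) _ y :=
    ((hasFDerivAt_id y).sub_const o).norm_sq
  have h2 := Complex.ofRealCLM.hasFDerivAt.comp y ((h1.const_mul (τ s)).neg)
  have h3 : HasFDerivAt (fun y : Coord n => ((1 - τ s : ℝ) : ℂ) * φ y +
      ((-(τ s * ‖y - o‖ ^ 2) : ℝ) : ℂ)) _ y :=
    ((hφ.differentiable (by simp) y).hasFDerivAt.const_mul ((1 - τ s : ℝ) : ℂ)).add h2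
  rw [h3.fderiv]
  simp [EuclideanSpace.inner_single_right]
  ring

/-- The gradient of the deformed phase is `M (y - o)`, where `M` at `o` is the deformed Hessian. It
is invertible for all parameters there, and by compactness also on a common ball around `o`; the
inverse matrix expresses the coordinates through the gradient. -/
theorem exists_phaseFamily {φ : Coord n → ℂ} (hφ : ContDiff ℝ ∞ φ) {o : Coord n}
    (hre : ∀ y, (φ y).re ≤ 0) (h0 : φ o = 0) (h1 : fderiv ℝ φ o = 0)
    (hdet : (hessianMatrix φ o).det ≠ 0) {R₀ : ℝ} (hR₀ : 0 < R₀) :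
    ∃ P : PhaseFamily n, P.o = o ∧ P.bump.rOut ≤ R₀ ∧ (∀ y, P.Φ (0, y) = φ y) ∧
      (∀ y, P.Φ (1, y) = ((-‖y - P.o‖ ^ 2 : ℝ) : ℂ)) ∧ ∀ s, P.velocity (s, P.o) = 0 := by
  set u : Fin (2 * n) → ℝ × Coord n → ℂ :=
    fun j z => fderiv ℝ φ z.2 (EuclideanSpace.single j 1) with hu
  have hus : ∀ j, ContDiff ℝ ∞ (u j) := fun j =>
    ((hφ.fderiv_right (m := ∞) (by simp)).comp contDiff_snd).clm_apply contDiff_const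
  -- The Hadamard coefficients of the gradient of `φ`: a smooth matrix with `∇φ = B (y - o)`, equal
  -- to the Hessian at `o`.
  set B : Coord n → Matrix (Fin (2 * n)) (Fin (2 * n)) ℂ :=
    fun y j k => hadamard o k (u j) (0, y) with hB
  have hBs : ∀ j k, ContDiff ℝ ∞ fun y => B y j k := fun j k =>
    (contDiff_hadamard o (hus j)).comp (contDiff_const.prodMk contDiff_id)
  have hBo : B o = hessianMatrix φ o := by
    ext j k
    have e : hadamard o k (u j) (0, o) = pd k (u j) (0, o) := by
      simp [hadamard, contraction]
    rw [hB]
    simp only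
    rw [e, ← fderiv_slice (hus j), hessianMatrix_symm hφ, hessianMatrix_apply, hu]
    simp only
    rw [fderiv_clm_apply ((hφ.fderiv_right (m := ∞) (by simp)).differentiable (by simp) o)
      (differentiableAt_const _)]
    simp
  have hgrad : ∀ j y, fderiv ℝ φ y (EuclideanSpace.single j 1) =
      ∑ k, ((y k - o k : ℝ) : ℂ) * B y j k := by
    intro j y
    have := eq_add_sum_hadamard o (hus j) 0 y
    simpa [hu, h1] using this
  set M : ℝ × Coord n → Matrix (Fin (2 * n)) (Fin (2 * n)) ℂ := fun w =>
    ((1 - w.1 : ℝ) : ℂ) • B w.2 - ((2 * w.1 : ℝ) : ℂ) • (1 : Matrix _ _ ℂ) with hM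
  have hMs : ∀ j k, ContDiff ℝ ∞ fun w => M w j k := by
    intro j k
    have c1 : ContDiff ℝ ∞ fun w : ℝ × Coord n => ((1 - w.1 : ℝ) : ℂ) :=
      Complex.ofRealCLM.contDiff.comp (contDiff_const.sub contDiff_fst)
    have c2 : ContDiff ℝ ∞ fun w : ℝ × Coord n => ((2 * w.1 : ℝ) : ℂ) :=
      Complex.ofRealCLM.contDiff.comp (contDiff_const.mul contDiff_fst)
    exact (c1.mul ((hBs j k).comp contDiff_snd)).sub (c2.mul contDiff_const)
  have hMo : ∀ τ ∈ Set.Icc (0 : ℝ) 1, (M (τ, o)).det ≠ 0 := by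
    intro τ hτ
    rw [hM]
    simp only
    rw [hBo]
    refine det_deformed_ne_zero (hessianMatrix_symm hφ o) (fun a => ?_) hdet hτ
    simpa using re_hessian_nonpos hφ hre h0 h1 (WithLp.toLp 2 a)
  obtain ⟨ε, hε, hMε⟩ : ∃ ε > 0, ∀ τ ∈ Set.Icc (0 : ℝ) 1, ∀ y ∈ Metric.ball o ε,
      (M (τ, y)).det ≠ 0 := by
    have hopen : IsOpen {w : ℝ × Coord n | (M w).det ≠ 0} :=
      isOpen_ne_fun (contDiff_det hMs).continuous continuous_const
    obtain ⟨a, b, ha, hb, hab, hbo, hsub⟩ := generalized_tube_lemma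
      (isCompact_Icc (a := (0 : ℝ)) (b := 1)) (isCompact_singleton (x := o)) hopen (by
        rintro ⟨τ, y⟩ ⟨hτ, hy⟩
        rw [show y = o from hy]
        exact hMo τ hτ)
    obtain ⟨ε, hε, hball⟩ := Metric.isOpen_iff.1 hb o (hbo rfl)
    exact ⟨ε, hε, fun τ hτ y hy => hsub ⟨hab hτ, hball hy⟩⟩
  -- The cutoff `χ` lives on the ball of radius `R`, the auxiliary cutoff `η` is `1` on that ball
  -- and vanishes beyond `2 R`. As `2 R < ε`, the matrix `M` is invertible on the support of `η`.
  set R : ℝ := min R₀ (ε / 4) with hR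
  have hR0 : 0 < R := lt_min hR₀ (by linarith)
  let χ : ContDiffBump o := ⟨R / 2, R, by linarith, by linarith⟩
  let η : ContDiffBump o := ⟨R, 2 * R, hR0, by linarith⟩
  -- Reparametrizing by a smooth step keeps the weight in `[0, 1]` for every real `s`, so the real
  -- part of the phase is nonpositive and `M` is invertible for all `s`, not only on `[0, 1]`.
  set σ : ℝ → ℝ := Real.smoothTransition with hσ
  have hσs : ContDiff ℝ ∞ σ := Real.smoothTransition.contDiff
  have hσI : ∀ s, σ s ∈ Set.Icc (0 : ℝ) 1 := fun s =>
    ⟨Real.smoothTransition.nonneg s, Real.smoothTransition.le_one s⟩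
  set Φ : ℝ × Coord n → ℂ := fun z => ((1 - σ z.1 : ℝ) : ℂ) * φ z.2 +
      ((-(σ z.1 * ‖z.2 - o‖ ^ 2) : ℝ) : ℂ) with hΦ
  have hpd : ∀ j s y, pd j Φ (s, y) = ∑ k, M (σ s, y) j k * ((y k - o k : ℝ) : ℂ) := by
    intro j s y
    rw [hΦ, pd_deformed hφ o hσs j s y, hgrad, hM]
    simp only [Matrix.sub_apply, Matrix.smul_apply, sub_mul, Finset.sum_sub_distrib, smul_eq_mul,
      Matrix.one_apply]
    congr 1
    · rw [Finset.mul_sum]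
      exact Finset.sum_congr rfl fun k _ => by ring
    · simp
  have hΦs : ContDiff ℝ ∞ Φ := by
    have c1 : ContDiff ℝ ∞ fun z : ℝ × Coord n => ((1 - σ z.1 : ℝ) : ℂ) :=
      Complex.ofRealCLM.contDiff.comp (contDiff_const.sub (hσs.comp contDiff_fst))
    have c2 : ContDiff ℝ ∞ fun z : ℝ × Coord n => ((-(σ z.1 * ‖z.2 - o‖ ^ 2) : ℝ) : ℂ) :=
      Complex.ofRealCLM.contDiff.comp
        ((hσs.comp contDiff_fst).mul ((contDiff_snd.sub contDiff_const).norm_sq ℝ)).neg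
    exact (c1.mul (hφ.comp contDiff_snd)).add c2
  let P : PhaseFamily n :=
    { o := o
      bump := χ
      Φ := Φ
      smooth := hΦs
      re_nonpos := fun z => by
        rw [hΦ, Complex.add_re, Complex.re_ofReal_mul, Complex.ofReal_re]
        have i1 := mul_nonpos_of_nonneg_of_nonpos (sub_nonneg.2 (hσI z.1).2) (hre z.2)
        have i2 := mul_nonneg (hσI z.1).1 (sq_nonneg ‖z.2 - o‖)
        linarith
      -- The factor `η` makes the inverse matrix globally smooth without changing it on the support
      -- of the bump.
      inv := fun k j z => (η z.2 : ℂ) * (M (σ z.1, z.2))⁻¹ k j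
      smooth_inv := fun k j => by
        have hcomp : ContDiff ℝ ∞ fun z : ℝ × Coord n => (σ z.1, z.2) :=
          (hσs.comp contDiff_fst).prodMk contDiff_snd
        have hη : ContDiff ℝ ∞ fun z : ℝ × Coord n => (η z.2 : ℂ) :=
          Complex.ofRealCLM.contDiff.comp (η.contDiff.comp contDiff_snd)
        rw [contDiff_iff_contDiffAt]
        intro z
        by_cases hz : z.2 ∈ Metric.ball o ε
        · have hd : (M (σ z.1, z.2)).det ≠ 0 := hMε _ (hσI _) _ hz
          have e : ∀ z : ℝ × Coord n, (M (σ z.1, z.2))⁻¹ k j =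
              (M (σ z.1, z.2)).det⁻¹ * (M (σ z.1, z.2)).adjugate k j := fun z => by
            rw [Matrix.inv_def, Ring.inverse_eq_inv']; rfl
          simp only [e]
          exact hη.contDiffAt.mul ((((contDiff_det hMs).comp hcomp).contDiffAt.inv hd).mul
            ((contDiff_adjugate hMs k j).comp hcomp).contDiffAt)
        · have hz' : z.2 ∉ Metric.closedBall o (2 * R) := fun h => hz (by
            rw [Metric.mem_closedBall] at h
            rw [Metric.mem_ball]
            have : R ≤ ε / 4 := min_le_right _ _
            linarith)
          have hev : (fun z : ℝ × Coord n => (η z.2 : ℂ) * (M (σ z.1, z.2))⁻¹ k j) =ᶠ[𝓝 z]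
              fun _ => 0 := by
            filter_upwards [(Metric.isClosed_closedBall.isOpen_compl.preimage
              continuous_snd).mem_nhds hz'] with w hw
            have hw' : 2 * R ≤ dist w.2 o := by
              have : w.2 ∉ Metric.closedBall o (2 * R) := hw
              rw [Metric.mem_closedBall] at this
              linarith
            rw [η.zero_of_le_dist hw']
            simp
          exact contDiffAt_const.congr_of_eventuallyEq hev
      coord_eq := fun z hz k => by
        have hη : η z.2 = 1 := η.one_of_mem_closedBall hz
        have hzε : z.2 ∈ Metric.ball o ε := by
          have hz' : dist z.2 o ≤ R := hz
          rw [Metric.mem_ball]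
          have : R ≤ ε / 4 := min_le_right _ _
          linarith
        have hd : IsUnit (M (σ z.1, z.2)).det := (hMε _ (hσI _) _ hzε).isUnit
        have hv := congrFun (Matrix.mulVec_mulVec (fun k => ((z.2 k - o k : ℝ) : ℂ))
          (M (σ z.1, z.2))⁻¹ (M (σ z.1, z.2))) k
        rw [Matrix.nonsing_inv_mul _ hd, Matrix.one_mulVec] at hv
        rw [← hv, Matrix.mulVec, dotProduct]
        refine Finset.sum_congr rfl fun j _ => ?_
        rw [show z = (z.1, z.2) from rfl, hpd, hη, Complex.ofReal_one, one_mul]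
        rfl }
  refine ⟨P, rfl, min_le_left _ _, fun y => ?_, fun y => ?_, fun s => ?_⟩
  · change Φ (0, y) = φ y
    simp [hΦ, hσ]
  · change Φ (1, y) = _
    simp [hΦ, hσ]
    rfl
  · have h := PhaseFamily.hasDerivAt_phase (P := P) s o
    have h2 : (fun s => P.Φ (s, o)) = fun _ => 0 := by
      funext s
      change Φ (s, o) = 0
      simp [hΦ, h0]
    rw [h2] at h
    exact h.unique (hasDerivAt_const s 0)

end Deformation

/-! ### Nonstationary phase in coordinates. -/

section Nonstationary

open Filter Asymptotics

variable {n : ℕ}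

theorem ContDiffOn.mul_of_tsupport_subset {O : Set (Coord n)} (hO : IsOpen O) {a g : Coord n → ℂ}
    (ha : ContDiffOn ℝ ∞ a O) (hg : ContDiff ℝ ∞ g) (hs : tsupport g ⊆ O) :
    ContDiff ℝ ∞ fun y => a y * g y :=
  contDiff_of_tsupport_subset hO (ha.mul hg.contDiffOn)
    ((tsupport_mul_subset_right (f := a) (g := g)).trans hs)

/-- Without critical points `∑ |∂_jφ|²` is nowhere zero, so `g = ∑ ∂_jφ G_j` with `G_j` the
conjugate of `∂_jφ` times `g`, divided by that sum. One integration by parts gains `1/m` and leaves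
amplitudes of the same kind, whence the induction over all `g`. -/
theorem isBigO_integral_of_fderiv_ne_zero {O : Set (Coord n)} (hO : IsOpen O) {φ : Coord n → ℂ}
    (hφ : ContDiffOn ℝ ∞ φ O) (hre : ∀ y ∈ O, (φ y).re ≤ 0)
    (hcrit : ∀ y ∈ O, fderiv ℝ φ y ≠ 0) (N : ℕ) :
    ∀ g : Coord n → ℂ, ContDiff ℝ ∞ g → HasCompactSupport g → tsupport g ⊆ O →
      (fun m : ℝ => ∫ y, Complex.exp (m * φ y) * g y) =O[atTop] fun m : ℝ => m⁻¹ ^ N := by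
  have hexp : ∀ m : ℝ, ContDiffOn ℝ ∞ (fun y => Complex.exp (m * φ y)) O := fun m =>
    Complex.contDiff_exp.comp_contDiffOn (contDiffOn_const.mul hφ)
  induction N with
  | zero =>
    intro g hg hc hs
    refine isBigO_one_inv_pow_zero (C := ∫ y, ‖g y‖) ?_
    filter_upwards [eventually_ge_atTop 0] with m hm
    refine MeasureTheory.norm_integral_le_of_norm_le
      (hg.continuous.integrable_of_hasCompactSupport hc).norm (Eventually.of_forall fun y => ?_)
    rw [norm_mul]
    by_cases hy : y ∈ O
    · exact mul_le_of_le_one_left (norm_nonneg _) (PhaseFamily.norm_exp_mul_le_one hm (hre y hy))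
    · rw [image_eq_zero_of_notMem_tsupport fun h => hy (hs h)]
      simp
  | succ N ih =>
    intro g hg hc hs
    let d : Fin (2 * n) → Coord n → ℂ := fun j y => fderiv ℝ φ y (EuclideanSpace.single j 1)
    have hd : ∀ j, ContDiffOn ℝ ∞ (d j) O := fun j =>
      (hφ.fderiv_of_isOpen hO (by simp)).clm_apply contDiffOn_const
    let D : Coord n → ℂ := fun y => ∑ j, d j y * (starRingEnd ℂ) (d j y)
    have hconj : ∀ j, ContDiffOn ℝ ∞ (fun y => (starRingEnd ℂ) (d j y)) O := fun j =>
      Complex.conjCLE.contDiff.comp_contDiffOn (hd j)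
    have hDs : ContDiffOn ℝ ∞ D O := ContDiffOn.sum fun j _ => (hd j).mul (hconj j)
    have hD0 : ∀ y ∈ O, D y ≠ 0 := by
      intro y hy h
      have h2 : ∑ j, Complex.normSq (d j y) = 0 := by
        have : D y = ((∑ j, Complex.normSq (d j y) : ℝ) : ℂ) := by
          push_cast
          exact Finset.sum_congr rfl fun j _ => Complex.mul_conj _
        rw [this] at h
        exact_mod_cast h
      have h3 := (Finset.sum_eq_zero_iff_of_nonneg fun j _ => Complex.normSq_nonneg (d j y)).1 h2
      refine hcrit y hy (ContinuousLinearMap.ext fun v => ?_)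
      rw [clm_apply_eq_sum]
      exact Finset.sum_eq_zero fun j hj => by
        rw [show fderiv ℝ φ y (EuclideanSpace.single j 1) = 0 from
          Complex.normSq_eq_zero.1 (h3 j hj), mul_zero]
    let G : Fin (2 * n) → Coord n → ℂ := fun j y => ((D y)⁻¹ * (starRingEnd ℂ) (d j y)) * g y
    have hGs : ∀ j, ContDiff ℝ ∞ (G j) := fun j =>
      ContDiffOn.mul_of_tsupport_subset hO ((hDs.inv hD0).mul (hconj j)) hg hs
    have hGsub : ∀ j, tsupport (G j) ⊆ tsupport g := fun j => tsupport_mul_subset_right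
    have hGc : ∀ j, HasCompactSupport (G j) := fun j => hc.mul_left
    have hsum : ∀ y, g y = ∑ j, d j y * G j y := by
      intro y
      by_cases hy : y ∈ O
      · have : ∑ j, d j y * G j y = (D y * (D y)⁻¹) * g y := by
          rw [Finset.sum_mul, Finset.sum_mul]
          exact Finset.sum_congr rfl fun j _ => by ring
        rw [this, mul_inv_cancel₀ (hD0 y hy), one_mul]
      · have h0 := image_eq_zero_of_notMem_tsupport fun h => hy (hs h)
        rw [h0]
        exact (Finset.sum_eq_zero fun j _ => by simp [G, h0]).symm
    let G' : Fin (2 * n) → Coord n → ℂ := fun j y => fderiv ℝ (G j) y (EuclideanSpace.single j 1)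
    have hG's : ∀ j, ContDiff ℝ ∞ (G' j) := fun j =>
      ((hGs j).fderiv_right (by simp)).clm_apply contDiff_const
    have hG'c : ∀ j, HasCompactSupport (G' j) := fun j => (hGc j).fderiv_apply ℝ _
    have hG'sub : ∀ j, tsupport (G' j) ⊆ O := fun j =>
      (tsupport_fderiv_apply_subset ℝ _).trans ((hGsub j).trans hs)
    have hint : ∀ (m : ℝ) (h : Coord n → ℂ), ContDiff ℝ ∞ h → HasCompactSupport h →
        tsupport h ⊆ O → MeasureTheory.Integrable fun y => Complex.exp (m * φ y) * h y :=
      fun m h h1 h2 h3 => (ContDiffOn.mul_of_tsupport_subset hO (hexp m) h1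
        h3).continuous.integrable_of_hasCompactSupport h2.mul_left
    have hdG : ∀ j, ContDiff ℝ ∞ fun y => d j y * G j y := fun j =>
      ContDiffOn.mul_of_tsupport_subset hO (hd j) (hGs j) ((hGsub j).trans hs)
    have hi1 : ∀ (m : ℝ) j, MeasureTheory.Integrable fun y =>
        Complex.exp (m * φ y) * (d j y * G j y) := fun m j =>
      hint m _ (hdG j) (hGc j).mul_left
        ((tsupport_mul_subset_right (f := d j) (g := G j)).trans ((hGsub j).trans hs))
    have hi2 : ∀ (m : ℝ) j, MeasureTheory.Integrable fun y => Complex.exp (m * φ y) * G' j y :=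
      fun m j => hint m _ (hG's j) (hG'c j) (hG'sub j)
    have hdiv : ∀ (m : ℝ) j, m * (∫ y, Complex.exp (m * φ y) * (d j y * G j y)) =
        -∫ y, Complex.exp (m * φ y) * G' j y := by
      intro m j
      have h := integral_exp_mul_divergence_eq_zero hO hφ (hGs j).contDiffOn
        ((hGsub j).trans hs) (hGc j) m (EuclideanSpace.single j 1)
      rw [eq_neg_iff_add_eq_zero, ← h, ← MeasureTheory.integral_const_mul,
        ← MeasureTheory.integral_add ((hi1 m j).const_mul _) (hi2 m j)]
      congr 1
      funext y
      simp only [d, G']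
      ring
    have key : ∀ m : ℝ, m ≠ 0 → ∫ y, Complex.exp (m * φ y) * g y =
        (m : ℂ)⁻¹ ^ 1 * ∑ j, -∫ y, Complex.exp (m * φ y) * G' j y := by
      intro m hm
      have hm' : (m : ℂ) ≠ 0 := by exact_mod_cast hm
      simp only [← hdiv]
      rw [pow_one, ← Finset.mul_sum, inv_mul_cancel_left₀ hm',
        ← MeasureTheory.integral_finsetSum _ fun j _ => hi1 m j]
      congr 1
      funext y
      rw [hsum y, Finset.mul_sum]
    have hO' : (fun m : ℝ => ∑ j, -∫ y, Complex.exp (m * φ y) * G' j y) =O[atTop]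
        fun m : ℝ => m⁻¹ ^ N :=
      IsBigO.fun_sum fun j _ => (ih (G' j) (hG's j) (hG'c j) (hG'sub j)).neg_left
    refine (((isBigO_inv_pow_self 1).mul hO').congr_right fun m => ?_).congr' ?_ EventuallyEq.rfl
    · ring
    · filter_upwards [eventually_ne_atTop 0] with m hm using (key m hm).symm

end Nonstationary

/-! ### The local expansion at the critical point, in coordinates. -/

section LocalExpansion

variable {n : ℕ}

theorem norm_iteratedFDeriv_comp_snd_le {u : Coord n → ℂ} (hu : ContDiff ℝ ∞ u) (j : ℕ)
    (z : ℝ × Coord n) :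
    ‖iteratedFDeriv ℝ j (fun z : ℝ × Coord n => u z.2) z‖ ≤ ‖iteratedFDeriv ℝ j u z.2‖ := by
  have e : (fun z : ℝ × Coord n => u z.2) = u ∘ ContinuousLinearMap.snd ℝ ℝ (Coord n) := rfl
  rw [e, (ContinuousLinearMap.snd ℝ ℝ (Coord n)).iteratedFDeriv_comp_right hu z
    (by exact_mod_cast le_top)]
  refine (ContinuousMultilinearMap.norm_compContinuousLinearMap_le _ _).trans ?_
  refine mul_le_of_le_one_right (norm_nonneg _) ?_
  exact Finset.prod_le_one (fun _ _ => norm_nonneg _)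
    fun _ _ => ContinuousLinearMap.norm_snd_le _ _ _

/-- Everything needed from the deformation, read at `s = 0`. Each application of `lower` costs two
derivatives, hence the order `2 r` of the `r`-th coefficient. The last clause, division by the
gradient of the phase, serves the uniqueness proof. -/
theorem exists_local_expansion {φ : Coord n → ℂ} (hφ : ContDiff ℝ ∞ φ) {o : Coord n}
    (hre : ∀ y, (φ y).re ≤ 0) (h0 : φ o = 0) (h1 : fderiv ℝ φ o = 0)
    (hdet : (hessianMatrix φ o).det ≠ 0) {R₀ : ℝ} (hR₀ : 0 < R₀) :
    ∃ R : ℝ, 0 < R ∧ R ≤ R₀ ∧ ∃ (S : (Coord n → ℂ) → PowerSeries ℂ) (κ : ℂ), κ ≠ 0 ∧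
      (∀ u, ContDiff ℝ ∞ u → (∀ y ∉ Metric.closedBall o R, u y = 0) →
        PowerAsymp (fun m => (m : ℂ) ^ n * ∫ y, Complex.exp (m * φ y) * u y) (S u)) ∧
      (∀ u, PowerSeries.constantCoeff (S u) = u o * κ) ∧
      (∀ r : ℕ, ∃ C : ℝ, 0 ≤ C ∧ ∀ u, ContDiff ℝ ∞ u → ∀ B, 0 ≤ B →
        (∀ j ≤ 2 * r, ∀ y ∈ Metric.closedBall o R, ‖iteratedFDeriv ℝ j u y‖ ≤ B) →
          ‖PowerSeries.coeff r (S u)‖ ≤ C * B) ∧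
      (∀ v, ContDiff ℝ ∞ v → v o = 0 → ∃ g : Fin (2 * n) → Coord n → ℂ,
        (∀ j, ContDiff ℝ ∞ (g j)) ∧ ∀ y ∈ Metric.closedBall o R,
          v y = ∑ j, fderiv ℝ φ y (EuclideanSpace.single j 1) * g j y) := by
  obtain ⟨P, rfl, hPR, hP0, hP1, hPv⟩ := exists_phaseFamily hφ hre h0 h1 hdet hR₀
  obtain ⟨a, ha, ha0⟩ := PhaseFamily.powerAsymp_osc_cutoff hPv hP1
  have hsnd : ∀ u : Coord n → ℂ, ContDiff ℝ ∞ u → ContDiff ℝ ∞ fun z : ℝ × Coord n => u z.2 :=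
    fun u hu => hu.comp contDiff_snd
  refine ⟨P.bump.rOut, P.bump.rOut_pos, hPR, fun u => P.relSeries (fun z => u z.2) * a,
    PowerSeries.constantCoeff a, ha0, ?_, ?_, ?_, ?_⟩
  · intro u hu hs
    have h := PhaseFamily.powerAsymp_osc ha (hsnd u hu) fun z hz => hs z.2 hz
    simpa only [PhaseFamily.osc, hP0] using h
  · intro u
    rw [map_mul, ← PowerSeries.coeff_zero_eq_constantCoeff_apply, PhaseFamily.relSeries,
      PowerSeries.coeff_mk]
    simp
  · intro r
    have hD : IsCompact (({0} : Set ℝ) ×ˢ Metric.closedBall P.o P.bump.rOut) :=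
      isCompact_singleton.prod (isCompact_closedBall _ _)
    -- A ball about `o` in the slice `s = 0` is stable under contractions, as the bounds on Hadamard
    -- coefficients require.
    have hstar : ∀ t ∈ Set.Icc (0 : ℝ) 1,
        ∀ z ∈ ({0} : Set ℝ) ×ˢ Metric.closedBall P.o P.bump.rOut,
          contraction P.o t z ∈ ({0} : Set ℝ) ×ˢ Metric.closedBall P.o P.bump.rOut := by
      rintro t ht ⟨s, y⟩ ⟨hs, hy⟩
      refine ⟨hs, ?_⟩
      simp only [contraction, Metric.mem_closedBall, dist_eq_norm, add_sub_cancel_left] at hy ⊢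
      rw [norm_smul, Real.norm_of_nonneg ht.1]
      exact (mul_le_of_le_one_left (norm_nonneg _) ht.2).trans hy
    have hb := fun i => ((P.boundedOfOrder_lower hD hstar).iterate i).bound 0
    choose C hC0 hC using hb
    refine ⟨∑ p ∈ Finset.HasAntidiagonal.antidiagonal r, C p.1 * ‖PowerSeries.coeff p.2 a‖,
      Finset.sum_nonneg fun p _ => mul_nonneg (hC0 _) (norm_nonneg _), fun u hu B hB hu' => ?_⟩
    rw [PowerSeries.coeff_mul, Finset.sum_mul]
    refine norm_sum_le_of_le _ fun p hp => ?_
    have hp' := Finset.HasAntidiagonal.mem_antidiagonal.1 hp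
    rw [norm_mul, PhaseFamily.relSeries, PowerSeries.coeff_mk, norm_mul, norm_pow, norm_neg,
      norm_one, one_pow, one_mul, mul_right_comm]
    refine mul_le_mul_of_nonneg_right ?_ (norm_nonneg _)
    have h := hC p.1 (fun z => u z.2) (hsnd u hu) B hB (fun j hj z hz =>
      (norm_iteratedFDeriv_comp_snd_le hu j z).trans (hu' j (by omega) z.2 hz.2)) 0 le_rfl (0, P.o)
      ⟨rfl, Metric.mem_closedBall_self P.bump.rOut_pos.le⟩
    simpa using h
  · intro v hv hv0
    refine ⟨fun j y => P.gradCoeff j (fun z => v z.2) (0, y), fun j =>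
      PhaseFamily.contDiff_slice (PhaseFamily.contDiff_gradCoeff (hsnd v hv) j) 0, fun y hy => ?_⟩
    have h := PhaseFamily.resid_eq_of_mem (P := P) (hsnd v hv) (z := (0, y)) hy
    have e : (fun y => P.Φ (0, y)) = φ := funext hP0
    simp only [PhaseFamily.resid, PhaseFamily.contraction_zero, hv0, mul_zero,
      add_zero, ← fderiv_slice P.smooth, e] at h
    exact h

end LocalExpansion

/-! ### Extension of a series of functionals to formal functions, linearly over `𝕂`. -/

section FormalExtension

variable {V : Type*} [AddCommGroup V] [Module ℂ V]

/-- The antidiagonal of the Hahn product depends on the supports. Lower bounds for the exponents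
replace it by an interval of fixed length, so that sums for different coefficients can be compared
and interchanged. -/
theorem HahnModule.coeff_smul_eq_sum_range {a : HahnSeries ℤ ℂ} {F : HahnModule ℤ ℂ V}
    {p q l : ℤ} {M : ℕ} (ha : ∀ i < p, a.coeff i = 0)
    (hF : ∀ j < q, ((HahnModule.of ℂ).symm F).coeff j = 0) (hM : l - q < p + M) :
    ((HahnModule.of ℂ).symm (a • F)).coeff l = ∑ i ∈ Finset.range M,
      a.coeff (p + i) • ((HahnModule.of ℂ).symm F).coeff (l - (p + i)) := by
  rw [HahnModule.coeff_smul]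
  have hmem : ∀ ij : ℤ × ℤ, a.coeff ij.1 ≠ 0 → ((HahnModule.of ℂ).symm F).coeff ij.2 ≠ 0 →
      ij.1 + ij.2 = l → p ≤ ij.1 ∧ ij.1 < p + M := by
    intro ij h1 h2 h3
    have := not_lt.1 fun h => h1 (ha _ h)
    have := not_lt.1 fun h => h2 (hF _ h)
    omega
  refine Finset.sum_of_injOn (fun ij => (ij.1 - p).toNat) ?_ ?_ ?_ ?_
  · intro x hx y hy hxy
    simp only [Finset.mem_coe, Finset.mem_vaddAntidiagonal, HahnSeries.mem_support,
      vadd_eq_add] at hx hy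
    have h1 := hmem x hx.1 hx.2.1 hx.2.2
    have h2 := hmem y hy.1 hy.2.1 hy.2.2
    simp only at hxy
    ext <;> omega
  · intro x hx
    simp only [Finset.mem_coe, Finset.mem_vaddAntidiagonal, HahnSeries.mem_support,
      vadd_eq_add] at hx
    have h1 := hmem x hx.1 hx.2.1 hx.2.2
    simp only [Finset.coe_range, Set.mem_Iio]
    omega
  · intro i hi hi'
    by_contra h
    have h1 : a.coeff (p + i) ≠ 0 := fun h0 => h (by rw [h0, zero_smul])
    have h2 : ((HahnModule.of ℂ).symm F).coeff (l - (p + i)) ≠ 0 := fun h0 =>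
      h (by rw [h0, smul_zero])
    refine hi' ⟨(p + i, l - (p + i)), ?_, by simp⟩
    simp only [Finset.mem_coe, Finset.mem_vaddAntidiagonal, HahnSeries.mem_support, vadd_eq_add]
    exact ⟨h1, h2, by ring⟩
  · intro x hx
    simp only [Finset.mem_vaddAntidiagonal, HahnSeries.mem_support, vadd_eq_add] at hx
    have h1 := hmem x hx.1 hx.2.1 hx.2.2
    have e : p + ((x.1 - p).toNat : ℤ) = x.1 := by omega
    rw [e, ← hx.2.2, add_sub_cancel_left]

theorem HahnSeries.coeff_mul_eq_sum_range {R : Type*} [CommRing R] {a b : HahnSeries ℤ R}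
    {p q l : ℤ} {M : ℕ}
    (ha : ∀ i < p, a.coeff i = 0) (hb : ∀ j < q, b.coeff j = 0) (hM : l - q < p + M) :
    (a * b).coeff l = ∑ i ∈ Finset.range M, a.coeff (p + i) * b.coeff (l - (p + i)) := by
  rw [HahnSeries.coeff_mul]
  have hmem : ∀ ij : ℤ × ℤ, a.coeff ij.1 ≠ 0 → b.coeff ij.2 ≠ 0 →
      ij.1 + ij.2 = l → p ≤ ij.1 ∧ ij.1 < p + M := by
    intro ij h1 h2 h3
    have := not_lt.1 fun h => h1 (ha _ h)
    have := not_lt.1 fun h => h2 (hb _ h)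
    omega
  refine Finset.sum_of_injOn (fun ij => (ij.1 - p).toNat) ?_ ?_ ?_ ?_
  · intro x hx y hy hxy
    simp only [Finset.mem_coe, Finset.mem_antidiagonal, HahnSeries.mem_support] at hx hy
    have h1 := hmem x hx.1 hx.2.1 hx.2.2
    have h2 := hmem y hy.1 hy.2.1 hy.2.2
    simp only at hxy
    ext <;> omega
  · intro x hx
    simp only [Finset.mem_coe, Finset.mem_antidiagonal, HahnSeries.mem_support] at hx
    have h1 := hmem x hx.1 hx.2.1 hx.2.2
    simp only [Finset.coe_range, Set.mem_Iio]
    omega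
  · intro i hi hi'
    by_contra h
    have h1 : a.coeff (p + i) ≠ 0 := fun h0 => h (by rw [h0, zero_mul])
    have h2 : b.coeff (l - (p + i)) ≠ 0 := fun h0 => h (by rw [h0, mul_zero])
    refine hi' ⟨(p + i, l - (p + i)), ?_, by simp⟩
    simp only [Finset.mem_coe, Finset.mem_antidiagonal, HahnSeries.mem_support]
    exact ⟨h1, h2, by ring⟩
  · intro x hx
    simp only [Finset.mem_antidiagonal, HahnSeries.mem_support] at hx
    have h1 := hmem x hx.1 hx.2.1 hx.2.2
    have e : p + ((x.1 - p).toNat : ℤ) = x.1 := by omega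
    rw [e, ← hx.2.2, add_sub_cancel_left]

theorem HahnSeries.exists_coeff_eq_zero_of_lt {R : Type*} [Zero R] (a : HahnSeries ℤ R) :
    ∃ p : ℤ, ∀ i < p, a.coeff i = 0 :=
  ⟨a.order, fun _ h => HahnSeries.coeff_eq_zero_of_lt_order h⟩

omit [Module ℂ V] in
/-- The coefficient of `ν ^ k` of the formal extension of `t = ∑_r ν^r t_r`. -/
theorem finsum_coeff_eq_sum_range {W : Type*} [AddCommMonoid W] (T : ℕ → V →+ W)
    {F : ℤ → V} {q k : ℤ} {N : ℕ} (hF : ∀ j < q, F j = 0) (hN : k - q < N) :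
    ∑ᶠ r : ℕ, T r (F (k - r)) = ∑ r ∈ Finset.range N, T r (F (k - r)) := by
  refine finsum_eq_sum_of_support_subset _ fun r hr => ?_
  by_contra h
  refine hr ?_
  have : N ≤ r := by simpa using h
  simp only
  rw [hF _ (by omega), map_zero]

/-- The `𝕂`-linear extension of a formal series of linear functionals. -/
theorem exists_formalExtension (T : ℕ → V →ₗ[ℂ] ℂ) :
    ∃ K : HahnModule ℤ ℂ V →ₗ[LaurentSeries ℂ] LaurentSeries ℂ, ∀ (F : HahnSeries ℤ V) (k : ℤ),
      (K (HahnModule.of ℂ F)).coeff k = ∑ᶠ r : ℕ, T r (F.coeff (k - r)) := by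
  have hsum : ∀ {F : ℤ → V} {q k : ℤ} {N : ℕ}, (∀ j < q, F j = 0) → k - q < N →
      ∑ᶠ r : ℕ, T r (F (k - r)) = ∑ r ∈ Finset.range N, T r (F (k - r)) :=
    fun hF hN => finsum_coeff_eq_sum_range (fun r => (T r).toAddMonoidHom) hF hN
  have hbdd : ∀ {F : ℤ → V} {q : ℤ}, (∀ j < q, F j = 0) → ∀ k < q,
      ∑ᶠ r : ℕ, T r (F (k - r)) = 0 := fun hF k hk => by
    rw [hsum hF (N := 0) (by push_cast; omega)]; simp
  let K₀ : HahnModule ℤ ℂ V → LaurentSeries ℂ := fun F =>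
    HahnSeries.ofSuppBddBelow (fun k => ∑ᶠ r : ℕ, T r (((HahnModule.of ℂ).symm F).coeff (k - r)))
      (by
        obtain ⟨q, hq⟩ := HahnSeries.exists_coeff_eq_zero_of_lt ((HahnModule.of ℂ).symm F)
        exact ⟨q, fun k hk => not_lt.1 fun h => hk (hbdd hq k h)⟩)
  have hK₀ : ∀ F k, (K₀ F).coeff k =
      ∑ᶠ r : ℕ, T r (((HahnModule.of ℂ).symm F).coeff (k - r)) := fun F k => rfl
  refine ⟨{ toFun := K₀, map_add' := fun F G => ?_, map_smul' := fun a F => ?_ },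
    fun F k => rfl⟩
  · ext k
    obtain ⟨q, hq⟩ := HahnSeries.exists_coeff_eq_zero_of_lt ((HahnModule.of ℂ).symm F)
    obtain ⟨q', hq'⟩ := HahnSeries.exists_coeff_eq_zero_of_lt ((HahnModule.of ℂ).symm G)
    rw [HahnSeries.coeff_add, hK₀, hK₀, hK₀]
    have h1 : ∀ j < min q q', ((HahnModule.of ℂ).symm F).coeff j = 0 :=
      fun j hj => hq j (lt_min_iff.1 hj).1
    have h2 : ∀ j < min q q', ((HahnModule.of ℂ).symm G).coeff j = 0 :=
      fun j hj => hq' j (lt_min_iff.1 hj).2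
    have h3 : ∀ j < min q q', ((HahnModule.of ℂ).symm (F + G)).coeff j = 0 := fun j hj => by
      change ((HahnModule.of ℂ).symm F).coeff j + ((HahnModule.of ℂ).symm G).coeff j = 0
      rw [h1 j hj, h2 j hj, add_zero]
    have hN : k - min q q' < ((k - min q q' + 1).toNat : ℕ) := by omega
    rw [hsum h1 hN, hsum h2 hN, hsum h3 hN, ← Finset.sum_add_distrib]
    exact Finset.sum_congr rfl fun r _ => map_add (T r) _ _
  · ext k
    obtain ⟨p, hp⟩ := HahnSeries.exists_coeff_eq_zero_of_lt a
    obtain ⟨q, hq⟩ := HahnSeries.exists_coeff_eq_zero_of_lt ((HahnModule.of ℂ).symm F)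
    have hpq : ∀ j < p + q, ((HahnModule.of ℂ).symm (a • F)).coeff j = 0 := fun j hj => by
      rw [HahnModule.coeff_smul_eq_sum_range (M := 0) hp hq (by push_cast; omega)]; simp
    have hKq : ∀ j < q, (K₀ F).coeff j = 0 := fun j hj => hbdd hq j hj
    set N : ℕ := (k - (p + q) + 1).toNat with hN
    have h0 : k - (p + q) < N := by omega
    rw [hK₀, hsum hpq h0, RingHom.id_apply, smul_eq_mul,
      HahnSeries.coeff_mul_eq_sum_range (M := N) hp hKq (by omega)]
    have e1 : ∀ r ∈ Finset.range N, T r (((HahnModule.of ℂ).symm (a • F)).coeff (k - r)) =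
        ∑ i ∈ Finset.range N,
          a.coeff (p + i) * T r (((HahnModule.of ℂ).symm F).coeff (k - (p + i) - r)) := by
      intro r _
      rw [HahnModule.coeff_smul_eq_sum_range (M := N) hp hq (by omega), map_sum]
      refine Finset.sum_congr rfl fun i _ => ?_
      rw [map_smul, smul_eq_mul, show k - (r : ℤ) - (p + i) = k - (p + i) - r by ring]
    rw [Finset.sum_congr rfl e1, Finset.sum_comm]
    refine Finset.sum_congr rfl fun i _ => ?_
    rw [hK₀, hsum hq (N := N) (by omega), Finset.mul_sum]

end FormalExtension

/-! ### Functions, differentials and vector fields read in a chart. -/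

section ChartCalculus

variable {n : ℕ} {U : Type*} [TopologicalSpace U] [ChartedSpace (Coord n) U]

/-- The function `f` read in the chart at `p`. -/
def chartRep (p : U) (f : SmoothFn n U) (y : Coord n) : ℂ :=
  f.1 ((chartAt (Coord n) p).symm y)

/-- The transfer to `U` of a function given in the chart at `p`, extended by zero. -/
noncomputable def chartExtend {F : Type*} [Zero F] (p : U) (g : Coord n → F) : U → F :=
  (chartAt (Coord n) p).source.indicator fun x => g (chartAt (Coord n) p x)

theorem chartExtend_of_mem {F : Type*} [Zero F] {p x : U} (g : Coord n → F)
    (hx : x ∈ (chartAt (Coord n) p).source) : chartExtend p g x = g (chartAt (Coord n) p x) :=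
  Set.indicator_of_mem hx _

theorem chartExtend_symm {F : Type*} [Zero F] {p : U} (g : Coord n → F) {y : Coord n}
    (hy : y ∈ (chartAt (Coord n) p).target) :
    chartExtend p g ((chartAt (Coord n) p).symm y) = g y := by
  rw [chartExtend_of_mem g ((chartAt (Coord n) p).map_target hy),
    (chartAt (Coord n) p).right_inv hy]

theorem isCompact_symm_image {p : U} {K : Set (Coord n)} (hK : IsCompact K)
    (hsub : K ⊆ (chartAt (Coord n) p).target) :
    IsCompact ((chartAt (Coord n) p).symm '' K) :=
  hK.image_of_continuousOn ((chartAt (Coord n) p).continuousOn_symm.mono hsub)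

theorem support_chartExtend_subset {F : Type*} [Zero F] {p : U} {g : Coord n → F}
    {K : Set (Coord n)} (hK : ∀ y ∉ K, g y = 0) :
    Function.support (chartExtend p g) ⊆ (chartAt (Coord n) p).symm '' K := by
  intro x hx
  by_cases hs : x ∈ (chartAt (Coord n) p).source
  · rw [Function.mem_support, chartExtend_of_mem g hs] at hx
    exact ⟨chartAt (Coord n) p x, by_contra fun h => hx (hK _ h),
      (chartAt (Coord n) p).left_inv hs⟩
  · exact absurd (Set.indicator_of_notMem hs _) hx

theorem tsupport_chartExtend_subset [T2Space U] {F : Type*} [Zero F] {p : U} {g : Coord n → F}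
    {K : Set (Coord n)} (hK : IsCompact K) (hsub : K ⊆ (chartAt (Coord n) p).target)
    (hg : ∀ y ∉ K, g y = 0) :
    tsupport (chartExtend p g) ⊆ (chartAt (Coord n) p).symm '' K :=
  closure_minimal (support_chartExtend_subset hg) (isCompact_symm_image hK hsub).isClosed

theorem symm_image_subset_source {p : U} {K : Set (Coord n)}
    (hsub : K ⊆ (chartAt (Coord n) p).target) :
    (chartAt (Coord n) p).symm '' K ⊆ (chartAt (Coord n) p).source := by
  rintro _ ⟨y, hy, rfl⟩
  exact (chartAt (Coord n) p).map_target (hsub hy)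

theorem hasCompactSupport_chartExtend [T2Space U] {F : Type*} [Zero F] {p : U}
    {g : Coord n → F} {K : Set (Coord n)} (hK : IsCompact K)
    (hsub : K ⊆ (chartAt (Coord n) p).target) (hg : ∀ y ∉ K, g y = 0) :
    HasCompactSupport (chartExtend p g) :=
  (isCompact_symm_image hK hsub).of_isClosed_subset (isClosed_tsupport _)
    (tsupport_chartExtend_subset hK hsub hg)

variable [IsManifold (𝓡 (2 * n)) ∞ U]

/-- The image of `K` in `U` is compact, hence closed by the Hausdorff property. The extension by
zero is therefore locally zero off that image, also at the boundary of the chart domain. -/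
theorem contMDiff_chartExtend [T2Space U] {F : Type*} [NormedAddCommGroup F] [NormedSpace ℝ F]
    {p : U} {g : Coord n → F} (hg : ContDiff ℝ ∞ g) {K : Set (Coord n)} (hK : IsCompact K)
    (hsub : K ⊆ (chartAt (Coord n) p).target) (hg0 : ∀ y ∉ K, g y = 0) :
    ContMDiff (𝓡 (2 * n)) 𝓘(ℝ, F) ∞ (chartExtend p g) := by
  intro x
  by_cases hx : x ∈ (chartAt (Coord n) p).symm '' K
  · have hs := symm_image_subset_source hsub hx
    have hchart : ContMDiffAt (𝓡 (2 * n)) (𝓡 (2 * n)) ∞ (chartAt (Coord n) p) x :=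
      (contMDiffOn_chart x hs).contMDiffAt ((chartAt (Coord n) p).open_source.mem_nhds hs)
    have hcomp : ContMDiffAt (𝓡 (2 * n)) 𝓘(ℝ, F) ∞ (g ∘ chartAt (Coord n) p) x :=
      hg.contMDiff.contMDiffAt.comp x hchart
    refine hcomp.congr_of_eventuallyEq ?_
    filter_upwards [(chartAt (Coord n) p).open_source.mem_nhds hs] with z hz
    exact chartExtend_of_mem g hz
  · have hev : chartExtend p g =ᶠ[𝓝 x] fun _ => 0 := by
      filter_upwards [(isCompact_symm_image hK hsub).isClosed.isOpen_compl.mem_nhds hx] with z hz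
      exact by_contra fun h => hz (support_chartExtend_subset hg0 h)
    exact contMDiffAt_const.congr_of_eventuallyEq hev

/-- `chartExtend` as a smooth function. -/
theorem exists_smoothFn_chartExtend [T2Space U] {p : U} {g : Coord n → ℂ} (hg : ContDiff ℝ ∞ g)
    {K : Set (Coord n)} (hK : IsCompact K) (hsub : K ⊆ (chartAt (Coord n) p).target)
    (hg0 : ∀ y ∉ K, g y = 0) : ∃ G : SmoothFn n U, G.1 = chartExtend p g :=
  ⟨⟨chartExtend p g, contMDiff_chartExtend hg hK hsub hg0⟩, rfl⟩

theorem contDiffOn_chartRep (p : U) (f : SmoothFn n U) :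
    ContDiffOn ℝ ∞ (chartRep p f) (chartAt (Coord n) p).target := by
  rw [← contMDiffOn_iff_contDiffOn]
  exact (show ContMDiff (𝓡 (2 * n)) 𝓘(ℝ, ℂ) ∞ f.1 from f.2).comp_contMDiffOn
    (contMDiffOn_chart_symm (I := 𝓡 (2 * n)) (x := p))

omit [IsManifold (𝓡 (2 * n)) ∞ U] in
theorem mdifferentiableAt_smoothFn (f : SmoothFn n U) (x : U) :
    MDifferentiableAt (𝓡 (2 * n)) 𝓘(ℝ, ℂ) f.1 x :=
  ContMDiff.mdifferentiable (n := ∞)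
    (show ContMDiff (𝓡 (2 * n)) 𝓘(ℝ, ℂ) ∞ f.1 from f.2) (by simp) x

theorem mdifferentiableAt_chart {p x : U} (hx : x ∈ (chartAt (Coord n) p).source) :
    MDifferentiableAt (𝓡 (2 * n)) (𝓡 (2 * n)) (chartAt (Coord n) p) x :=
  ((contMDiffOn_chart (n := ∞) x hx).contMDiffAt
    ((chartAt (Coord n) p).open_source.mem_nhds hx)).mdifferentiableAt (by simp)

theorem mdifferentiableAt_chart_symm {p : U} {y : Coord n}
    (hy : y ∈ (chartAt (Coord n) p).target) :
    MDifferentiableAt (𝓡 (2 * n)) (𝓡 (2 * n)) (chartAt (Coord n) p).symm y :=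
  ((contMDiffOn_chart_symm (n := ∞) y hy).contMDiffAt
    ((chartAt (Coord n) p).open_target.mem_nhds hy)).mdifferentiableAt (by simp)

theorem mfderiv_eq_fderiv_chartRep {p x : U} (hx : x ∈ (chartAt (Coord n) p).source)
    (f : SmoothFn n U) (v : TangentSpace (𝓡 (2 * n)) x) :
    mfderiv (𝓡 (2 * n)) 𝓘(ℝ, ℂ) f.1 x v =
      fderiv ℝ (chartRep p f) (chartAt (Coord n) p x)
        (mfderiv (𝓡 (2 * n)) (𝓡 (2 * n)) (chartAt (Coord n) p) x v) := by
  have hy := (chartAt (Coord n) p).map_source hx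
  have h1 : HasMFDerivAt (𝓡 (2 * n)) 𝓘(ℝ, ℂ) (chartRep p f) (chartAt (Coord n) p x)
      (fderiv ℝ (chartRep p f) (chartAt (Coord n) p x)) :=
    (((contDiffOn_chartRep p f).contDiffAt
      ((chartAt (Coord n) p).open_target.mem_nhds hy)).differentiableAt
        (by simp)).hasFDerivAt.hasMFDerivAt
  have h2 := h1.comp x (mdifferentiableAt_chart hx).hasMFDerivAt
  have h3 : chartRep p f ∘ chartAt (Coord n) p =ᶠ[𝓝 x] f.1 := by
    filter_upwards [(chartAt (Coord n) p).open_source.mem_nhds hx] with z hz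
    simp only [Function.comp_apply, chartRep, (chartAt (Coord n) p).left_inv hz]
  have h4 := (h2.congr_of_eventuallyEq h3.symm).mfderiv
  exact congrArg (fun A => A v) h4

theorem isCriticalPoint_of_fderiv_chartRep {p : U} {y : Coord n}
    (hy : y ∈ (chartAt (Coord n) p).target) {f : SmoothFn n U}
    (h : fderiv ℝ (chartRep p f) y = 0) :
    IsCriticalPoint f ((chartAt (Coord n) p).symm y) := by
  refine ContinuousLinearMap.ext fun v => ?_
  rw [mfderiv_eq_fderiv_chartRep ((chartAt (Coord n) p).map_target hy) f v,
    (chartAt (Coord n) p).right_inv hy, h]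
  rfl

theorem fderiv_chartRep_of_isCriticalPoint {p : U} {y : Coord n}
    (hy : y ∈ (chartAt (Coord n) p).target) {f : SmoothFn n U}
    (h : IsCriticalPoint f ((chartAt (Coord n) p).symm y)) :
    fderiv ℝ (chartRep p f) y = 0 := by
  have h1 := (mdifferentiableAt_smoothFn f _).hasMFDerivAt.comp y
    (mdifferentiableAt_chart_symm hy).hasMFDerivAt
  have h2 := h1.mfderiv
  rw [show mfderiv (𝓡 (2 * n)) 𝓘(ℝ, ℂ) f.1 ((chartAt (Coord n) p).symm y) = 0 from h] at h2
  rw [mfderiv_eq_fderiv] at h2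
  refine ContinuousLinearMap.ext fun v => ?_
  exact congrArg (fun A => A v) h2

/-! ### Vector fields in a chart -/

/-- Over the chart domain the tangent bundle trivialization is the differential of the chart.
Smoothness of sections is formulated through the former, components through the latter. -/
theorem component_eq_trivialization (ξ : SmoothVectorField n U) (p : U) (k : Fin (2 * n))
    {y : Coord n} (hy : y ∈ (chartAt (Coord n) p).target) :
    ξ.component p k y = (show Coord n from
      (trivializationAt (Coord n) (TangentSpace (𝓡 (2 * n)) : U → Type _) p
        ⟨(chartAt (Coord n) p).symm y, ξ ((chartAt (Coord n) p).symm y)⟩).2) k := by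
  have hx := (chartAt (Coord n) p).map_target hy
  have h := TangentBundle.continuousLinearMapAt_trivializationAt (I := 𝓡 (2 * n)) (𝕜 := ℝ) hx
  have h2 := congrArg (fun A => A (ξ ((chartAt (Coord n) p).symm y))) h
  simp only [Bundle.Trivialization.continuousLinearMapAt_apply] at h2
  rw [Bundle.Trivialization.linearMapAt_apply, if_pos (by simpa using hx)] at h2
  rw [h2]
  rfl

theorem contDiffOn_component (ξ : SmoothVectorField n U) (p : U) (k : Fin (2 * n)) :
    ContDiffOn ℝ ∞ (ξ.component p k) (chartAt (Coord n) p).target := by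
  have h1 : ContMDiffOn (𝓡 (2 * n)) 𝓘(ℝ, Coord n) ∞ (fun x =>
      (trivializationAt (Coord n) (TangentSpace (𝓡 (2 * n)) : U → Type _) p ⟨x, ξ x⟩).2)
      (chartAt (Coord n) p).source := by
    have := (Bundle.Trivialization.contMDiffOn_section_baseSet_iff (IB := 𝓡 (2 * n)) (n := ∞)
      (s := fun x => ξ x)
      (trivializationAt (Coord n) (TangentSpace (𝓡 (2 * n)) : U → Type _) p)).1
      ξ.contMDiff.contMDiffOn
    simpa using this
  have h2 := h1.comp (contMDiffOn_chart_symm (I := 𝓡 (2 * n)) (n := ∞) (x := p))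
    fun y hy => (chartAt (Coord n) p).map_target hy
  rw [contMDiffOn_iff_contDiffOn] at h2
  have h3 := (EuclideanSpace.proj (𝕜 := ℝ) k : Coord n →L[ℝ] ℝ).contDiff.comp_contDiffOn h2
  exact h3.congr fun y hy => component_eq_trivialization ξ p k hy

theorem apply_eq_sum_component (ξ : SmoothVectorField n U) (f : SmoothFn n U) (p : U)
    {y : Coord n} (hy : y ∈ (chartAt (Coord n) p).target) :
    ξ.apply f ((chartAt (Coord n) p).symm y) = ∑ k, (ξ.component p k y : ℂ) *
      fderiv ℝ (chartRep p f) y (EuclideanSpace.single k 1) := by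
  rw [SmoothVectorField.apply,
    mfderiv_eq_fderiv_chartRep ((chartAt (Coord n) p).map_target hy) f,
    (chartAt (Coord n) p).right_inv hy]
  exact clm_apply_eq_sum _ _

/-- The coordinate vector fields, cut off by a function with support in the chart. -/
theorem exists_coordinateField [T2Space U] {p : U} {g : Coord n → ℝ} (hg : ContDiff ℝ ∞ g)
    {K : Set (Coord n)} (hK : IsCompact K) (hsub : K ⊆ (chartAt (Coord n) p).target)
    (hg0 : ∀ y ∉ K, g y = 0) (j : Fin (2 * n)) :
    ∃ ξ : SmoothVectorField n U, ∀ y ∈ (chartAt (Coord n) p).target, ∀ k,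
      ξ.component p k y = if k = j then g y else 0 := by
  set T := trivializationAt (Coord n) (TangentSpace (𝓡 (2 * n)) : U → Type _) p with hT
  have hbase : T.baseSet = (chartAt (Coord n) p).source := by simp [hT]
  let v : Coord n := EuclideanSpace.single j 1
  have hs : ContMDiffOn (𝓡 (2 * n)) ((𝓡 (2 * n)).prod 𝓘(ℝ, Coord n)) ∞
      (fun x => (⟨x, T.symm x v⟩ : Bundle.TotalSpace (Coord n)
        (TangentSpace (𝓡 (2 * n)) : U → Type _))) T.baseSet := by
    refine (Bundle.Trivialization.contMDiffOn_section_baseSet_iff (IB := 𝓡 (2 * n)) (n := ∞)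
      (s := fun x => T.symm x v) T).2 ?_
    refine (contMDiffOn_const (c := v)).congr fun x hx => ?_
    rw [T.apply_mk_symm hx]
  have hψ : ContMDiff (𝓡 (2 * n)) 𝓘(ℝ, ℝ) ∞ (chartExtend p g) :=
    contMDiff_chartExtend hg hK hsub hg0
  have hψs : tsupport (chartExtend p g) ⊆ T.baseSet := by
    rw [hbase]
    exact (tsupport_chartExtend_subset hK hsub hg0).trans (symm_image_subset_source hsub)
  have hsec := ContMDiffOn.smul_section_of_tsupport (s := fun x => T.symm x v)
    (ψ := chartExtend p g) hψ.contMDiffOn T.open_baseSet hψs hs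
  refine ⟨⟨_, hsec⟩, fun y hy k => ?_⟩
  have hx := (chartAt (Coord n) p).map_target hy
  rw [component_eq_trivialization _ p k hy]
  have hx' : (chartAt (Coord n) p).symm y ∈ T.baseSet := by rwa [hbase]
  have h1 : (T ⟨(chartAt (Coord n) p).symm y, chartExtend p g ((chartAt (Coord n) p).symm y) •
      T.symm ((chartAt (Coord n) p).symm y) v⟩).2 = g y • v := by
    have := (T.linear ℝ hx').map_smul (chartExtend p g ((chartAt (Coord n) p).symm y))
      (T.symm ((chartAt (Coord n) p).symm y) v)
    rw [this, T.apply_mk_symm hx', chartExtend_symm g hy]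
  have h2 := congrArg (fun w : Coord n => w k) h1
  refine h2.trans ?_
  by_cases hk : k = j
  · simp [v, hk]
  · simp [v, hk]

end ChartCalculus

/-! ### Integration against the volume form and its expression in a chart. -/

section ChartIntegral

variable {n : ℕ} {U : Type*} [TopologicalSpace U] [ChartedSpace (Coord n) U]
  [MeasurableSpace U]

namespace VolumeForm

open MeasureTheory

theorem map_absolutelyContinuous (dx : VolumeForm n U) (p : U) :
    (dx.base.restrict (chartAt (Coord n) p).source).map (chartAt (Coord n) p) ≪
      (volume : Measure (Coord n)).restrict (chartAt (Coord n) p).target := by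
  rw [dx.map_base]
  exact withDensity_absolutelyContinuous _ _

variable [BorelSpace U]

theorem integral_base_eq (dx : VolumeForm n U) (p : U) {F : U → ℂ} (hF : Continuous F)
    (hs : ∀ x ∉ (chartAt (Coord n) p).source, F x = 0) :
    ∫ x, F x ∂dx.base = ∫ y in (chartAt (Coord n) p).target,
      F ((chartAt (Coord n) p).symm y) * (dx.baseDensity p y : ℂ) := by
  set e := chartAt (Coord n) p with he
  have hsrc : MeasurableSet e.source := e.open_source.measurableSet
  have htgt : MeasurableSet e.target := e.open_target.measurableSet
  have hemeas : AEMeasurable e (dx.base.restrict e.source) := e.continuousOn.aemeasurable hsrc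
  have hG : AEStronglyMeasurable (fun y => F (e.symm y))
      ((volume : Measure (Coord n)).restrict e.target) :=
    (hF.comp_continuousOn e.continuousOn_symm).aestronglyMeasurable htgt
  have hdens : AEMeasurable (fun y => ENNReal.ofReal (dx.baseDensity p y))
      ((volume : Measure (Coord n)).restrict e.target) :=
    ((dx.smooth_baseDensity p).continuousOn.aemeasurable htgt).ennreal_ofReal
  calc ∫ x, F x ∂dx.base = ∫ x in e.source, F x ∂dx.base :=
        (setIntegral_eq_integral_of_forall_compl_eq_zero fun x hx => hs x hx).symm
    _ = ∫ x in e.source, F (e.symm (e x)) ∂dx.base :=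
        setIntegral_congr_fun hsrc fun x hx => by simp only [e.left_inv hx]
    _ = ∫ y, F (e.symm y) ∂((dx.base.restrict e.source).map e) :=
        (integral_map hemeas (hG.mono_ac (dx.map_absolutelyContinuous p))).symm
    _ = ∫ y in e.target, (ENNReal.ofReal (dx.baseDensity p y)).toReal • F (e.symm y) := by
        rw [dx.map_base p, integral_withDensity_eq_integral_toReal_smul₀ hdens]
        exact ae_of_all _ fun y => ENNReal.ofReal_lt_top
    _ = _ := by
        refine setIntegral_congr_fun htgt fun y hy => ?_
        simp only [ENNReal.toReal_ofReal (dx.baseDensity_pos p y hy).le, Complex.real_smul]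
        ring

/-- On a compact ball in a chart the density is continuous, hence bounded. -/
theorem isLocallyFiniteMeasure_base (dx : VolumeForm n U) : IsLocallyFiniteMeasure dx.base := by
  refine ⟨fun x => ?_⟩
  set e := chartAt (Coord n) x with he
  have hsrc : MeasurableSet e.source := e.open_source.measurableSet
  have hemeas : AEMeasurable e (dx.base.restrict e.source) := e.continuousOn.aemeasurable hsrc
  have hx : x ∈ e.source := mem_chart_source _ x
  have hmem : e.target ∈ 𝓝 (e x) := e.open_target.mem_nhds (e.map_source hx)
  obtain ⟨R, hR, hsub⟩ := Metric.nhds_basis_closedBall.mem_iff.1 hmem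
  have hK : IsCompact (Metric.closedBall (e x) R) := isCompact_closedBall _ _
  refine ⟨e.source ∩ e ⁻¹' Metric.closedBall (e x) R, ?_, ?_⟩
  · exact Filter.inter_mem (e.open_source.mem_nhds hx)
      ((e.continuousAt hx) (Metric.closedBall_mem_nhds _ hR))
  · have h1 : dx.base (e.source ∩ e ⁻¹' Metric.closedBall (e x) R) =
        ((dx.base.restrict e.source).map e) (Metric.closedBall (e x) R) := by
      rw [Measure.map_apply_of_aemeasurable hemeas Metric.isClosed_closedBall.measurableSet,
        Measure.restrict_apply' hsrc, Set.inter_comm]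
    rw [h1, dx.map_base x, withDensity_apply _ Metric.isClosed_closedBall.measurableSet,
      Measure.restrict_restrict Metric.isClosed_closedBall.measurableSet,
      Set.inter_eq_left.2 hsub]
    obtain ⟨C, hC⟩ := hK.bddAbove_image ((dx.smooth_baseDensity x).continuousOn.mono hsub)
    calc ∫⁻ y in Metric.closedBall (e x) R, ENNReal.ofReal (dx.baseDensity x y)
        ≤ ∫⁻ y in Metric.closedBall (e x) R, ENNReal.ofReal C :=
          setLIntegral_mono measurable_const fun y hy =>
            ENNReal.ofReal_le_ofReal (hC ⟨y, hy, rfl⟩)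
      _ = ENNReal.ofReal C * volume (Metric.closedBall (e x) R) := setLIntegral_const _ _
      _ < ⊤ := ENNReal.mul_lt_top ENNReal.ofReal_lt_top hK.measure_lt_top

omit [BorelSpace U] in
theorem continuous_factor (dx : VolumeForm n U) : Continuous dx.factor.1 :=
  ContMDiff.continuous (n := ∞) (I := 𝓡 (2 * n)) (I' := 𝓘(ℝ, ℂ)) dx.factor.2

theorem integrable_mul_factor (dx : VolumeForm n U) {F : U → ℂ} (hF : Continuous F)
    (hs : HasCompactSupport F) : Integrable (fun x => F x * dx.factor.1 x) dx.base := by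
  have := dx.isLocallyFiniteMeasure_base
  exact (hF.mul dx.continuous_factor).integrable_of_hasCompactSupport hs.mul_right

theorem integral_add (dx : VolumeForm n U) {F G : U → ℂ} (hF : Continuous F)
    (hs : HasCompactSupport F) (hG : Continuous G) (hs' : HasCompactSupport G) :
    dx.integral (fun x => F x + G x) = dx.integral F + dx.integral G := by
  simp only [VolumeForm.integral, add_mul]
  exact MeasureTheory.integral_add (dx.integrable_mul_factor hF hs)
    (dx.integrable_mul_factor hG hs')

omit [BorelSpace U] in
theorem integral_const_mul (dx : VolumeForm n U) (c : ℂ) (F : U → ℂ) :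
    dx.integral (fun x => c * F x) = c * dx.integral F := by
  simp only [VolumeForm.integral, mul_assoc]
  exact MeasureTheory.integral_const_mul _ _

theorem integral_sum (dx : VolumeForm n U) {ι : Type*} (s : Finset ι) {F : ι → U → ℂ}
    (hF : ∀ i ∈ s, Continuous (F i)) (hs : ∀ i ∈ s, HasCompactSupport (F i)) :
    dx.integral (fun x => ∑ i ∈ s, F i x) = ∑ i ∈ s, dx.integral (F i) := by
  simp only [VolumeForm.integral, Finset.sum_mul]
  exact MeasureTheory.integral_finsetSum _ fun i hi =>
    dx.integrable_mul_factor (hF i hi) (hs i hi)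

/-- An integral over a fixed compact set is bounded by the supremum of the integrand. -/
theorem exists_norm_integral_le [T2Space U] (dx : VolumeForm n U) {S : Set U} (hS : IsCompact S) :
    ∃ C : ℝ, 0 ≤ C ∧ ∀ (F : U → ℂ) (B : ℝ), (∀ x ∉ S, F x = 0) → (∀ x ∈ S, ‖F x‖ ≤ B) →
      ‖dx.integral F‖ ≤ C * B := by
  have := dx.isLocallyFiniteMeasure_base
  obtain ⟨A, hA⟩ := hS.exists_bound_of_continuousOn dx.continuous_factor.continuousOn
  refine ⟨max A 0 * dx.base.real S, by positivity, fun F B h0 hB => ?_⟩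
  have h1 : dx.integral F = ∫ x in S, F x * dx.factor.1 x ∂dx.base :=
    (setIntegral_eq_integral_of_forall_compl_eq_zero fun x hx => by rw [h0 x hx, zero_mul]).symm
  rw [h1]
  have h2 : ∀ x ∈ S, ‖F x * dx.factor.1 x‖ ≤ B * max A 0 := fun x hx => by
    rw [norm_mul]
    exact mul_le_mul (hB x hx) ((hA x hx).trans (le_max_left _ _)) (norm_nonneg _)
      ((norm_nonneg _).trans (hB x hx))
  refine (norm_setIntegral_le_of_norm_le_const hS.measure_lt_top h2).trans_eq ?_
  ring

/-- The density of `f dx` in the chart at `p`, extended by zero. -/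
noncomputable def pushDensity (dx : VolumeForm n U) (p : U) (f : SmoothFn n U) : Coord n → ℂ :=
  (chartAt (Coord n) p).target.indicator (dx.coeff f p)

omit [BorelSpace U] in
theorem pushDensity_of_mem (dx : VolumeForm n U) {p : U} (f : SmoothFn n U) {y : Coord n}
    (hy : y ∈ (chartAt (Coord n) p).target) : dx.pushDensity p f y = dx.coeff f p y :=
  Set.indicator_of_mem hy _

/-- Change of variables with all localization put on `f`, so that `g` may be the exponential, which
has no support condition. -/
theorem integral_mul_eq (dx : VolumeForm n U) (p : U) {f : SmoothFn n U} {g : U → ℂ}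
    (hg : Continuous g) (hf : tsupport f.1 ⊆ (chartAt (Coord n) p).source) :
    dx.integral (fun x => g x * f.1 x) =
      ∫ y, g ((chartAt (Coord n) p).symm y) * dx.pushDensity p f y := by
  have hfc : Continuous f.1 :=
    ContMDiff.continuous (n := ∞) (I := 𝓡 (2 * n)) (I' := 𝓘(ℝ, ℂ)) f.2
  have h0 : ∀ x ∉ (chartAt (Coord n) p).source, f.1 x = 0 := fun x hx =>
    image_eq_zero_of_notMem_tsupport fun h => hx (hf h)
  rw [VolumeForm.integral, dx.integral_base_eq p (F := fun x => g x * f.1 x * dx.factor.1 x)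
    ((hg.mul hfc).mul dx.continuous_factor) fun x hx => by rw [h0 x hx]; ring]
  rw [← integral_indicator (chartAt (Coord n) p).open_target.measurableSet]
  refine integral_congr_ae (ae_of_all _ fun y => ?_)
  by_cases hy : y ∈ (chartAt (Coord n) p).target
  · simp only [pushDensity, Set.indicator_of_mem hy, VolumeForm.coeff]
    ring
  · simp only [pushDensity, Set.indicator_of_notMem hy, mul_zero]

omit [BorelSpace U] in
theorem coeff_mul (dx : VolumeForm n U) (f g : SmoothFn n U) (p : U) (y : Coord n) :
    dx.coeff (f * g) p y = chartRep p f y * dx.coeff g p y := by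
  show (f.1 _ * g.1 _) * _ * _ = f.1 _ * (g.1 _ * _ * _)
  ring

omit [BorelSpace U] in
theorem tsupport_pushDensity_subset [T2Space U] (dx : VolumeForm n U) {p : U}
    {f : SmoothFn n U} (hc : HasCompactSupport f.1)
    (hf : tsupport f.1 ⊆ (chartAt (Coord n) p).source) :
    tsupport (dx.pushDensity p f) ⊆ chartAt (Coord n) p '' tsupport f.1 := by
  have hK : IsCompact (chartAt (Coord n) p '' tsupport f.1) :=
    IsCompact.image_of_continuousOn hc ((chartAt (Coord n) p).continuousOn.mono hf)
  refine closure_minimal (fun y hy => ?_) hK.isClosed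
  by_cases ht : y ∈ (chartAt (Coord n) p).target
  · rw [Function.mem_support, dx.pushDensity_of_mem f ht, VolumeForm.coeff] at hy
    refine ⟨(chartAt (Coord n) p).symm y, by_contra fun h => hy ?_,
      (chartAt (Coord n) p).right_inv ht⟩
    rw [image_eq_zero_of_notMem_tsupport h]
    ring
  · exact absurd (Set.indicator_of_notMem ht _) hy

omit [BorelSpace U] in
theorem hasCompactSupport_pushDensity [T2Space U] (dx : VolumeForm n U) {p : U}
    {f : SmoothFn n U} (hc : HasCompactSupport f.1)
    (hf : tsupport f.1 ⊆ (chartAt (Coord n) p).source) :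
    HasCompactSupport (dx.pushDensity p f) :=
  (IsCompact.image_of_continuousOn hc ((chartAt (Coord n) p).continuousOn.mono hf)).of_isClosed_subset
    (isClosed_tsupport _) (dx.tsupport_pushDensity_subset hc hf)

omit [BorelSpace U] in
theorem tsupport_pushDensity_subset_target [T2Space U] (dx : VolumeForm n U) {p : U}
    {f : SmoothFn n U} (hc : HasCompactSupport f.1)
    (hf : tsupport f.1 ⊆ (chartAt (Coord n) p).source) :
    tsupport (dx.pushDensity p f) ⊆ (chartAt (Coord n) p).target := by
  refine (dx.tsupport_pushDensity_subset hc hf).trans ?_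
  rintro _ ⟨x, hx, rfl⟩
  exact (chartAt (Coord n) p).map_source (hf hx)

omit [BorelSpace U] in
theorem contDiffOn_coeff [IsManifold (𝓡 (2 * n)) ∞ U] (dx : VolumeForm n U)
    (f : SmoothFn n U) (p : U) :
    ContDiffOn ℝ ∞ (dx.coeff f p) (chartAt (Coord n) p).target := by
  have h := Complex.ofRealCLM.contDiff.comp_contDiffOn (dx.smooth_baseDensity p)
  exact ((contDiffOn_chartRep p f).mul (contDiffOn_chartRep p dx.factor)).mul h

omit [BorelSpace U] in
theorem contDiff_pushDensity [T2Space U] [IsManifold (𝓡 (2 * n)) ∞ U] (dx : VolumeForm n U)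
    {p : U} {f : SmoothFn n U} (hc : HasCompactSupport f.1)
    (hf : tsupport f.1 ⊆ (chartAt (Coord n) p).source) :
    ContDiff ℝ ∞ (dx.pushDensity p f) :=
  contDiff_of_tsupport_subset (chartAt (Coord n) p).open_target
    ((dx.contDiffOn_coeff f p).congr fun _ hy => dx.pushDensity_of_mem f hy)
    (dx.tsupport_pushDensity_subset_target hc hf)

end VolumeForm

end ChartIntegral

/-! ### Nonstationary phase on the manifold. -/

section Nonstationary

variable {n : ℕ} {U : Type*} [TopologicalSpace U] [ChartedSpace (Coord n) U]

theorem continuous_smoothFn (f : SmoothFn n U) : Continuous f.1 :=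
  ContMDiff.continuous (n := ∞) (I := 𝓡 (2 * n)) (I' := 𝓘(ℝ, ℂ)) f.2

theorem continuous_exp_mul_smoothFn (φ : SmoothFn n U) (m : ℝ) :
    Continuous fun x => Complex.exp ((m : ℂ) * φ.1 x) :=
  Complex.continuous_exp.comp (continuous_const.mul (continuous_smoothFn φ))

/-- The integral `∫_U e^{mφ} f dx`. -/
noncomputable def VolumeForm.expIntegral [MeasurableSpace U] (dx : VolumeForm n U)
    (φ f : SmoothFn n U) (m : ℝ) : ℂ :=
  dx.integral fun x => Complex.exp ((m : ℂ) * φ.1 x) * f.1 x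

variable [T2Space U] [SecondCountableTopology U] [IsManifold (𝓡 (2 * n)) ∞ U]

/-- A decomposition of a compactly supported function into pieces supported in charts. -/
theorem exists_sum_eq_of_hasCompactSupport {f : SmoothFn n U} (hf : HasCompactSupport f.1) :
    ∃ (t : Finset U) (F : U → SmoothFn n U), (∀ x, f.1 x = ∑ p ∈ t, (F p).1 x) ∧
      ∀ p ∈ t, tsupport (F p).1 ⊆ tsupport f.1 ∧
        tsupport (F p).1 ⊆ (chartAt (Coord n) p).source := by
  have := ChartedSpace.locallyCompactSpace (Coord n) U
  obtain ⟨w, hw⟩ := SmoothPartitionOfUnity.exists_isSubordinate (𝓡 (2 * n))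
    (isClosed_tsupport f.1) (fun p : U => (chartAt (Coord n) p).source)
    (fun p => (chartAt (Coord n) p).open_source)
    (fun x _ => Set.mem_iUnion.2 ⟨x, mem_chart_source _ x⟩)
  have hfin := w.locallyFinite.finite_nonempty_inter_compact hf
  let F : U → SmoothFn n U := fun p => ⟨fun x => ((w p x : ℝ) : ℂ) * f.1 x, by
    have h1 : ContMDiff (𝓡 (2 * n)) 𝓘(ℝ, ℂ) ∞ fun x => ((w p x : ℝ) : ℂ) :=
      Complex.ofRealCLM.contDiff.contMDiff.comp (w p).contMDiff
    exact (smoothFunctions n U).mul_mem (x := fun x => ((w p x : ℝ) : ℂ)) h1 f.2⟩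
  refine ⟨hfin.toFinset, F, fun x => ?_, fun p _ => ⟨?_, ?_⟩⟩
  · by_cases hx : x ∈ tsupport f.1
    · have h1 : ∑ p ∈ hfin.toFinset, w p x = 1 := by
        rw [← w.sum_eq_one hx]
        refine (finsum_eq_sum_of_support_subset _ fun p hp => ?_).symm
        rw [Set.Finite.coe_toFinset]
        exact ⟨x, hp, hx⟩
      have h2 : ∑ p ∈ hfin.toFinset, ((w p x : ℝ) : ℂ) = 1 := by exact_mod_cast h1
      show f.1 x = ∑ p ∈ hfin.toFinset, ((w p x : ℝ) : ℂ) * f.1 x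
      rw [← Finset.sum_mul, h2, one_mul]
    · have h0 := image_eq_zero_of_notMem_tsupport hx
      show f.1 x = ∑ p ∈ hfin.toFinset, ((w p x : ℝ) : ℂ) * f.1 x
      simp [h0]
  · exact closure_mono fun x hx => right_ne_zero_of_mul hx
  · refine Set.Subset.trans (closure_mono fun x hx => ?_) (hw p)
    have := left_ne_zero_of_mul (a := ((w p x : ℝ) : ℂ)) hx
    exact fun h => this (by simp [h])

/-- A partition of unity reduces to pieces supported in charts. In each chart the critical point is
removed from the target, which leaves an open set containing the support and free of critical
points. -/
theorem VolumeForm.isBigO_expIntegral_of_notMem [MeasurableSpace U] [BorelSpace U]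
    (dx : VolumeForm n U) {φ : SmoothFn n U} {x₀ : U} (hre : ∀ x, (φ.1 x).re ≤ 0)
    (hcrit : ∀ x, IsCriticalPoint φ x → x = x₀) {f : SmoothFn n U}
    (hf : HasCompactSupport f.1) (hx₀ : x₀ ∉ tsupport f.1) (N : ℕ) :
    dx.expIntegral φ f =O[Filter.atTop] fun m : ℝ => m⁻¹ ^ N := by
  obtain ⟨t, F, hsum, hF⟩ := exists_sum_eq_of_hasCompactSupport hf
  have hFc : ∀ p ∈ t, HasCompactSupport (F p).1 := fun p hp =>
    IsCompact.of_isClosed_subset hf (isClosed_tsupport _) (hF p hp).1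
  have h1 : dx.expIntegral φ f = fun m => ∑ p ∈ t, dx.expIntegral φ (F p) m := by
    funext m
    have : (fun x => Complex.exp ((m : ℂ) * φ.1 x) * f.1 x) =
        fun x => ∑ p ∈ t, Complex.exp ((m : ℂ) * φ.1 x) * (F p).1 x := by
      funext x
      rw [hsum x, Finset.mul_sum]
    rw [VolumeForm.expIntegral, this]
    exact dx.integral_sum t
      (fun p _ => (continuous_exp_mul_smoothFn φ m).mul (continuous_smoothFn _))
      fun p hp => (hFc p hp).mul_left
  rw [h1]
  refine Asymptotics.IsBigO.fun_sum fun p hp => ?_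
  set e := chartAt (Coord n) p with he
  have h2 : dx.expIntegral φ (F p) =
      fun m : ℝ => ∫ y, Complex.exp (m * chartRep p φ y) * dx.pushDensity p (F p) y := by
    funext m
    exact dx.integral_mul_eq p (continuous_exp_mul_smoothFn φ m) (hF p hp).2
  rw [h2]
  have hO : IsOpen (e.target ∩ e.symm ⁻¹' {x₀}ᶜ) :=
    e.isOpen_inter_preimage_symm isOpen_compl_singleton
  refine isBigO_integral_of_fderiv_ne_zero hO
    ((contDiffOn_chartRep p φ).mono Set.inter_subset_left) (fun y _ => hre _)
    (fun y hy h => hy.2 (hcrit _ (isCriticalPoint_of_fderiv_chartRep hy.1 h))) N _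
    (dx.contDiff_pushDensity (hFc p hp) (hF p hp).2)
    (dx.hasCompactSupport_pushDensity (hFc p hp) (hF p hp).2) ?_
  refine (dx.tsupport_pushDensity_subset (hFc p hp) (hF p hp).2).trans ?_
  rintro _ ⟨x, hx, rfl⟩
  refine ⟨e.map_source ((hF p hp).2 hx), fun h => hx₀ ?_⟩
  rw [Set.mem_singleton_iff, e.left_inv ((hF p hp).2 hx)] at h
  rw [← h]
  exact (hF p hp).1 hx

end Nonstationary

/-! ### Replacing the symbol by its expansion under the integral. -/

section Symbol

variable {n : ℕ} {U : Type*} [TopologicalSpace U] [ChartedSpace (Coord n) U]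

theorem norm_mixedDeriv_zero_zero (a : U → ℝ → ℂ) (p : U) (y : Coord n) (m : ℝ) :
    ‖mixedDeriv a p 0 0 y m‖ = ‖a ((chartAt (Coord n) p).symm y) m‖ := by
  rw [mixedDeriv, iteratedDeriv_zero, norm_iteratedFDeriv_zero]

/-- Compactness patches the chartwise estimates together. Only the estimate without derivatives (`j
= l = 0`) is needed. -/
theorem HasSymbolExpansion.exists_bound {ρ : U → ℝ → ℂ} {s : ℕ → SmoothFn n U}
    (h : HasSymbolExpansion ρ s) {S : Set U} (hS : IsCompact S) (N : ℕ) :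
    ∃ C : ℝ, ∀ x ∈ S, ∀ m : ℝ, 1 ≤ m →
      ‖ρ x m - ∑ r ∈ Finset.range N, (m : ℂ)⁻¹ ^ r * (s r).1 x‖ ≤ C * m⁻¹ ^ N := by
  refine hS.induction_on (p := fun S => ∃ C : ℝ, ∀ x ∈ S, ∀ m : ℝ, 1 ≤ m →
      ‖ρ x m - ∑ r ∈ Finset.range N, (m : ℂ)⁻¹ ^ r * (s r).1 x‖ ≤ C * m⁻¹ ^ N) ?_ ?_ ?_ ?_
  · exact ⟨0, fun x hx => absurd hx (Set.notMem_empty x)⟩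
  · rintro S T hST ⟨C, hC⟩
    exact ⟨C, fun x hx => hC x (hST hx)⟩
  · rintro S T ⟨C, hC⟩ ⟨D, hD⟩
    refine ⟨max C D, fun x hx m hm => ?_⟩
    have hm' : 0 ≤ m⁻¹ ^ N := by positivity
    rcases hx with hx | hx
    · exact (hC x hx m hm).trans (mul_le_mul_of_nonneg_right (le_max_left _ _) hm')
    · exact (hD x hx m hm).trans (mul_le_mul_of_nonneg_right (le_max_right _ _) hm')
  · intro x _
    set e := chartAt (Coord n) x with he
    have hx : x ∈ e.source := mem_chart_source _ x
    obtain ⟨R, hR, hsub⟩ := Metric.nhds_basis_closedBall.mem_iff.1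
      (e.open_target.mem_nhds (e.map_source hx))
    obtain ⟨C, hC⟩ := h N x _ (isCompact_closedBall _ _) hsub 0 0
    refine ⟨e.source ∩ e ⁻¹' Metric.closedBall (e x) R, mem_nhdsWithin_of_mem_nhds
      (Filter.inter_mem (e.open_source.mem_nhds hx)
        ((e.continuousAt hx) (Metric.closedBall_mem_nhds _ hR))), C, fun z hz m hm => ?_⟩
    have h1 := hC (e z) hz.2 m hm
    rw [norm_mixedDeriv_zero_zero, e.left_inv hz.1] at h1
    simpa [zpow_neg, inv_pow] using h1

theorem continuous_of_isSymbol {d : ℤ} {ρ : U → ℝ → ℂ} (hρ : IsSymbol n d ρ) (m : ℝ) :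
    Continuous fun x => ρ x m :=
  hρ.1.continuous.comp (Continuous.prodMk continuous_id continuous_const)

/-- The remainder of the symbol is `O(m^(-N))` uniformly on the support of `f`, and the exponential
is bounded by one. -/
theorem isBigO_oscillatoryIntegral_sub [T2Space U] [MeasurableSpace U] [BorelSpace U]
    (dx : VolumeForm n U) {φ : SmoothFn n U} (hre : ∀ x, (φ.1 x).re ≤ 0) {ρ : U → ℝ → ℂ}
    {s : ℕ → SmoothFn n U} {d : ℤ} (hρ : IsSymbol n d ρ) (h : HasSymbolExpansion ρ s)
    {f : SmoothFn n U} (hf : HasCompactSupport f.1) (N : ℕ) :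
    (fun m : ℝ => oscillatoryIntegral dx φ ρ f m -
      ∑ r ∈ Finset.range N, (m : ℂ)⁻¹ ^ r * dx.expIntegral φ (f * s r) m)
      =O[Filter.atTop] fun m : ℝ => m⁻¹ ^ N := by
  obtain ⟨C, hC⟩ := h.exists_bound hf N
  obtain ⟨D, hD0, hD⟩ := dx.exists_norm_integral_le hf
  obtain ⟨A, hA⟩ := IsCompact.exists_bound_of_continuousOn hf (continuous_smoothFn f).continuousOn
  have hcont : ∀ (m : ℝ) (g : U → ℂ), Continuous g →
      Continuous fun x => Complex.exp ((m : ℂ) * φ.1 x) * f.1 x * g x := fun m g hg =>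
    ((continuous_exp_mul_smoothFn φ m).mul (continuous_smoothFn f)).mul hg
  have hsupp : ∀ (m : ℝ) (g : U → ℂ),
      HasCompactSupport fun x => Complex.exp ((m : ℂ) * φ.1 x) * f.1 x * g x := fun m g =>
    (HasCompactSupport.mul_left hf).mul_right
  refine Asymptotics.IsBigO.of_bound (D * (A * C)) ?_
  filter_upwards [Filter.eventually_ge_atTop (1 : ℝ)] with m hm
  have hm0 : 0 ≤ m⁻¹ ^ N := by positivity
  have h1 : oscillatoryIntegral dx φ ρ f m =
      dx.integral (fun x => Complex.exp ((m : ℂ) * φ.1 x) * f.1 x *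
        (ρ x m - ∑ r ∈ Finset.range N, (m : ℂ)⁻¹ ^ r * (s r).1 x)) +
      ∑ r ∈ Finset.range N, (m : ℂ)⁻¹ ^ r * dx.expIntegral φ (f * s r) m := by
    have h2 : ∑ r ∈ Finset.range N, (m : ℂ)⁻¹ ^ r * dx.expIntegral φ (f * s r) m =
        dx.integral (fun x => Complex.exp ((m : ℂ) * φ.1 x) * f.1 x *
          ∑ r ∈ Finset.range N, (m : ℂ)⁻¹ ^ r * (s r).1 x) := by
      have h3 : (fun x => Complex.exp ((m : ℂ) * φ.1 x) * f.1 x *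
          ∑ r ∈ Finset.range N, (m : ℂ)⁻¹ ^ r * (s r).1 x) = fun x =>
          ∑ r ∈ Finset.range N, (m : ℂ)⁻¹ ^ r *
            (Complex.exp ((m : ℂ) * φ.1 x) * f.1 x * (s r).1 x) := by
        funext x
        rw [Finset.mul_sum]
        exact Finset.sum_congr rfl fun r _ => by ring
      rw [h3, dx.integral_sum _ (F := fun r x => (m : ℂ)⁻¹ ^ r *
          (Complex.exp ((m : ℂ) * φ.1 x) * f.1 x * (s r).1 x))
        (fun r _ => continuous_const.mul (hcont m _ (continuous_smoothFn (s r))))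
        fun r _ => (hsupp m (s r).1).mul_left]
      refine Finset.sum_congr rfl fun r _ => ?_
      rw [dx.integral_const_mul, VolumeForm.expIntegral]
      congr 2
      funext x
      show _ * (f.1 x * (s r).1 x) = _
      ring
    have hsumc : Continuous fun x => ∑ r ∈ Finset.range N, (m : ℂ)⁻¹ ^ r * (s r).1 x :=
      continuous_finsetSum _ fun r _ => continuous_const.mul (continuous_smoothFn (s r))
    rw [h2, ← dx.integral_add (F := fun x => Complex.exp ((m : ℂ) * φ.1 x) * f.1 x *
        (ρ x m - ∑ r ∈ Finset.range N, (m : ℂ)⁻¹ ^ r * (s r).1 x)) (hcont m _ ((continuous_of_isSymbol hρ m).sub hsumc)) (hsupp m _)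
      (hcont m _ hsumc) (hsupp m _), oscillatoryIntegral]
    congr 1
    funext x
    ring
  rw [h1, add_sub_cancel_right, Real.norm_of_nonneg hm0]
  refine (hD _ (A * (C * m⁻¹ ^ N)) (fun x hx => ?_) fun x hx => ?_).trans_eq (by ring)
  · rw [image_eq_zero_of_notMem_tsupport hx]
    ring
  · rw [norm_mul, norm_mul]
    have hA0 : 0 ≤ A := (norm_nonneg _).trans (hA x hx)
    refine mul_le_mul ?_ (hC x hx m hm) (norm_nonneg _) hA0
    calc _ ≤ 1 * ‖f.1 x‖ := mul_le_mul_of_nonneg_right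
          (PhaseFamily.norm_exp_mul_le_one (by linarith) (hre x)) (norm_nonneg _)
      _ ≤ A := by rw [one_mul]; exact hA x hx

end Symbol

/-! ### Distributions supported at a point. -/

section PointDistribution

variable {n : ℕ} {U : Type*} [TopologicalSpace U] [ChartedSpace (Coord n) U]

/-- A Leibniz bound for the product with a fixed smooth function. -/
theorem exists_norm_iteratedFDeriv_mul_le {O L : Set (Coord n)} (hO : IsOpen O)
    (hL : IsCompact L) (hLO : L ⊆ O) {g : Coord n → ℂ} (hg : ContDiffOn ℝ ∞ g O) (N : ℕ) :
    ∃ D : ℝ, 0 ≤ D ∧ ∀ (u : Coord n → ℂ) (B : ℝ), ContDiffOn ℝ ∞ u O →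
      (∀ j ≤ N, ∀ y ∈ L, ‖iteratedFDeriv ℝ j u y‖ ≤ B) →
      ∀ j ≤ N, ∀ y ∈ L, ‖iteratedFDeriv ℝ j (fun z => g z * u z) y‖ ≤ D * B := by
  have hA : ∀ i : ℕ, ∃ A : ℝ, ∀ y ∈ L, ‖iteratedFDeriv ℝ i g y‖ ≤ A := fun i => by
    have h1 : ContinuousOn (iteratedFDerivWithin ℝ i g O) O :=
      hg.continuousOn_iteratedFDerivWithin (mod_cast le_top) hO.uniqueDiffOn
    obtain ⟨A, hA⟩ := hL.exists_bound_of_continuousOn (h1.mono hLO)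
    exact ⟨A, fun y hy => by
      rw [← iteratedFDerivWithin_of_isOpen i hO (hLO hy)]
      exact hA y hy⟩
  choose A hA using hA
  refine ⟨∑ j ∈ Finset.range (N + 1), ∑ i ∈ Finset.range (j + 1), (j.choose i : ℝ) * |A i|,
    by positivity, fun u B hu hB j hj y hy => ?_⟩
  have hB0 : 0 ≤ B := (norm_nonneg _).trans (hB 0 (Nat.zero_le _) y hy)
  have h1 := norm_iteratedFDerivWithin_mul_le (𝕜 := ℝ) (N := ∞) hg hu hO.uniqueDiffOn (hLO hy)
    (n := j) (mod_cast le_top)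
  simp only [iteratedFDerivWithin_of_isOpen _ hO (hLO hy)] at h1
  calc _ ≤ _ := h1
    _ ≤ ∑ i ∈ Finset.range (j + 1), (j.choose i : ℝ) * |A i| * B := by
        refine Finset.sum_le_sum fun i hi => ?_
        have hi' : j - i ≤ N := (Nat.sub_le _ _).trans hj
        gcongr
        · exact (hA i y hy).trans (le_abs_self _)
        · exact hB _ hi' y hy
    _ = (∑ i ∈ Finset.range (j + 1), (j.choose i : ℝ) * |A i|) * B := by
        rw [Finset.sum_mul]
    _ ≤ _ := by
        refine mul_le_mul_of_nonneg_right ?_ hB0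
        exact Finset.single_le_sum
          (f := fun j => ∑ i ∈ Finset.range (j + 1), (j.choose i : ℝ) * |A i|)
          (fun _ _ => by positivity) (Finset.mem_range.2 (Nat.lt_succ_of_le hj))

namespace IsDistributionSupportedAt

theorem zero (x : U) : IsDistributionSupportedAt (n := n) x (0 : SmoothFn n U →ₗ[ℂ] ℂ) :=
  ⟨fun _ _ => rfl, ∅, 0, 0, isCompact_empty, Set.empty_subset _, fun f B _ => by simp⟩

theorem add {x : U} {T S : SmoothFn n U →ₗ[ℂ] ℂ} (hT : IsDistributionSupportedAt x T)
    (hS : IsDistributionSupportedAt x S) : IsDistributionSupportedAt x (T + S) := by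
  obtain ⟨hT1, L, N, C, hL, hLt, hT2⟩ := hT
  obtain ⟨hS1, L', N', C', hL', hLt', hS2⟩ := hS
  refine ⟨fun f hf => by rw [LinearMap.add_apply, hT1 f hf, hS1 f hf, add_zero], L ∪ L',
    max N N', C + C', hL.union hL', Set.union_subset hLt hLt', fun f B hB => ?_⟩
  rw [LinearMap.add_apply, add_mul]
  exact (norm_add_le _ _).trans (add_le_add
    (hT2 f B fun j hj y hy => hB j (hj.trans (le_max_left _ _)) y (Or.inl hy))
    (hS2 f B fun j hj y hy => hB j (hj.trans (le_max_right _ _)) y (Or.inr hy)))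

theorem sum {x : U} {ι : Type*} (s : Finset ι) {T : ι → SmoothFn n U →ₗ[ℂ] ℂ}
    (hT : ∀ i ∈ s, IsDistributionSupportedAt x (T i)) :
    IsDistributionSupportedAt x (∑ i ∈ s, T i) :=
  Finset.sum_induction T _ (fun _ _ => add) (zero x) hT

theorem smul {x : U} {T : SmoothFn n U →ₗ[ℂ] ℂ} (hT : IsDistributionSupportedAt x T) (c : ℂ) :
    IsDistributionSupportedAt x (c • T) := by
  obtain ⟨hT1, L, N, C, hL, hLt, hT2⟩ := hT
  refine ⟨fun f hf => by rw [LinearMap.smul_apply, hT1 f hf, smul_zero], L, N, ‖c‖ * C, hL, hLt,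
    fun f B hB => ?_⟩
  rw [LinearMap.smul_apply, norm_smul, mul_assoc]
  exact mul_le_mul_of_nonneg_left (hT2 f B hB) (norm_nonneg _)

variable [IsManifold (𝓡 (2 * n)) ∞ U]

theorem comp_mul {x : U} {T : SmoothFn n U →ₗ[ℂ] ℂ} (hT : IsDistributionSupportedAt x T)
    (a : SmoothFn n U) : IsDistributionSupportedAt x (T ∘ₗ LinearMap.mulLeft ℂ a) := by
  obtain ⟨hT1, L, N, C, hL, hLt, hT2⟩ := hT
  obtain ⟨D, hD0, hD⟩ := exists_norm_iteratedFDeriv_mul_le (chartAt (Coord n) x).open_target hL hLt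
    (contDiffOn_chartRep x a) N
  refine ⟨fun f hf => hT1 _ ?_, L, N, C * D, hL, hLt, fun f B hB => ?_⟩
  · filter_upwards [hf] with y hy
    show a.1 y * f.1 y = 0
    rw [hy, mul_zero]
  · rw [mul_assoc]
    exact hT2 (a * f) (D * B) (hD (chartRep x f) B (contDiffOn_chartRep x f) hB)

end IsDistributionSupportedAt

end PointDistribution

/-! ### The expansion of `∫ e^{mφ} f dx` on the manifold. -/

section LocalExpansion

variable {n : ℕ} {U : Type*} [TopologicalSpace U] [ChartedSpace (Coord n) U]
  [T2Space U] [SecondCountableTopology U] [IsManifold (𝓡 (2 * n)) ∞ U]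
  [MeasurableSpace U] [BorelSpace U]

omit [SecondCountableTopology U] [T2Space U] [IsManifold (𝓡 (2 * n)) ∞ U] in
theorem VolumeForm.expIntegral_add (dx : VolumeForm n U) (φ : SmoothFn n U) {f g : SmoothFn n U}
    (hf : HasCompactSupport f.1) (hg : HasCompactSupport g.1) (m : ℝ) :
    dx.expIntegral φ (f + g) m = dx.expIntegral φ f m + dx.expIntegral φ g m := by
  rw [VolumeForm.expIntegral, VolumeForm.expIntegral, VolumeForm.expIntegral,
    ← dx.integral_add (F := fun x => Complex.exp ((m : ℂ) * φ.1 x) * f.1 x)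
      (G := fun x => Complex.exp ((m : ℂ) * φ.1 x) * g.1 x)
      ((continuous_exp_mul_smoothFn φ m).mul (continuous_smoothFn f)) hf.mul_left
      ((continuous_exp_mul_smoothFn φ m).mul (continuous_smoothFn g)) hg.mul_left]
  congr 1
  funext x
  show _ * (f.1 x + g.1 x) = _
  ring

omit [T2Space U] [SecondCountableTopology U] [IsManifold (𝓡 (2 * n)) ∞ U] [BorelSpace U] in
theorem VolumeForm.expIntegral_smul (dx : VolumeForm n U) (φ : SmoothFn n U) (c : ℂ)
    (f : SmoothFn n U) (m : ℝ) :
    dx.expIntegral φ (c • f) m = c * dx.expIntegral φ f m := by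
  rw [VolumeForm.expIntegral, VolumeForm.expIntegral, ← dx.integral_const_mul]
  congr 1
  funext x
  show _ * (c * f.1 x) = _
  ring

theorem isBigO_pow_mul_of_forall {v : ℝ → ℂ}
    (h : ∀ N : ℕ, v =O[Filter.atTop] fun m : ℝ => m⁻¹ ^ N) (k N : ℕ) :
    (fun m : ℝ => (m : ℂ) ^ k * v m) =O[Filter.atTop] fun m : ℝ => m⁻¹ ^ N := by
  obtain ⟨C, hC⟩ := (h (N + k)).bound
  refine Asymptotics.IsBigO.of_bound C ?_
  filter_upwards [hC, Filter.eventually_gt_atTop (0 : ℝ)] with m hm hm0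
  rw [norm_mul, norm_pow, Complex.norm_real, Real.norm_of_nonneg hm0.le]
  calc m ^ k * ‖v m‖ ≤ m ^ k * (C * ‖m⁻¹ ^ (N + k)‖) := by gcongr
    _ = C * ‖m⁻¹ ^ N‖ := by
        have h1 : m ^ k * m⁻¹ ^ k = 1 := by rw [← mul_pow, mul_inv_cancel₀ hm0.ne', one_pow]
        rw [Real.norm_of_nonneg (by positivity), Real.norm_of_nonneg (by positivity), pow_add]
        linear_combination C * m⁻¹ ^ N * h1

/-- The asymptotic expansion of `∫_U e^{mφ} f dx` as a formal distribution at the critical point,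
and division by the differential of the phase near that point. -/
theorem exists_expIntegral_expansion (dx : VolumeForm n U) {φ : SmoothFn n U} {x₀ : U}
    (hre : ∀ x, (φ.1 x).re ≤ 0) (hcrit : ∀ x, IsCriticalPoint φ x ↔ x = x₀)
    (hdet : (hessian φ x₀).det ≠ 0) (hzero : φ.1 x₀ = 0) :
    (∃ (s : SmoothFn n U →ₗ[ℂ] PowerSeries ℂ) (κ : ℂ), κ ≠ 0 ∧
      (∀ f, HasCompactSupport f.1 →
        PowerAsymp (fun m => (m : ℂ) ^ n * dx.expIntegral φ f m) (s f)) ∧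
      (∀ f, PowerSeries.constantCoeff (s f) = κ * f.1 x₀) ∧
      ∀ r, IsDistributionSupportedAt x₀ (PowerSeries.coeff r ∘ₗ s)) ∧
    ∀ f : SmoothFn n U, f.1 x₀ = 0 → ∃ g : Fin (2 * n) → SmoothFn n U,
      ∀ᶠ y in 𝓝 (chartAt (Coord n) x₀ x₀), chartRep x₀ f y =
        ∑ j, fderiv ℝ (chartRep x₀ φ) y (EuclideanSpace.single j 1) * chartRep x₀ (g j) y := by
  set e := chartAt (Coord n) x₀ with he
  set o : Coord n := e x₀ with ho
  have hx₀ : x₀ ∈ e.source := mem_chart_source _ x₀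
  have hot : o ∈ e.target := e.map_source hx₀
  have hos : e.symm o = x₀ := e.left_inv hx₀
  obtain ⟨R₁, hR₁, hsub₁⟩ := Metric.nhds_basis_closedBall.mem_iff.1 (e.open_target.mem_nhds hot)
  -- The local result needs a phase on all of the coordinate space. Multiplying by a nonnegative
  -- bump function extends `φ` smoothly and keeps its real part nonpositive.
  let χ₁ : ContDiffBump o := ⟨R₁ / 2, R₁, by positivity, by linarith⟩
  have hχ₁s : tsupport χ₁ ⊆ e.target := by rw [χ₁.tsupport_eq]; exact hsub₁
  have hmulbump : ∀ (χ : ContDiffBump o) (u : Coord n → ℂ), tsupport χ ⊆ e.target →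
      ContDiffOn ℝ ∞ u e.target → ContDiff ℝ ∞ fun y => (χ y : ℂ) * u y := by
    intro χ u hχ hu
    refine contDiff_of_tsupport_subset e.open_target
      ((Complex.ofRealCLM.contDiff.comp χ.contDiff).contDiffOn.mul hu)
      ((closure_mono fun y hy => ?_).trans hχ)
    have := left_ne_zero_of_mul (a := ((χ y : ℝ) : ℂ)) hy
    exact fun h => this (by simp [h])
  let φ₁ : Coord n → ℂ := fun y => (χ₁ y : ℂ) * chartRep x₀ φ y
  have hφ₁ : ContDiff ℝ ∞ φ₁ := hmulbump χ₁ _ hχ₁s (contDiffOn_chartRep x₀ φ)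
  have hφ₁eq : ∀ y ∈ Metric.closedBall o (R₁ / 2), φ₁ y = chartRep x₀ φ y := fun y hy => by
    simp only [φ₁, χ₁.one_of_mem_closedBall hy, Complex.ofReal_one, one_mul]
  have hφ₁ev : ∀ y ∈ Metric.ball o (R₁ / 2), φ₁ =ᶠ[𝓝 y] chartRep x₀ φ := fun y hy => by
    filter_upwards [Metric.isOpen_ball.mem_nhds hy] with z hz
    exact hφ₁eq z (Metric.ball_subset_closedBall hz)
  have hob : o ∈ Metric.ball o (R₁ / 2) := Metric.mem_ball_self (by positivity)
  -- The bound `R ≤ R₁ / 4` places the amplitudes inside the ball of radius `R₁ / 2`, where the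
  -- extended phase agrees with the original one. The critical value and the Hessian are those of
  -- `φ`.
  obtain ⟨R, hR, hRR, S, κ, hκ, hS1, hS2, hS3, hS4⟩ := exists_local_expansion hφ₁ (o := o)
    (fun y => by
      simp only [φ₁, chartRep, Complex.re_ofReal_mul]
      exact mul_nonpos_of_nonneg_of_nonpos χ₁.nonneg (hre _))
    (by
      rw [hφ₁eq o (Metric.ball_subset_closedBall hob), chartRep, ← he, hos, hzero])
    (by
      rw [(hφ₁ev o hob).fderiv_eq]
      exact fderiv_chartRep_of_isCriticalPoint hot
        ((hcrit _).2 hos))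
    (by
      have h1 : hessianMatrix φ₁ o = hessian φ x₀ := by
        ext i j
        rw [hessianMatrix, (hφ₁ev o hob).iteratedFDeriv ℝ 2 |>.eq_of_nhds]
        rfl
      rwa [h1])
    (R₀ := R₁ / 4) (by positivity)
  have hRball : ∀ y ∈ Metric.closedBall o R, y ∈ Metric.ball o (R₁ / 2) := fun y hy =>
    Metric.closedBall_subset_ball (by linarith) hy
  have hRt : Metric.closedBall o R ⊆ e.target :=
    (Metric.closedBall_subset_closedBall (by linarith)).trans hsub₁
  let χ : ContDiffBump o := ⟨R / 2, R, by positivity, by linarith⟩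
  have hχs : tsupport χ ⊆ e.target := by rw [χ.tsupport_eq]; exact hRt
  have hχ0 : ∀ y ∉ Metric.closedBall o R, χ y = 0 := fun y hy =>
    χ.zero_of_le_dist (not_le.1 fun h => hy h).le
  have hχc : ContDiff ℝ ∞ fun y => (χ y : ℂ) := Complex.ofRealCLM.contDiff.comp χ.contDiff
  have hχ0' : ∀ y ∉ Metric.closedBall o R, (χ y : ℂ) = 0 := fun y hy => by simp [hχ0 y hy]
  obtain ⟨X, hX⟩ := exists_smoothFn_chartExtend (p := x₀) hχc (isCompact_closedBall o R) hRt hχ0'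
  have hXsupp : tsupport X.1 ⊆ e.source := by
    rw [hX]
    exact (tsupport_chartExtend_subset (isCompact_closedBall o R) hRt hχ0').trans
      (symm_image_subset_source hRt)
  have hXc : HasCompactSupport X.1 := by
    rw [hX]
    exact hasCompactSupport_chartExtend (isCompact_closedBall o R) hRt hχ0'
  have hXy : ∀ y ∈ e.target, chartRep x₀ X y = χ y := fun y hy => by
    rw [chartRep, hX]
    exact chartExtend_symm _ hy
  have hX1 : ∀ᶠ x in 𝓝 x₀, X.1 x = 1 := by
    filter_upwards [e.open_source.mem_nhds hx₀, (e.continuousAt hx₀)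
      (Metric.closedBall_mem_nhds o (show 0 < R / 2 by positivity))] with x hx hxb
    rw [hX, chartExtend_of_mem _ hx, χ.one_of_mem_closedBall hxb, Complex.ofReal_one]
  have hXf : ∀ f : SmoothFn n U, tsupport (X * f).1 ⊆ e.source := fun f =>
    (tsupport_mul_subset_left (f := X.1) (g := f.1)).trans hXsupp
  have hXfc : ∀ f : SmoothFn n U, HasCompactSupport (X * f).1 := fun f => hXc.mul_right
  let u : SmoothFn n U → Coord n → ℂ := fun f => dx.pushDensity x₀ (X * f)
  have husm : ∀ f, ContDiff ℝ ∞ (u f) := fun f => dx.contDiff_pushDensity (hXfc f) (hXf f)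
  have hueq : ∀ f, ∀ y ∈ e.target, u f y = (χ y * dx.coeff 1 x₀ y) * chartRep x₀ f y := by
    intro f y hy
    simp only [u]
    rw [dx.pushDensity_of_mem _ hy, dx.coeff_mul, hXy y hy]
    simp only [VolumeForm.coeff, chartRep, OneMemClass.coe_one, Pi.one_apply]
    ring
  have hu0 : ∀ f, ∀ y ∉ Metric.closedBall o R, u f y = 0 := by
    intro f y hy
    by_cases ht : y ∈ e.target
    · rw [hueq f y ht, hχ0' y hy, zero_mul, zero_mul]
    · exact Set.indicator_of_notMem ht _
  have hint : ∀ f (m : ℝ), ∫ y, Complex.exp (m * φ₁ y) * u f y = dx.expIntegral φ (X * f) m := by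
    intro f m
    rw [VolumeForm.expIntegral,
      dx.integral_mul_eq x₀ (continuous_exp_mul_smoothFn φ m) (hXf f)]
    refine MeasureTheory.integral_congr_ae (MeasureTheory.ae_of_all _ fun y => ?_)
    by_cases hy : y ∈ Metric.closedBall o R
    · simp only [hφ₁eq y (Metric.ball_subset_closedBall (hRball y hy))]
      rfl
    · show _ * u f y = _ * u f y
      rw [hu0 f y hy, mul_zero, mul_zero]
  have hasym : ∀ f, PowerAsymp (fun m => (m : ℂ) ^ n * dx.expIntegral φ (X * f) m) (S (u f)) := by
    intro f
    have := hS1 (u f) (husm f) (hu0 f)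
    simpa only [hint] using this
  -- Linearity is not read off from the construction of `S`; it follows from the linearity of the
  -- integral and the uniqueness of asymptotic expansions.
  let s : SmoothFn n U →ₗ[ℂ] PowerSeries ℂ :=
    { toFun := fun f => S (u f)
      map_add' := fun f g => by
        refine (hasym (f + g)).unique ?_
        have := (hasym f).add (hasym g)
        simp only [mul_add X, dx.expIntegral_add φ (hXfc f) (hXfc g), mul_add ((_ : ℂ) ^ n)]
        exact this
      map_smul' := fun c f => by
        refine (hasym (c • f)).unique ?_
        have := (hasym f).const_mul c
        simp only [mul_smul_comm, dx.expIntegral_smul, mul_left_comm _ c]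
        exact this }
  have hloc : ∀ f : SmoothFn n U, HasCompactSupport f.1 → (∀ᶠ x in 𝓝 x₀, f.1 x = 0) →
      ∀ N : ℕ, (fun m : ℝ => (m : ℂ) ^ n * dx.expIntegral φ f m)
        =O[Filter.atTop] fun m : ℝ => m⁻¹ ^ N := fun f hf h0 N =>
    isBigO_pow_mul_of_forall (dx.isBigO_expIntegral_of_notMem hre (fun x hx => (hcrit x).1 hx) hf
      (notMem_tsupport_iff_eventuallyEq.2 h0)) n N
  -- The leading constant is that of the local expansion times the density of `dx` at the critical
  -- point; the bump function is `1` there.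
  refine ⟨⟨s, χ o * dx.coeff 1 x₀ o * κ, ?_, fun f hf => ?_, fun f => ?_, fun r => ⟨?_, ?_⟩⟩,
    fun f hf => ?_⟩
  · rw [χ.one_of_mem_closedBall (Metric.mem_closedBall_self (by positivity))]
    refine mul_ne_zero (mul_ne_zero (by simp) ?_) hκ
    simp only [VolumeForm.coeff, OneMemClass.coe_one, Pi.one_apply, one_mul]
    exact mul_ne_zero (dx.factor_ne_zero _)
      (Complex.ofReal_ne_zero.2 (dx.baseDensity_pos x₀ o hot).ne')
  -- The part `f - X f` vanishes near the critical point and so contributes nothing to the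
  -- expansion.
  · have hd : HasCompactSupport (f - X * f).1 := HasCompactSupport.sub hf (hXfc f)
    have h0 : ∀ᶠ x in 𝓝 x₀, (f - X * f).1 x = 0 := by
      filter_upwards [hX1] with x hx
      show f.1 x - X.1 x * f.1 x = 0
      rw [hx]
      ring
    refine PowerAsymp.congr (hasym f) fun N => (hloc _ hd h0 N).congr_left fun m => ?_
    have h3 : dx.expIntegral φ f m =
        dx.expIntegral φ (f - X * f) m + dx.expIntegral φ (X * f) m := by
      rw [← dx.expIntegral_add φ hd (hXfc f), sub_add_cancel]
    rw [h3]
    ring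
  · show PowerSeries.constantCoeff (S (u f)) = _
    rw [hS2, hueq f o hot, chartRep, ← he, hos]
    ring
  -- If `f` vanishes near the critical point, the integral of `X f` is negligible, so uniqueness
  -- forces its expansion to be zero.
  · intro f hf
    have h0 : ∀ᶠ x in 𝓝 x₀, (X * f).1 x = 0 := by
      filter_upwards [hf] with x hx
      show X.1 x * f.1 x = 0
      rw [hx, mul_zero]
    have := (hasym f).unique (PowerAsymp.of_isBigO (hloc _ (hXfc f) h0))
    show PowerSeries.coeff r (S (u f)) = 0
    rw [this, map_zero]
  · obtain ⟨C, hC0, hC⟩ := hS3 r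
    obtain ⟨D, hD0, hD⟩ := exists_norm_iteratedFDeriv_mul_le e.open_target
      (isCompact_closedBall o R) hRt (hχc.contDiffOn.mul (dx.contDiffOn_coeff 1 x₀)) (2 * r)
    refine ⟨Metric.closedBall o R, 2 * r, C * D, isCompact_closedBall o R, hRt, fun f B hB => ?_⟩
    have hB0 : 0 ≤ B := (norm_nonneg _).trans
      (hB 0 (Nat.zero_le _) o (Metric.mem_closedBall_self hR.le))
    rw [mul_assoc]
    refine hC (u f) (husm f) (D * B) (by positivity) fun j hj y hy => ?_
    have hev : u f =ᶠ[𝓝 y] fun z => (χ z * dx.coeff 1 x₀ z) * chartRep x₀ f z := by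
      filter_upwards [e.open_target.mem_nhds (hRt hy)] with z hz
      exact hueq f z hz
    rw [(hev.iteratedFDeriv ℝ j).eq_of_nhds]
    exact hD (chartRep x₀ f) B (contDiffOn_chartRep x₀ f) hB j hj y hy
  · obtain ⟨g, hg, hgeq⟩ := hS4 (fun y => (χ y : ℂ) * chartRep x₀ f y)
      (hmulbump χ _ hχs (contDiffOn_chartRep x₀ f))
      (by rw [chartRep, ← he, hos, hf, mul_zero])
    have hG : ∀ j, ∃ G : SmoothFn n U, G.1 = chartExtend x₀ fun y => (χ y : ℂ) * g j y := fun j =>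
      exists_smoothFn_chartExtend (hχc.mul (hg j)) (isCompact_closedBall o R) hRt
        fun y hy => by rw [hχ0' y hy, zero_mul]
    choose G hG using hG
    refine ⟨G, ?_⟩
    filter_upwards [Metric.ball_mem_nhds o (show 0 < R / 2 by positivity)] with y hy
    have hyR : y ∈ Metric.closedBall o R := Metric.ball_subset_closedBall
      (Metric.ball_subset_ball (by linarith) hy)
    have hχ1 : (χ y : ℂ) = 1 := by
      rw [χ.one_of_mem_closedBall (Metric.ball_subset_closedBall hy), Complex.ofReal_one]
    have h1 := hgeq y hyR
    simp only [hχ1, one_mul] at h1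
    rw [h1]
    refine Finset.sum_congr rfl fun j _ => ?_
    rw [(hφ₁ev y (hRball y hyR)).fderiv_eq]
    congr 1
    rw [chartRep, hG j]
    rw [← he, chartExtend_symm _ (hRt hyR), hχ1, one_mul]

end LocalExpansion

/-! ### Formal algebra of the integration by parts identities. -/

section FormalStokes

open PowerSeries in
/-- For a formal family `s` of functionals and a formal function `ρ = ∑ ν^i ρ_i`, the family
`f ↦ ∑ ν^i s(ρ_i f)`. -/
noncomputable def symbolSeries {V : Type*} [CommRing V] [Algebra ℂ V]
    (s : V →ₗ[ℂ] PowerSeries ℂ) (ρ : ℕ → V) : V →ₗ[ℂ] PowerSeries ℂ where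
  toFun f := PowerSeries.mk fun k =>
    ∑ i ∈ Finset.range (k + 1), coeff (k - i) (s (ρ i * f))
  map_add' f g := by
    ext k
    simp only [coeff_mk, mul_add, map_add, Finset.sum_add_distrib]
  map_smul' c f := by
    ext k
    simp only [coeff_mk, mul_smul_comm, map_smul, RingHom.id_apply, Finset.mul_sum,
      smul_eq_mul]

variable {V : Type*} [CommRing V] [Algebra ℂ V]

theorem coeff_symbolSeries (s : V →ₗ[ℂ] PowerSeries ℂ) (ρ : ℕ → V) (f : V) (k : ℕ) :
    PowerSeries.coeff k (symbolSeries s ρ f) =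
      ∑ i ∈ Finset.range (k + 1), PowerSeries.coeff (k - i) (s (ρ i * f)) :=
  PowerSeries.coeff_mk k fun k =>
    ∑ i ∈ Finset.range (k + 1), PowerSeries.coeff (k - i) (s (ρ i * f))

theorem coeff_symbolSeries_eq_coeff_sum (s : V →ₗ[ℂ] PowerSeries ℂ) (ρ : ℕ → V) (f : V)
    {k N : ℕ} (hk : k < N) : PowerSeries.coeff k (symbolSeries s ρ f) =
      PowerSeries.coeff k (∑ i ∈ Finset.range N, PowerSeries.X ^ i * s (ρ i * f)) := by
  rw [coeff_symbolSeries, map_sum]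
  simp only [PowerSeries.coeff_X_pow_mul']
  rw [← Finset.sum_filter]
  refine Finset.sum_congr ?_ fun _ _ => rfl
  ext i
  simp only [Finset.mem_range, Finset.mem_filter]
  omega

/-- The integration by parts identities for `σ_k = coeff k ∘ s`. -/
structure IsStokesFamily (σ : ℕ → V →ₗ[ℂ] ℂ) (a b : V) (h : ℕ → V) (f : V) : Prop where
  coeff_zero : σ 0 a = 0
  coeff_succ : ∀ k, σ (k + 1) a + σ k b + ∑ i ∈ Finset.range (k + 1), σ (k - i) (h i * f) = 0

/-- The hypotheses are the identities for each coefficient `ρ r` of the symbol. Summing them with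
weights `ν^r` and regrouping the double sum by `r = i + j` gives the identities for the whole
family. -/
theorem isStokesFamily_symbolSeries {s : V →ₗ[ℂ] PowerSeries ℂ} {ρ : ℕ → V} {a b : V}
    {h : ℕ → V} {f : V} (h0 : ∀ r, PowerSeries.coeff 0 (s (ρ r * a)) = 0)
    (h1 : ∀ r k, PowerSeries.coeff (k + 1) (s (ρ r * a)) + PowerSeries.coeff k (s (ρ r * b)) +
      ∑ i ∈ Finset.range (r + 1), PowerSeries.coeff k (s (ρ (r - i) * (h i * f))) = 0) :
    IsStokesFamily (fun k => PowerSeries.coeff k ∘ₗ symbolSeries s ρ) a b h f := by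
  refine ⟨?_, fun k => ?_⟩
  · simp [coeff_symbolSeries, ← PowerSeries.coeff_zero_eq_constantCoeff_apply, h0]
  · simp only [LinearMap.comp_apply, coeff_symbolSeries]
    rw [Finset.sum_range_succ _ (k + 1), Nat.sub_self, h0, add_zero]
    have e1 : ∑ i ∈ Finset.range (k + 1), ∑ j ∈ Finset.range (k - i + 1),
        PowerSeries.coeff (k - i - j) (s (ρ j * (h i * f))) =
        ∑ r ∈ Finset.range (k + 1), ∑ i ∈ Finset.range (r + 1),
          PowerSeries.coeff (k - r) (s (ρ (r - i) * (h i * f))) := by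
      have := Finset.sum_range_diag_flip (k + 1)
        fun i j => PowerSeries.coeff (k - i - j) (s (ρ j * (h i * f)))
      refine Eq.trans (Finset.sum_congr rfl fun i hi => ?_) (this.symm.trans ?_)
      · rw [show k - i + 1 = k + 1 - i by have := Finset.mem_range.1 hi; omega]
      · refine Finset.sum_congr rfl fun r _ => Finset.sum_congr rfl fun i hi => ?_
        rw [show k - i - (r - i) = k - r by have := Finset.mem_range.1 hi; omega]
    rw [e1, ← Finset.sum_add_distrib, ← Finset.sum_add_distrib]
    refine Finset.sum_eq_zero fun r hr => ?_
    rw [← h1 r (k - r), show k + 1 - r = k - r + 1 by have := Finset.mem_range.1 hr; omega]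

/-- The identities are linear over formal constants, so they survive the normalization by `s(1)⁻¹`.
-/
theorem IsStokesFamily.mul {s : V →ₗ[ℂ] PowerSeries ℂ} {a b : V} {h : ℕ → V} {f : V}
    (hs : IsStokesFamily (fun k => PowerSeries.coeff k ∘ₗ s) a b h f) (u : PowerSeries ℂ) :
    IsStokesFamily (fun k => PowerSeries.coeff k ∘ₗ LinearMap.mulLeft ℂ u ∘ₗ s) a b h f := by
  have hc : ∀ (k : ℕ) (g : V), PowerSeries.coeff k (u * s g) = ∑ j ∈ Finset.range (k + 1),
      PowerSeries.coeff j u * PowerSeries.coeff (k - j) (s g) := fun k g => by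
    rw [PowerSeries.coeff_mul, Finset.Nat.sum_antidiagonal_eq_sum_range_succ
      (fun i j => PowerSeries.coeff i u * PowerSeries.coeff j (s g))]
  have h0 : PowerSeries.coeff 0 (s a) = 0 := hs.coeff_zero
  refine ⟨?_, fun k => ?_⟩
  · simp only [LinearMap.comp_apply, LinearMap.mulLeft_apply, hc]
    simp [h0, -PowerSeries.coeff_zero_eq_constantCoeff]
  · simp only [LinearMap.comp_apply, LinearMap.mulLeft_apply, hc]
    rw [Finset.sum_range_succ _ (k + 1), Nat.sub_self, h0, mul_zero, add_zero]
    have e1 : ∑ i ∈ Finset.range (k + 1), ∑ j ∈ Finset.range (k - i + 1),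
        PowerSeries.coeff j u * PowerSeries.coeff (k - i - j) (s (h i * f)) =
        ∑ j ∈ Finset.range (k + 1), ∑ i ∈ Finset.range (k - j + 1),
          PowerSeries.coeff j u * PowerSeries.coeff (k - j - i) (s (h i * f)) := by
      refine Finset.sum_comm' (fun i j => ?_) |>.trans
        (Finset.sum_congr rfl fun j _ => Finset.sum_congr rfl fun i _ => ?_)
      · simp only [Finset.mem_range]
        omega
      · rw [Nat.sub_right_comm]
    rw [e1, ← Finset.sum_add_distrib, ← Finset.sum_add_distrib]
    refine Finset.sum_eq_zero fun j hj => ?_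
    have := hs.coeff_succ (k - j)
    simp only [LinearMap.comp_apply] at this
    rw [show k + 1 - j = k - j + 1 by have := Finset.mem_range.1 hj; omega, ← Finset.mul_sum,
      ← mul_add, ← mul_add, this, mul_zero]

/-- Passage from plain functions to formal ones. Regrouped by the coefficients of `F`, the
coefficient of `ν^l` becomes a finite sum of the identities `coeff_succ`, one for each coefficient.
-/
theorem finsum_stokes_eq_zero {T : ℕ → V →ₗ[ℂ] ℂ} {B : V →ₗ[ℂ] V} {ψ : V}
    {h F : LaurentSeries V} (hh : ∀ r < 0, h.coeff r = 0)
    (hT : ∀ f, IsStokesFamily T (ψ * f) (B f) (fun i => h.coeff i) f) (l : ℤ) :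
    ∑ᶠ r : ℕ, T r ((F.map B + (HahnSeries.single (-1) ψ + h) * F).coeff (l - r)) = 0 := by
  obtain ⟨q, hq⟩ := HahnSeries.exists_coeff_eq_zero_of_lt F
  obtain ⟨N, hN⟩ : ∃ N : ℕ, l - q < N := ⟨(l - q + 1).toNat, by omega⟩
  have hG : ∀ k ≤ l, (F.map B + (HahnSeries.single (-1) ψ + h) * F).coeff k =
      B (F.coeff k) + (ψ * F.coeff (k + 1) +
        ∑ i ∈ Finset.range (N + 1), h.coeff (i : ℤ) * F.coeff (k - i)) := fun k hk => by
    rw [add_mul, HahnSeries.coeff_add, HahnSeries.coeff_add, HahnSeries.map_coeff,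
      HahnSeries.coeff_single_mul, sub_neg_eq_add,
      HahnSeries.coeff_mul_eq_sum_range (M := N + 1) hh hq (by push_cast; omega)]
    simp only [zero_add]
  -- The factor `ν⁻¹` lowers the first exponent from `q` to `q - 1`; the minimum with `l` is there
  -- because `hG` is available only up to `l`.
  have key := finsum_coeff_eq_sum_range (fun r => (T r).toAddMonoidHom)
    (F := (F.map B + (HahnSeries.single (-1) ψ + h) * F).coeff) (k := l)
    (q := min (q - 1) l) (N := N + 1)
    (fun j hj => by
      have hj1 : j < q - 1 := (lt_min_iff.1 hj).1
      rw [hG j (lt_min_iff.1 hj).2.le, hq j (by omega), hq (j + 1) (by omega), map_zero, mul_zero,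
        zero_add, zero_add]
      exact Finset.sum_eq_zero fun i _ => by rw [hq _ (by omega), mul_zero])
    (by push_cast; omega)
  simp only [LinearMap.toAddMonoidHom_coe] at key
  have ha : ∀ j : ℕ, N ≤ j → F.coeff (l - j) = 0 := fun j hj => hq _ (by omega)
  have e1 : ∀ r : ℕ, T r ((F.map B + (HahnSeries.single (-1) ψ + h) * F).coeff (l - r)) =
      T r (B (F.coeff (l - r))) + (T r (ψ * F.coeff (l - r + 1)) +
        ∑ i ∈ Finset.range (N + 1), T r (h.coeff (i : ℤ) * F.coeff (l - (i + r : ℕ)))) := by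
    intro r
    rw [hG _ (by omega), map_add, map_add, map_sum]
    congr 3
    funext i
    congr 3
    push_cast
    ring
  have e2 : ∑ r ∈ Finset.range (N + 1), ∑ i ∈ Finset.range (N + 1),
      T r (h.coeff (i : ℤ) * F.coeff (l - (i + r : ℕ))) =
      ∑ j ∈ Finset.range (N + 1), ∑ i ∈ Finset.range (j + 1),
        T (j - i) (h.coeff (i : ℤ) * F.coeff (l - j)) := by
    rw [Finset.sum_comm]
    have := Finset.sum_range_diag_flip (N + 1)
      fun i r => T r (h.coeff (i : ℤ) * F.coeff (l - (i + r : ℕ)))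
    refine Eq.trans (Finset.sum_congr rfl fun i hi => ?_) (this.symm.trans ?_)
    · refine (Finset.sum_subset (Finset.range_mono (Nat.sub_le _ _)) fun r _ hr => ?_).symm
      have hr' : N + 1 - i ≤ r := by simpa using hr
      rw [ha _ (by omega), mul_zero, map_zero]
    · refine Finset.sum_congr rfl fun j _ => Finset.sum_congr rfl fun i hi => ?_
      rw [show i + (j - i) = j by have := Finset.mem_range.1 hi; omega]
  -- The factor `ν⁻¹` shifts the index by one. The term `r = 0` disappears by `coeff_zero`, the new
  -- last term because `F` has no coefficient there.
  have e3 : ∑ r ∈ Finset.range (N + 1), T r (ψ * F.coeff (l - r + 1)) =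
      ∑ r ∈ Finset.range (N + 1), T (r + 1) (ψ * F.coeff (l - r)) := by
    rw [Finset.sum_range_succ', (hT _).coeff_zero, add_zero, Finset.sum_range_succ, ha N le_rfl,
      mul_zero, map_zero, add_zero]
    refine Finset.sum_congr rfl fun r _ => ?_
    congr 3
    push_cast
    ring
  rw [key, Finset.sum_congr rfl fun r _ => e1 r, Finset.sum_add_distrib, Finset.sum_add_distrib, e2, e3,
    ← Finset.sum_add_distrib, ← Finset.sum_add_distrib]
  refine Finset.sum_eq_zero fun r _ => ?_
  rw [← (hT (F.coeff (l - r))).coeff_succ r]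
  ring

end FormalStokes

/-! ### The divergence theorem on the manifold and its asymptotic form. -/

section StokesIdentity

variable {n : ℕ} {U : Type*} [TopologicalSpace U] [ChartedSpace (Coord n) U]
  [T2Space U] [IsManifold (𝓡 (2 * n)) ∞ U]

omit [T2Space U] [IsManifold (𝓡 (2 * n)) ∞ U] in
/-- A bump function with compact support in a given neighbourhood of a point of a chart. -/
theorem exists_contDiffBump (x₀ : U) {W : Set (Coord n)}
    (hW : W ∈ 𝓝 (chartAt (Coord n) x₀ x₀)) :
    ∃ χ : ContDiffBump (chartAt (Coord n) x₀ x₀),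
      Metric.closedBall (chartAt (Coord n) x₀ x₀) χ.rOut ⊆ (chartAt (Coord n) x₀).target ∩ W := by
  have hot := (chartAt (Coord n) x₀).map_source (mem_chart_source _ x₀)
  obtain ⟨R, hR, hsub⟩ := Metric.nhds_basis_closedBall.mem_iff.1
    (Filter.inter_mem ((chartAt (Coord n) x₀).open_target.mem_nhds hot) hW)
  exact ⟨⟨R / 2, R, by positivity, by linarith⟩, hsub⟩

omit [IsManifold (𝓡 (2 * n)) ∞ U] [T2Space U] in
theorem contDiffBump_eq_zero {o : Coord n} (χ : ContDiffBump o) :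
    ∀ y ∉ Metric.closedBall o χ.rOut, χ y = 0 := fun _ hy =>
  χ.zero_of_le_dist (not_le.1 fun h => hy h).le

theorem exists_smoothFn_bump (x₀ : U) {W : Set (Coord n)}
    (hW : W ∈ 𝓝 (chartAt (Coord n) x₀ x₀)) :
    ∃ (X : SmoothFn n U) (K : Set (Coord n)), IsCompact K ∧
      K ⊆ (chartAt (Coord n) x₀).target ∩ W ∧
      (∀ x ∉ (chartAt (Coord n) x₀).symm '' K, X.1 x = 0) ∧ ∀ᶠ x in 𝓝 x₀, X.1 x = 1 := by
  set e := chartAt (Coord n) x₀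
  obtain ⟨χ, hχ⟩ : ∃ χ : ContDiffBump (e x₀),
    Metric.closedBall (e x₀) χ.rOut ⊆ e.target ∩ W := exists_contDiffBump x₀ hW
  have hχ0 : ∀ y ∉ Metric.closedBall (e x₀) χ.rOut, (χ y : ℂ) = 0 := fun y hy => by
    rw [contDiffBump_eq_zero χ y hy, Complex.ofReal_zero]
  have hsub : Metric.closedBall (e x₀) χ.rOut ⊆ e.target := fun y hy => (hχ hy).1
  obtain ⟨X, hX⟩ := exists_smoothFn_chartExtend (p := x₀) (g := fun y => (χ y : ℂ))
    (Complex.ofRealCLM.contDiff.comp χ.contDiff) (isCompact_closedBall _ _) hsub hχ0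
  refine ⟨X, _, isCompact_closedBall _ _, hχ, fun x hx => ?_, ?_⟩
  · rw [hX]
    exact by_contra fun h => hx (support_chartExtend_subset hχ0 h)
  · filter_upwards [e.open_source.mem_nhds (mem_chart_source _ x₀),
      (e.continuousAt (mem_chart_source _ x₀)) (Metric.closedBall_mem_nhds _ χ.rIn_pos)]
      with x hx hxb
    rw [hX, chartExtend_of_mem _ hx, χ.one_of_mem_closedBall hxb, Complex.ofReal_one]

omit [T2Space U] in
theorem SmoothVectorField.apply_congr (ξ : SmoothVectorField n U) {f g : SmoothFn n U} {x : U}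
    (h : ∀ᶠ z in 𝓝 x, f.1 z = g.1 z) : (ξ.op f).1 x = (ξ.op g).1 x := by
  have h1 : f.1 =ᶠ[𝓝 x] g.1 := h
  exact congrArg (fun A => A (ξ x)) (h1.mfderiv_eq (I := 𝓡 (2 * n)) (I' := 𝓘(ℝ, ℂ)))

omit [T2Space U] in
theorem SmoothVectorField.apply_eq_zero (ξ : SmoothVectorField n U) {f : SmoothFn n U} {x : U}
    (h : ∀ᶠ z in 𝓝 x, f.1 z = 0) : (ξ.op f).1 x = 0 := by
  rw [ξ.apply_congr (g := 0) h, map_zero]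
  rfl

variable [MeasurableSpace U] [BorelSpace U]

/-- The divergence theorem for `e^{mφ} F (s_r dx)` and the vector field `ξ`. -/
theorem VolumeForm.expIntegral_divergence_eq_zero (dx : VolumeForm n U) {φ : SmoothFn n U}
    {x₀ : U} {s : ℕ → SmoothFn n U} {ξ : SmoothVectorField n U} {h : ℕ → SmoothFn n U}
    {F : SmoothFn n U} {K : Set (Coord n)} (hK : IsCompact K)
    (hKt : K ⊆ (chartAt (Coord n) x₀).target)
    (hF : ∀ x ∉ (chartAt (Coord n) x₀).symm '' K, F.1 x = 0) (r : ℕ)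
    (hdiv : ∀ y ∈ K, lieDerivCoeff ξ x₀ (dx.coeff (s r) x₀) y =
      ∑ i ∈ Finset.range (r + 1), chartRep x₀ (h i) y * dx.coeff (s (r - i)) x₀ y) (m : ℝ) :
    m * dx.expIntegral φ (s r * (ξ.op φ * F)) m + (dx.expIntegral φ (s r * ξ.op F) m +
      ∑ i ∈ Finset.range (r + 1), dx.expIntegral φ (s (r - i) * (h i * F)) m) = 0 := by
  set e := chartAt (Coord n) x₀ with he
  have hKU : IsCompact (e.symm '' K) := isCompact_symm_image hK hKt
  have hKs : e.symm '' K ⊆ e.source := symm_image_subset_source hKt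
  have hsupp : ∀ G : SmoothFn n U, (∀ x ∉ e.symm '' K, G.1 x = 0) →
      tsupport G.1 ⊆ e.symm '' K := fun G hG =>
    closure_minimal (fun x hx => by_contra fun h => hx (hG x h)) hKU.isClosed
  have hcomp : ∀ G : SmoothFn n U, (∀ x ∉ e.symm '' K, G.1 x = 0) → HasCompactSupport G.1 :=
    fun G hG => hKU.of_isClosed_subset (isClosed_tsupport _) (hsupp G hG)
  have hξF : ∀ x ∉ e.symm '' K, (ξ.op F).1 x = 0 := fun x hx =>
    ξ.apply_eq_zero (by filter_upwards [hKU.isClosed.isOpen_compl.mem_nhds hx] with z hz using hF z hz)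
  have hG1 : ∀ x ∉ e.symm '' K, (s r * (ξ.op φ * F)).1 x = 0 := fun x hx => by
    show (s r).1 x * ((ξ.op φ).1 x * F.1 x) = 0
    rw [hF x hx]; ring
  have hG2 : ∀ x ∉ e.symm '' K, (s r * ξ.op F).1 x = 0 := fun x hx => by
    show (s r).1 x * (ξ.op F).1 x = 0
    rw [hξF x hx]; ring
  have hG3 : ∀ i, ∀ x ∉ e.symm '' K, (s (r - i) * (h i * F)).1 x = 0 := fun i x hx => by
    show (s (r - i)).1 x * ((h i).1 x * F.1 x) = 0
    rw [hF x hx]; ring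
  have hsumapp : ∀ (N : ℕ) (f : ℕ → SmoothFn n U) (x : U),
      (∑ i ∈ Finset.range N, f i).1 x = ∑ i ∈ Finset.range N, (f i).1 x := fun N f x => by
    induction N with
    | zero => rfl
    | succ N ih => rw [Finset.sum_range_succ, Finset.sum_range_succ, ← ih]; rfl
  have hG4 : ∀ N, ∀ x ∉ e.symm '' K,
      (∑ i ∈ Finset.range N, s (r - i) * (h i * F)).1 x = 0 := fun N x hx => by
    rw [hsumapp]
    exact Finset.sum_eq_zero fun i _ => hG3 i x hx
  have hsumI : ∀ N : ℕ, dx.expIntegral φ (∑ i ∈ Finset.range N, s (r - i) * (h i * F)) m =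
      ∑ i ∈ Finset.range N, dx.expIntegral φ (s (r - i) * (h i * F)) m := fun N => by
    induction N with
    | zero =>
      have := dx.expIntegral_smul φ 0 0 m
      simpa using this
    | succ N ih =>
      rw [Finset.sum_range_succ, Finset.sum_range_succ, ← ih,
        dx.expIntegral_add φ (hcomp _ (hG4 N)) (hcomp _ (hG3 N))]
  set G : SmoothFn n U := (m : ℂ) • (s r * (ξ.op φ * F)) + (s r * ξ.op F +
    ∑ i ∈ Finset.range (r + 1), s (r - i) * (h i * F)) with hGdef
  have hG5 : ∀ x ∉ e.symm '' K, ((m : ℂ) • (s r * (ξ.op φ * F))).1 x = 0 := fun x hx => by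
    show (m : ℂ) * (s r * (ξ.op φ * F)).1 x = 0
    rw [hG1 x hx, mul_zero]
  have hG6 : ∀ x ∉ e.symm '' K, (s r * ξ.op F +
      ∑ i ∈ Finset.range (r + 1), s (r - i) * (h i * F)).1 x = 0 := fun x hx => by
    show (s r * ξ.op F).1 x + (∑ i ∈ Finset.range (r + 1), s (r - i) * (h i * F)).1 x = 0
    rw [hG2 x hx, hG4 _ x hx, add_zero]
  have hG : ∀ x ∉ e.symm '' K, G.1 x = 0 := fun x hx => by
    show ((m : ℂ) • (s r * (ξ.op φ * F))).1 x + (s r * ξ.op F +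
      ∑ i ∈ Finset.range (r + 1), s (r - i) * (h i * F)).1 x = 0
    rw [hG5 x hx, hG6 x hx, add_zero]
  have hsG : tsupport G.1 ⊆ e.source := (hsupp G hG).trans hKs
  rw [← hsumI, ← dx.expIntegral_add φ (hcomp _ hG2) (hcomp _ (hG4 _)), ← dx.expIntegral_smul,
    ← dx.expIntegral_add φ (hcomp _ hG5) (hcomp _ hG6), ← hGdef, VolumeForm.expIntegral,
    dx.integral_mul_eq x₀ (continuous_exp_mul_smoothFn φ m) hsG]
  have hP : ∀ x ∉ e.symm '' K, (s r * F).1 x = 0 := fun x hx => by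
    show (s r).1 x * F.1 x = 0
    rw [hF x hx, mul_zero]
  have hPs : tsupport (s r * F).1 ⊆ e.source := (hsupp _ hP).trans hKs
  -- The components of `ξ` times the density of `F (s_r dx)`. The integrand in question is the
  -- divergence of `e^{mφ} g`.
  let g : Fin (2 * n) → Coord n → ℂ := fun k y =>
    (ξ.component x₀ k y : ℂ) * dx.pushDensity x₀ (s r * F) y
  have hξk : ∀ k, ContDiffOn ℝ ∞ (fun y => (ξ.component x₀ k y : ℂ)) e.target := fun k =>
    Complex.ofRealCLM.contDiff.comp_contDiffOn (contDiffOn_component ξ x₀ k)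
  have hg : ∀ k, ContDiffOn ℝ ∞ (g k) e.target := fun k =>
    (hξk k).mul (dx.contDiff_pushDensity (hcomp _ hP) hPs).contDiffOn
  have hgs : ∀ k, tsupport (g k) ⊆ e.target := fun k =>
    tsupport_mul_subset_right.trans (dx.tsupport_pushDensity_subset_target (hcomp _ hP) hPs)
  have hgc : ∀ k, HasCompactSupport (g k) := fun k =>
    (dx.hasCompactSupport_pushDensity (hcomp _ hP) hPs).mul_left
  rw [← integral_exp_mul_sum_divergence_eq_zero e.open_target (contDiffOn_chartRep x₀ φ)
    Finset.univ hg hgs hgc m fun k => EuclideanSpace.single k 1]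
  refine MeasureTheory.integral_congr_ae (MeasureTheory.ae_of_all _ fun y => ?_)
  simp only
  rw [← Finset.mul_sum]
  congr 1
  by_cases hy : y ∈ e.target
  · rw [dx.pushDensity_of_mem G hy]
    have hyn := e.open_target.mem_nhds hy
    have hd : ∀ k, fderiv ℝ (g k) y (EuclideanSpace.single k 1) =
        fderiv ℝ (fun z => (ξ.component x₀ k z : ℂ) * dx.coeff (s r) x₀ z) y
          (EuclideanSpace.single k 1) * chartRep x₀ F y +
        (ξ.component x₀ k y : ℂ) * dx.coeff (s r) x₀ y *
          fderiv ℝ (chartRep x₀ F) y (EuclideanSpace.single k 1) := by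
      intro k
      have hev : g k =ᶠ[𝓝 y] fun z =>
          ((ξ.component x₀ k z : ℂ) * dx.coeff (s r) x₀ z) * chartRep x₀ F z := by
        filter_upwards [hyn] with z hz
        simp only [g]
        rw [dx.pushDensity_of_mem _ hz, mul_comm (s r), dx.coeff_mul]
        ring
      have d1 := ((((hξk k).mul (dx.contDiffOn_coeff (s r) x₀)).contDiffAt
        hyn).differentiableAt (by simp)).hasFDerivAt
      have d2 := (((contDiffOn_chartRep x₀ F).contDiffAt hyn).differentiableAt
        (by simp)).hasFDerivAt
      have d3 : HasFDerivAt (fun z => ((ξ.component x₀ k z : ℂ) * dx.coeff (s r) x₀ z) *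
        chartRep x₀ F z) _ y := d1.mul d2
      rw [hev.fderiv_eq, d3.fderiv]
      simp only [add_apply, smul_apply, smul_eq_mul]
      ring
    have hsum1 : ∑ k, fderiv ℝ (fun z => (ξ.component x₀ k z : ℂ) * dx.coeff (s r) x₀ z) y
        (EuclideanSpace.single k 1) * chartRep x₀ F y =
        (∑ i ∈ Finset.range (r + 1), chartRep x₀ (h i) y * dx.coeff (s (r - i)) x₀ y) *
          chartRep x₀ F y := by
      rw [← Finset.sum_mul]
      -- The divergence formula is assumed only on `K`; outside of `K` both sides carry the factor
      -- `F`, which is zero there.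
      by_cases hyK : y ∈ K
      · rw [← hdiv y hyK]
        rfl
      · have h0 : chartRep x₀ F y = 0 := hF _ fun ⟨z, hz, hzy⟩ => hyK (by
          rwa [← e.symm.injOn (hKt hz) hy hzy])
        rw [h0, mul_zero, mul_zero]
    have hsum2 : ∀ f : SmoothFn n U, chartRep x₀ (ξ.op f) y = ∑ k, (ξ.component x₀ k y : ℂ) *
        fderiv ℝ (chartRep x₀ f) y (EuclideanSpace.single k 1) := fun f =>
      apply_eq_sum_component ξ f x₀ hy
    have hcG : dx.coeff G x₀ y = m * (chartRep x₀ (ξ.op φ) y * chartRep x₀ F y *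
        dx.coeff (s r) x₀ y) + (chartRep x₀ (ξ.op F) y * dx.coeff (s r) x₀ y +
        ∑ i ∈ Finset.range (r + 1), chartRep x₀ (h i) y * dx.coeff (s (r - i)) x₀ y *
          chartRep x₀ F y) := by
      have hx : G.1 (e.symm y) = m * ((s r).1 (e.symm y) * ((ξ.op φ).1 (e.symm y) *
          F.1 (e.symm y))) + ((s r).1 (e.symm y) * (ξ.op F).1 (e.symm y) +
          ∑ i ∈ Finset.range (r + 1), (s (r - i)).1 (e.symm y) * ((h i).1 (e.symm y) *
            F.1 (e.symm y))) := by
        have := hsumapp (r + 1) (fun i => s (r - i) * (h i * F)) (e.symm y)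
        rw [hGdef]
        exact congrArg (fun t => m * ((s r).1 (e.symm y) * ((ξ.op φ).1 (e.symm y) *
          F.1 (e.symm y))) + ((s r).1 (e.symm y) * (ξ.op F).1 (e.symm y) + t)) this
      rw [VolumeForm.coeff, ← he, hx]
      simp only [VolumeForm.coeff, chartRep, add_mul, Finset.sum_mul, ← he]
      congr 1
      · ring
      congr 1
      · ring
      refine Finset.sum_congr rfl fun i _ => ?_
      ring
    have hgy : ∀ k, g k y = (ξ.component x₀ k y : ℂ) * (chartRep x₀ F y * dx.coeff (s r) x₀ y) := by
      intro k
      simp only [g]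
      rw [dx.pushDensity_of_mem _ hy, mul_comm (s r), dx.coeff_mul]
    rw [hcG]
    simp only [hd, hgy, Finset.sum_add_distrib]
    rw [hsum1, hsum2, hsum2, Finset.sum_mul, Finset.sum_mul, Finset.sum_mul, Finset.sum_mul,
      Finset.mul_sum, ← add_assoc, add_assoc, add_comm (∑ k, _ * dx.coeff (s r) x₀ y)]
    congr 1
    · exact Finset.sum_congr rfl fun k _ => by ring
    congr 1
    exact Finset.sum_congr rfl fun k _ => by ring
  · rw [VolumeForm.pushDensity, Set.indicator_of_notMem hy]
    refine (Finset.sum_eq_zero fun k _ => ?_).symm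
    have hev : g k =ᶠ[𝓝 y] fun _ => 0 := notMem_tsupport_iff_eventuallyEq.1 fun h => hy (hgs k h)
    rw [hev.fderiv_eq, hev.eq_of_nhds]
    simp

/-- Integration by parts for the asymptotic expansion of `∫_U e^{mφ} f dx`. -/
theorem expansion_divergence_eq_zero (dx : VolumeForm n U) {φ : SmoothFn n U} {x₀ : U}
    {S : SmoothFn n U →ₗ[ℂ] PowerSeries ℂ}
    (hS : ∀ f, HasCompactSupport f.1 →
      PowerAsymp (fun m => (m : ℂ) ^ n * dx.expIntegral φ f m) (S f))
    (hloc : ∀ f, (∀ᶠ x in 𝓝 x₀, f.1 x = 0) → S f = 0)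
    {s : ℕ → SmoothFn n U} {ξ : SmoothVectorField n U} {h : FormalFn n U}
    (hdiv : IsDivergenceNear dx s ξ x₀ h) (f : SmoothFn n U) (r : ℕ) :
    S (s r * (ξ.op φ * f)) + PowerSeries.X * (S (s r * ξ.op f) +
      ∑ i ∈ Finset.range (r + 1), S (s (r - i) * (h.coeff i * f))) = 0 := by
  -- The expansion sees only germs at `x₀`, so `f` may be cut off to a compact set on which the
  -- divergence formula holds. One neighbourhood serves all `r` at once.
  obtain ⟨X, K, hK, hKs, hX0, hX1⟩ := exists_smoothFn_bump x₀ hdiv.2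
  have hKt := hKs.trans Set.inter_subset_left
  have hF : ∀ x ∉ (chartAt (Coord n) x₀).symm '' K, (X * f).1 x = 0 := fun x hx => by
    show X.1 x * f.1 x = 0
    rw [hX0 x hx, zero_mul]
  have hXev : ∀ᶠ x in 𝓝 x₀, (X * f).1 x = f.1 x := by
    filter_upwards [hX1] with x hx
    show X.1 x * f.1 x = f.1 x
    rw [hx, one_mul]
  have hcongr : ∀ a b : SmoothFn n U, (∀ᶠ x in 𝓝 x₀, a.1 x = b.1 x) → S a = S b := by
    intro a b hab
    rw [← sub_eq_zero, ← map_sub]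
    refine hloc _ ?_
    filter_upwards [hab] with x hx
    show a.1 x - b.1 x = 0
    rw [hx, sub_self]
  have e1 : S (s r * (ξ.op φ * f)) = S (s r * (ξ.op φ * (X * f))) := by
    refine hcongr _ _ ?_
    filter_upwards [hXev] with x hx
    show (s r).1 x * ((ξ.op φ).1 x * f.1 x) = (s r).1 x * ((ξ.op φ).1 x * (X * f).1 x)
    rw [hx]
  have e2 : S (s r * ξ.op f) = S (s r * ξ.op (X * f)) := by
    refine hcongr _ _ ?_
    filter_upwards [hXev.eventually_nhds] with x hx
    show (s r).1 x * (ξ.op f).1 x = (s r).1 x * (ξ.op (X * f)).1 x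
    rw [ξ.apply_congr hx]
  have e3 : ∀ i : ℕ, S (s (r - i) * (h.coeff i * f)) = S (s (r - i) * (h.coeff i * (X * f))) := by
    intro i
    refine hcongr _ _ ?_
    filter_upwards [hXev] with x hx
    show (s (r - i)).1 x * ((h.coeff i).1 x * f.1 x) =
      (s (r - i)).1 x * ((h.coeff i).1 x * (X * f).1 x)
    rw [hx]
  rw [e1, e2, Finset.sum_congr rfl fun i _ => e3 i]
  have hKU := isCompact_symm_image hK hKt
  have hcs : HasCompactSupport (X * f).1 := hKU.of_isClosed_subset (isClosed_tsupport _)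
    (closure_minimal (fun x hx => by_contra fun h => hx (hF x h)) hKU.isClosed)
  have hξF : HasCompactSupport (ξ.op (X * f)).1 := hKU.of_isClosed_subset (isClosed_tsupport _)
    (closure_minimal (fun x hx => by_contra fun h => hx (ξ.apply_eq_zero (by
      filter_upwards [hKU.isClosed.isOpen_compl.mem_nhds h] with z hz using hF z hz)))
      hKU.isClosed)
  have a1 := hS (s r * (ξ.op φ * (X * f))) (hcs.mul_left.mul_left)
  have a2 := hS (s r * ξ.op (X * f)) hξF.mul_left
  have a3 := PowerAsymp.sum (Finset.range (r + 1)) fun i _ =>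
    hS (s (r - i) * (h.coeff i * (X * f))) (hcs.mul_left.mul_left)
  have a4 := a1.add ((a2.add a3).inv_pow_mul 1)
  rw [pow_one] at a4
  -- The sum of the four expansions belongs to a function vanishing for `m > 0`: it is the
  -- divergence theorem multiplied by `m^n / m`. This division by `m` is the factor `X` in the
  -- identity.
  refine a4.unique (PowerAsymp.of_isBigO fun N => ?_)
  refine (Asymptotics.isBigO_zero (fun m : ℝ => m⁻¹ ^ N) _).congr' ?_ Filter.EventuallyEq.rfl
  filter_upwards [Filter.eventually_gt_atTop (0 : ℝ)] with m hm
  have hm' : (m : ℂ) ≠ 0 := Complex.ofReal_ne_zero.2 hm.ne'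
  have key := dx.expIntegral_divergence_eq_zero (φ := φ) (h := fun i => h.coeff i) hK hKt hF r
    (fun y hy => (hKs hy).2 r) m
  simp only [← Finset.mul_sum, pow_one]
  have : dx.expIntegral φ (s r * (ξ.op φ * (X * f))) m + (m : ℂ)⁻¹ *
      (dx.expIntegral φ (s r * ξ.op (X * f)) m +
        ∑ i ∈ Finset.range (r + 1), dx.expIntegral φ (s (r - i) * (h.coeff i * (X * f))) m) = 0 := by
    field_simp
    linear_combination key
  linear_combination (-(m : ℂ) ^ n) * this

end StokesIdentity

/-! ### Existence of the formal divergence near the critical point. -/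

section Divergence

/-- The solution of `h_r + ∑_{i < r} h_i W_{r - i} = L_r`. -/
def triangularSolution {R : Type*} [CommRing R] (L W : ℕ → R) (r : ℕ) : R :=
  L r - ∑ i : Fin r, triangularSolution L W i * W (r - i)
termination_by r

theorem triangularSolution_eq {R : Type*} [CommRing R] (L W : ℕ → R) (r : ℕ) :
    triangularSolution L W r =
      L r - ∑ i ∈ Finset.range r, triangularSolution L W i * W (r - i) := by
  rw [triangularSolution, Finset.sum_range fun i => triangularSolution L W i * W (r - i)]

variable {n : ℕ} {U : Type*} [TopologicalSpace U] [ChartedSpace (Coord n) U]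
  [T2Space U] [IsManifold (𝓡 (2 * n)) ∞ U]

omit [T2Space U] in
theorem contDiffOn_lieDerivCoeff (ξ : SmoothVectorField n U) (p : U) {w : Coord n → ℂ}
    (hw : ContDiffOn ℝ ∞ w (chartAt (Coord n) p).target) :
    ContDiffOn ℝ ∞ (lieDerivCoeff ξ p w) (chartAt (Coord n) p).target := by
  refine ContDiffOn.sum fun k _ => ?_
  have h1 : ContDiffOn ℝ ∞ (fun z => (ξ.component p k z : ℂ) * w z)
      (chartAt (Coord n) p).target :=
    (Complex.ofRealCLM.contDiff.comp_contDiffOn (contDiffOn_component ξ p k)).mul hw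
  exact (h1.fderiv_of_isOpen (chartAt (Coord n) p).open_target (by simp)).clm_apply
    contDiffOn_const

variable [MeasurableSpace U]

/-- The equation `L_ξ μ = h μ` is triangular in the coefficients of `h`, with the leading density on
the diagonal. This density is not zero near `x₀`, so the system can be solved recursively. -/
theorem exists_isDivergenceNear (dx : VolumeForm n U) {s : ℕ → SmoothFn n U} {x₀ : U}
    (hs : (s 0).1 x₀ ≠ 0) (ξ : SmoothVectorField n U) :
    ∃ h : FormalFn n U, IsDivergenceNear dx s ξ x₀ h := by
  set e := chartAt (Coord n) x₀ with he
  have hx₀ : x₀ ∈ e.source := mem_chart_source _ x₀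
  have hot : e x₀ ∈ e.target := e.map_source hx₀
  have hcont : ContinuousOn (chartRep x₀ (s 0)) e.target :=
    (contDiffOn_chartRep x₀ (s 0)).continuousOn
  have hV : IsOpen (e.target ∩ chartRep x₀ (s 0) ⁻¹' {0}ᶜ) :=
    hcont.isOpen_inter_preimage e.open_target isOpen_compl_singleton
  have hoV : e x₀ ∈ e.target ∩ chartRep x₀ (s 0) ⁻¹' {0}ᶜ := by
    refine ⟨hot, ?_⟩
    show chartRep x₀ (s 0) (e x₀) ≠ 0
    rw [chartRep, ← he, e.left_inv hx₀]
    exact hs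
  obtain ⟨χ, hχ⟩ : ∃ χ : ContDiffBump (e x₀), Metric.closedBall (e x₀) χ.rOut ⊆
    e.target ∩ (e.target ∩ chartRep x₀ (s 0) ⁻¹' {0}ᶜ) :=
    exists_contDiffBump x₀ (hV.mem_nhds hoV)
  have hχV := hχ.trans Set.inter_subset_right
  have hχt := hχ.trans Set.inter_subset_left
  have hw0 : ∀ y ∈ e.target ∩ chartRep x₀ (s 0) ⁻¹' {0}ᶜ, dx.coeff (s 0) x₀ y ≠ 0 := fun y hy =>
    mul_ne_zero (mul_ne_zero hy.2 (dx.factor_ne_zero _))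
      (Complex.ofReal_ne_zero.2 (dx.baseDensity_pos x₀ y hy.1).ne')
  -- The inverse of the leading density, cut off so that the normalized data `L` and `W` of the
  -- triangular system are global smooth functions. Where `χ = 1` nothing is changed.
  let b : Coord n → ℂ := fun y => χ y * (dx.coeff (s 0) x₀ y)⁻¹
  have hχ0 : ∀ y ∉ Metric.closedBall (e x₀) χ.rOut, (χ y : ℂ) = 0 := fun y hy => by
    rw [contDiffBump_eq_zero χ y hy, Complex.ofReal_zero]
  have hb0 : ∀ y ∉ Metric.closedBall (e x₀) χ.rOut, b y = 0 := fun y hy => by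
    simp only [b, hχ0 y hy, zero_mul]
  have hbV : ∀ a : Coord n → ℂ, ContDiffOn ℝ ∞ a e.target →
      ∃ A : SmoothFn n U, ∀ y ∈ e.target, chartRep x₀ A y = b y * a y := by
    intro a ha
    have h0 : ∀ y ∉ Metric.closedBall (e x₀) χ.rOut, b y * a y = 0 := fun y hy => by
      rw [hb0 y hy, zero_mul]
    have hsm : ContDiff ℝ ∞ fun y => b y * a y := by
      refine contDiff_of_tsupport_subset hV (ContDiffOn.mul (ContDiffOn.mul
        (Complex.ofRealCLM.contDiff.comp χ.contDiff).contDiffOn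
        (ContDiffOn.inv ((dx.contDiffOn_coeff (s 0) x₀).mono Set.inter_subset_left) hw0))
        (ha.mono Set.inter_subset_left)) ?_
      have hsupp : (Function.support fun y => b y * a y) ⊆ Metric.closedBall (e x₀) χ.rOut :=
        fun y hy => by_contra fun h => hy (h0 y h)
      exact (closure_minimal hsupp Metric.isClosed_closedBall).trans hχV
    obtain ⟨A, hA⟩ := exists_smoothFn_chartExtend hsm (isCompact_closedBall _ _) hχt h0
    refine ⟨A, fun y hy => ?_⟩
    rw [chartRep, hA]
    exact chartExtend_symm _ hy
  have h1 := fun r => hbV _ (contDiffOn_lieDerivCoeff ξ x₀ (dx.contDiffOn_coeff (s r) x₀))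
  have h2 := fun r => hbV _ (dx.contDiffOn_coeff (s r) x₀)
  choose L hL using h1
  choose W hW using h2
  refine ⟨HahnSeries.ofSuppBddBelow
    (fun k : ℤ => if 0 ≤ k then triangularSolution L W k.toNat else 0)
    ⟨0, fun k hk => not_lt.1 fun h => hk (if_neg (not_le.2 h))⟩, fun r hr => if_neg (not_le.2 hr),
    ?_⟩
  filter_upwards [Metric.closedBall_mem_nhds (e x₀) χ.rIn_pos] with y hy r
  have hyV := hχV (Metric.closedBall_subset_closedBall χ.rIn_lt_rOut.le hy)
  have hb : b y * dx.coeff (s 0) x₀ y = 1 := by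
    simp only [b, χ.one_of_mem_closedBall hy, Complex.ofReal_one, one_mul]
    exact inv_mul_cancel₀ (hw0 y hyV)
  have hcoeff : ∀ i : ℕ, (HahnSeries.ofSuppBddBelow
      (fun k : ℤ => if 0 ≤ k then triangularSolution L W k.toNat else 0)
      ⟨0, fun k hk => not_lt.1 fun h => hk (if_neg (not_le.2 h))⟩).coeff (i : ℤ) =
      triangularSolution L W i := fun i => by
    show (if 0 ≤ (i : ℤ) then triangularSolution L W (i : ℤ).toNat else 0) = _
    rw [if_pos (Int.natCast_nonneg i), Int.toNat_natCast]
  simp only [hcoeff]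
  have hsumapp : ∀ (N : ℕ) (f : ℕ → SmoothFn n U) (x : U),
      (∑ i ∈ Finset.range N, f i).1 x = ∑ i ∈ Finset.range N, (f i).1 x := fun N f x => by
    induction N with
    | zero => rfl
    | succ N ih => rw [Finset.sum_range_succ, Finset.sum_range_succ, ← ih]; rfl
  have hr : chartRep x₀ (triangularSolution L W r) y = chartRep x₀ (L r) y -
      ∑ i ∈ Finset.range r, chartRep x₀ (triangularSolution L W i) y *
        chartRep x₀ (W (r - i)) y := by
    conv_lhs => rw [triangularSolution_eq]
    exact congrArg (fun t => chartRep x₀ (L r) y - t) (hsumapp r _ _)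
  rw [Finset.sum_range_succ, Nat.sub_self]
  change _ = _ + chartRep x₀ (triangularSolution L W r) y * _
  rw [hr, hL r y hyV.1]
  simp only [hW _ y hyV.1]
  rw [sub_mul, Finset.sum_mul]
  have e1 : ∀ i ∈ Finset.range r, chartRep x₀ (triangularSolution L W i) y *
      (b y * dx.coeff (s (r - i)) x₀ y) * dx.coeff (s 0) x₀ y =
      (triangularSolution L W i).1 (e.symm y) * dx.coeff (s (r - i)) x₀ y := fun i _ => by
    have : chartRep x₀ (triangularSolution L W i) y = (triangularSolution L W i).1 (e.symm y) := rfl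
    rw [this]
    linear_combination ((triangularSolution L W i).1 (e.symm y) * dx.coeff (s (r - i)) x₀ y) * hb
  rw [Finset.sum_congr rfl e1]
  linear_combination (-lieDerivCoeff ξ x₀ (dx.coeff (s r) x₀) y) * hb

end Divergence

/-! ### Uniqueness of the formal integral. -/

section Uniqueness

theorem finsum_single_coeff {V : Type*} [AddCommGroup V] [Module ℂ V] (T : ℕ → V →ₗ[ℂ] ℂ) (f : V)
    (k : ℤ) : ∑ᶠ r : ℕ, T r ((HahnSeries.single (0 : ℤ) f).coeff (k - r)) =
      if 0 ≤ k then T k.toNat f else 0 := by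
  have h1 : ∀ r : ℕ, (r : ℤ) ≠ k → T r ((HahnSeries.single (0 : ℤ) f).coeff (k - r)) = 0 :=
    fun r hr => by rw [HahnSeries.coeff_single_of_ne (by omega), map_zero]
  split_ifs with hk
  · rw [finsum_eq_single _ k.toNat fun r hr => h1 r (by omega), Int.toNat_of_nonneg hk, sub_self,
      HahnSeries.coeff_single_same]
  · exact (finsum_congr fun r => h1 r (by omega)).trans finsum_zero

variable {n : ℕ} {U : Type*} [TopologicalSpace U] [ChartedSpace (Coord n) U]
  [T2Space U] [IsManifold (𝓡 (2 * n)) ∞ U] [MeasurableSpace U]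

omit [T2Space U] [MeasurableSpace U] in
theorem map_single_op (ξ : SmoothVectorField n U) (k : ℤ) (f : SmoothFn n U) :
    (HahnSeries.single k f).map ξ.op = HahnSeries.single k (ξ.op f) := by
  ext1
  funext j
  rw [HahnSeries.map_coeff]
  by_cases hj : j = k
  · rw [hj, HahnSeries.coeff_single_same, HahnSeries.coeff_single_same]
  · rw [HahnSeries.coeff_single_of_ne hj, HahnSeries.coeff_single_of_ne hj, map_zero]

/-- A formal integral is determined by the pair `(ν⁻¹ φ, μ)`, provided functions vanishing at the
critical point are near that point combinations of the derivatives of the phase. -/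
theorem IsFormalIntegral.unique {dx : VolumeForm n U} {φ : SmoothFn n U} {x₀ : U}
    {s : ℕ → SmoothFn n U} {K K' : FormalFnSpace n U →ₗ[FormalNumber] FormalNumber}
    (hdivision : ∀ f : SmoothFn n U, f.1 x₀ = 0 → ∃ g : Fin (2 * n) → SmoothFn n U,
      ∀ᶠ y in 𝓝 (chartAt (Coord n) x₀ x₀), chartRep x₀ f y =
        ∑ j, fderiv ℝ (chartRep x₀ φ) y (EuclideanSpace.single j 1) * chartRep x₀ (g j) y)
    (hK : IsFormalIntegral x₀ (HahnSeries.single (-1) φ) dx s K)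
    (hK' : IsFormalIntegral x₀ (HahnSeries.single (-1) φ) dx s K') : K = K' := by
  obtain ⟨T, hTd, hTK, -⟩ := hK.expansion
  obtain ⟨T', hTd', hTK', -⟩ := hK'.expansion
  set e := chartAt (Coord n) x₀ with he
  have hx₀ : x₀ ∈ e.source := mem_chart_source _ x₀
  have hT : ∀ r, T r = T' r := by
    intro r
    induction r using Nat.strong_induction_on with
    | _ r ih =>
    -- The normalization fixes every coefficient of `K(1)`, hence the value of each functional on
    -- the constant function.
    have hone : T r 1 = T' r 1 := by
      have h1 := hTK 1 r
      have h2 := hTK' 1 r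
      rw [hK.normalized] at h1
      rw [hK'.normalized, h1] at h2
      have h3 : (1 : FormalFn n U) = HahnSeries.single 0 1 := rfl
      rw [h3, finsum_single_coeff, finsum_single_coeff, if_pos (Int.natCast_nonneg r),
        if_pos (Int.natCast_nonneg r), Int.toNat_natCast] at h2
      exact h2
    have hloc : ∀ f g : SmoothFn n U, (∀ᶠ x in 𝓝 x₀, f.1 x = g.1 x) →
        T r f - T' r f = T r g - T' r g := by
      intro f g hfg
      have h0 : ∀ᶠ x in 𝓝 x₀, (f - g).1 x = 0 := by
        filter_upwards [hfg] with x hx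
        show f.1 x - g.1 x = 0
        rw [hx, sub_self]
      have h1 := (hTd r).1 _ h0
      have h2 := (hTd' r).1 _ h0
      rw [map_sub] at h1 h2
      linear_combination h1 - h2
    -- In the coefficient of `ν^(r-1)` of the Stokes identity for `F = f`, the functional of index
    -- `r` meets only the coefficient of `ν⁻¹`, which is `(ξφ) f`. All other terms involve
    -- functionals of smaller index, on which the two integrals agree by induction.
    have hstokes : ∀ (ξ : SmoothVectorField n U) (f : SmoothFn n U),
        T r (ξ.op φ * f) - T' r (ξ.op φ * f) = 0 := by
      intro ξ f
      obtain ⟨h, hh⟩ := exists_isDivergenceNear dx hK.leading_ne_zero ξ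
      have k1 := hTK ((HahnSeries.single 0 f).map ξ.op +
        ((HahnSeries.single (-1) φ).map ξ.op + h) * HahnSeries.single 0 f) (r - 1)
      have k2 := hTK' ((HahnSeries.single 0 f).map ξ.op +
        ((HahnSeries.single (-1) φ).map ξ.op + h) * HahnSeries.single 0 f) (r - 1)
      rw [hK.stokes ξ _ h hh] at k1
      rw [hK'.stokes ξ _ h hh] at k2
      rw [map_single_op, map_single_op] at k1 k2
      set A : FormalFn n U := HahnSeries.single 0 (ξ.op f) +
        (HahnSeries.single (-1) (ξ.op φ) + h) * HahnSeries.single 0 f with hA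
      have hAc : ∀ j : ℤ, j ≤ -1 → A.coeff j = if j = -1 then ξ.op φ * f else 0 := by
        intro j hj
        rw [hA, HahnSeries.coeff_add, HahnSeries.coeff_mul_single_zero, HahnSeries.coeff_add,
          HahnSeries.coeff_single_of_ne (by omega), hh.1 j (by omega), zero_add, add_zero]
        split_ifs with h1
        · rw [h1, HahnSeries.coeff_single_same]
        · rw [HahnSeries.coeff_single_of_ne h1, zero_mul]
      have hA0 : ∀ j < (-1 : ℤ), A.coeff j = 0 := fun j hj => by
        rw [hAc j hj.le, if_neg hj.ne]
      have f1 := finsum_coeff_eq_sum_range (fun i => (T i).toAddMonoidHom) (k := (r : ℤ) - 1)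
        (N := r + 1) hA0 (by push_cast; omega)
      have f2 := finsum_coeff_eq_sum_range (fun i => (T' i).toAddMonoidHom) (k := (r : ℤ) - 1)
        (N := r + 1) hA0 (by push_cast; omega)
      simp only [LinearMap.toAddMonoidHom_coe] at f1 f2
      rw [f1, Finset.sum_range_succ] at k1
      rw [f2, Finset.sum_range_succ] at k2
      have hlast : A.coeff ((r : ℤ) - 1 - r) = ξ.op φ * f := by
        rw [show (r : ℤ) - 1 - r = -1 by ring, hAc _ le_rfl, if_pos rfl]
      rw [hlast] at k1 k2
      have hsum : ∑ i ∈ Finset.range r, T i (A.coeff ((r : ℤ) - 1 - i)) =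
          ∑ i ∈ Finset.range r, T' i (A.coeff ((r : ℤ) - 1 - i)) :=
        Finset.sum_congr rfl fun i hi => by rw [ih i (Finset.mem_range.1 hi)]
      linear_combination k2 - k1 - hsum
    refine LinearMap.ext fun f => ?_
    obtain ⟨χ, hχ⟩ := exists_contDiffBump (n := n) x₀ Filter.univ_mem
    have hχt := hχ.trans Set.inter_subset_left
    choose ξ hξ using fun j => exists_coordinateField χ.contDiff (isCompact_closedBall _ _) hχt
      (contDiffBump_eq_zero χ) j
    -- After subtracting its value at `x₀`, the function is near `x₀` a combination of the `∂_jφ`.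
    -- There `∂_jφ` is the derivative of `φ` along the cut-off coordinate field, so `hstokes`
    -- applies to every summand.
    obtain ⟨g, hg⟩ := hdivision (f - f.1 x₀ • 1) (by
      show f.1 x₀ - f.1 x₀ * 1 = 0
      ring)
    have hsumapp : ∀ (t : Finset (Fin (2 * n))) (f : Fin (2 * n) → SmoothFn n U) (x : U),
        (∑ i ∈ t, f i).1 x = ∑ i ∈ t, (f i).1 x := fun t f x => by
      classical
      induction t using Finset.induction_on with
      | empty => rfl
      | insert a t ha ih => rw [Finset.sum_insert ha, Finset.sum_insert ha, ← ih]; rfl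
    have hev : ∀ᶠ x in 𝓝 x₀, (f - f.1 x₀ • 1).1 x = (∑ j, (ξ j).op φ * g j).1 x := by
      filter_upwards [e.open_source.mem_nhds hx₀, (e.continuousAt hx₀).eventually hg,
        (e.continuousAt hx₀) (Metric.closedBall_mem_nhds _ χ.rIn_pos)] with x hx hgx hxb
      rw [chartRep, ← he, e.left_inv hx] at hgx
      rw [hgx, hsumapp]
      refine Finset.sum_congr rfl fun j _ => ?_
      show _ = ((ξ j).op φ).1 x * (g j).1 x
      have h1 := apply_eq_sum_component (ξ j) φ x₀ (e.map_source hx)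
      rw [← he, e.left_inv hx] at h1
      rw [show ((ξ j).op φ).1 x = (ξ j).apply φ x from rfl, h1, chartRep, ← he, e.left_inv hx]
      congr 1
      rw [Finset.sum_eq_single j]
      · rw [hξ j _ (e.map_source hx), if_pos rfl, χ.one_of_mem_closedBall hxb, Complex.ofReal_one,
          one_mul]
      · intro k _ hk
        rw [hξ j _ (e.map_source hx), if_neg hk, Complex.ofReal_zero, zero_mul]
      · exact fun h => absurd (Finset.mem_univ j) h
    have h1 := hloc _ _ hev
    rw [map_sum, map_sum, ← Finset.sum_sub_distrib, Finset.sum_eq_zero fun j _ => hstokes (ξ j) (g j),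
      map_sub, map_sub, map_smul, map_smul, hone] at h1
    linear_combination h1
  refine LinearMap.ext fun F => ?_
  obtain ⟨F, rfl⟩ := (HahnModule.of ℂ).surjective F
  ext k
  rw [hTK, hTK']
  simp only [hT]

end Uniqueness

/-! ### Assembly of the formal integral and the main statement. -/

section MainTheorem

theorem PowerAsymp.hasAsymptoticExpansion {v : ℝ → ℂ} {a : PowerSeries ℂ} {n : ℕ}
    (h : PowerAsymp (fun m => (m : ℂ) ^ n * v m) a) :
    HasAsymptoticExpansion v (HahnSeries.single (n : ℤ) 1 * (a : LaurentSeries ℂ)) := by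
  intro N
  set A : LaurentSeries ℂ := HahnSeries.single (n : ℤ) 1 * (a : LaurentSeries ℂ) with hA
  have hAc : ∀ r, A.coeff r = if r - n < 0 then 0 else PowerSeries.coeff (r - n).natAbs a :=
    fun r => by rw [hA, HahnSeries.coeff_single_mul, one_mul, PowerSeries.coeff_coe]
  -- Dividing by `m^n` raises the error order by `n`, so order `N - n` suffices. For `N ≤ n` the
  -- partial sum is empty and the bound is still strong enough.
  set M : ℕ := (N - n).toNat with hM
  have hsum : ∀ m : ℝ, 0 < m → ∑ r ∈ Finset.Ico A.order N, A.coeff r * (m : ℂ) ^ (-r) =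
      (m : ℂ)⁻¹ ^ n * partialSum a M m := by
    intro m hm
    have hm' : (m : ℂ) ≠ 0 := Complex.ofReal_ne_zero.2 hm.ne'
    -- The order of `A` may exceed `n`, and it may be smaller than `n` when `A = 0`; in either case
    -- the coefficients in between vanish.
    have h1 : ∑ r ∈ Finset.Ico A.order N, A.coeff r * (m : ℂ) ^ (-r) =
        ∑ r ∈ Finset.Ico (n : ℤ) N, A.coeff r * (m : ℂ) ^ (-r) := by
      rw [Finset.sum_subset (Finset.Ico_subset_Ico_left (min_le_left A.order n)),
        Finset.sum_subset (Finset.Ico_subset_Ico_left (min_le_right A.order n))]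
      · intro r hr hr'
        rw [Finset.mem_Ico] at hr hr'
        rw [hAc, if_pos (by omega), zero_mul]
      · intro r hr hr'
        rw [Finset.mem_Ico] at hr hr'
        rw [HahnSeries.coeff_eq_zero_of_lt_order (by omega), zero_mul]
    rw [h1, partialSum, Finset.mul_sum]
    refine Finset.sum_nbij' (fun r => (r - n).toNat) (fun j => n + j) ?_ ?_ ?_ ?_ ?_
    · intro r hr
      rw [Finset.mem_Ico] at hr
      rw [Finset.mem_range]
      omega
    · intro j hj
      rw [Finset.mem_range] at hj
      rw [Finset.mem_Ico]
      omega
    · intro r hr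
      rw [Finset.mem_Ico] at hr
      omega
    · intro j _
      omega
    · intro r hr
      rw [Finset.mem_Ico] at hr
      obtain ⟨j, rfl⟩ : ∃ j : ℕ, r = n + j := ⟨(r - n).toNat, by omega⟩
      rw [hAc, if_neg (by omega), add_sub_cancel_left, Int.natAbs_natCast, Int.toNat_natCast,
        zpow_neg, zpow_add₀ hm', zpow_natCast, zpow_natCast, mul_inv, inv_pow, inv_pow]
      ring
  obtain ⟨C, hC⟩ := (h M).bound
  refine Asymptotics.IsBigO.of_bound C ?_
  filter_upwards [hC, Filter.eventually_ge_atTop (1 : ℝ)] with m hm hm1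
  have hm0 : 0 < m := by linarith
  have hm' : (m : ℂ) ≠ 0 := Complex.ofReal_ne_zero.2 hm0.ne'
  have hC0 : 0 ≤ C := by
    have h2 := (norm_nonneg _).trans hm
    have h3 : 0 < ‖m⁻¹ ^ M‖ := norm_pos_iff.2 (pow_ne_zero _ (inv_ne_zero hm0.ne'))
    exact nonneg_of_mul_nonneg_left h2 h3
  have e1 : v m - (m : ℂ)⁻¹ ^ n * partialSum a M m =
      (m : ℂ)⁻¹ ^ n * ((m : ℂ) ^ n * v m - partialSum a M m) := by
    rw [mul_sub, ← mul_assoc, ← mul_pow, inv_mul_cancel₀ hm', one_pow, one_mul]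
  rw [hsum m hm0, e1, norm_mul, norm_pow, norm_inv, Complex.norm_real, Real.norm_of_nonneg hm0.le,
    Real.norm_of_nonneg (zpow_nonneg hm0.le _)]
  calc m⁻¹ ^ n * ‖(m : ℂ) ^ n * v m - partialSum a M m‖ ≤ m⁻¹ ^ n * (C * ‖m⁻¹ ^ M‖) := by gcongr
    _ = C * m ^ (-((n : ℤ) + M)) := by
        rw [Real.norm_of_nonneg (by positivity), zpow_neg, zpow_add₀ hm0.ne', zpow_natCast,
          zpow_natCast, mul_inv, inv_pow, inv_pow]
        ring
    _ ≤ C * m ^ (-N) := by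
        refine mul_le_mul_of_nonneg_left (zpow_le_zpow_right₀ hm1 ?_) hC0
        omega

variable {n : ℕ} {U : Type*} [TopologicalSpace U] [T2Space U]
  [SecondCountableTopology U] [ChartedSpace (Coord n) U] [IsManifold (𝓡 (2 * n)) ∞ U]
  [MeasurableSpace U] [BorelSpace U]

omit [SecondCountableTopology U] [IsManifold (𝓡 (2 * n)) ∞ U] in
/-- The expansion of `S_m(f)` in terms of the expansion of `∫_U e^{mφ} f dx`. -/
theorem powerAsymp_oscillatoryIntegral (dx : VolumeForm n U) {φ : SmoothFn n U}
    (hre : ∀ x, (φ.1 x).re ≤ 0) {ρ : U → ℝ → ℂ} {s : ℕ → SmoothFn n U} (hρ : IsSymbol n 0 ρ)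
    (hexp : HasSymbolExpansion ρ s) {S : SmoothFn n U →ₗ[ℂ] PowerSeries ℂ}
    (hS : ∀ f, HasCompactSupport f.1 →
      PowerAsymp (fun m => (m : ℂ) ^ n * dx.expIntegral φ f m) (S f))
    {f : SmoothFn n U} (hf : HasCompactSupport f.1) :
    PowerAsymp (fun m => (m : ℂ) ^ n * oscillatoryIntegral dx φ ρ f m) (symbolSeries S s f) := by
  -- The symbol is expanded `n` orders further than required, to make up for the factor `m ^ n`.
  refine PowerAsymp.of_forall_approx fun N => ⟨fun m => ∑ r ∈ Finset.range (N + n),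
    (m : ℂ)⁻¹ ^ r * ((m : ℂ) ^ n * dx.expIntegral φ (s r * f) m),
    ∑ r ∈ Finset.range (N + n), PowerSeries.X ^ r * S (s r * f),
    PowerAsymp.sum _ fun r _ => (hS (s r * f) hf.mul_left).inv_pow_mul r, ?_,
    fun r hr => coeff_symbolSeries_eq_coeff_sum S s f (by omega)⟩
  obtain ⟨C, hC⟩ := (isBigO_oscillatoryIntegral_sub dx hre hρ hexp hf (N + n)).bound
  refine Asymptotics.IsBigO.of_bound C ?_
  filter_upwards [hC, Filter.eventually_gt_atTop (0 : ℝ)] with m hm hm0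
  have e1 : (m : ℂ) ^ n * oscillatoryIntegral dx φ ρ f m - ∑ r ∈ Finset.range (N + n),
      (m : ℂ)⁻¹ ^ r * ((m : ℂ) ^ n * dx.expIntegral φ (s r * f) m) =
      (m : ℂ) ^ n * (oscillatoryIntegral dx φ ρ f m - ∑ r ∈ Finset.range (N + n),
        (m : ℂ)⁻¹ ^ r * dx.expIntegral φ (f * s r) m) := by
    rw [mul_sub, Finset.mul_sum]
    congr 1
    refine Finset.sum_congr rfl fun r _ => ?_
    rw [mul_comm f]
    ring
  rw [e1, norm_mul, norm_pow, Complex.norm_real, Real.norm_of_nonneg hm0.le]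
  calc _ ≤ m ^ n * (C * ‖m⁻¹ ^ (N + n)‖) := by gcongr
    _ = C * ‖m⁻¹ ^ N‖ := by
        have h1 : m ^ n * m⁻¹ ^ n = 1 := by rw [← mul_pow, mul_inv_cancel₀ hm0.ne', one_pow]
        rw [Real.norm_of_nonneg (by positivity), Real.norm_of_nonneg (by positivity), pow_add]
        linear_combination C * m⁻¹ ^ N * h1

end MainTheorem

theorem proposition5 (n : ℕ) (U : Type*) [TopologicalSpace U] [T2Space U]
    [SecondCountableTopology U] [ChartedSpace (Coord n) U] [IsManifold (𝓡 (2 * n)) ∞ U]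
    [MeasurableSpace U] [BorelSpace U]
    (dx : VolumeForm n U) (φ : SmoothFn n U) (x_c : U)
    (hre : ∀ x : U, (φ.1 x).re ≤ 0)
    (hcrit : ∀ x : U, IsCriticalPoint φ x ↔ x = x_c)
    (hnondeg : IsNondegenerateCriticalPoint φ x_c)
    (hzero : φ.1 x_c = 0)
    (ρ : U → ℝ → ℂ) (ρcoeff : ℕ → SmoothFn n U)
    (hρ : IsSymbol n 0 ρ) (hexp : HasSymbolExpansion ρ ρcoeff)
    (hρ0 : (ρcoeff 0).1 x_c ≠ 0) :
    ∃ (K : FormalFnSpace n U →ₗ[FormalNumber] FormalNumber) (c : FormalNumber),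
      IsFormalIntegral x_c (HahnSeries.single (-1) φ) dx ρcoeff K ∧
      (∀ K' : FormalFnSpace n U →ₗ[FormalNumber] FormalNumber,
        IsFormalIntegral x_c (HahnSeries.single (-1) φ) dx ρcoeff K' → K' = K) ∧
      c ≠ 0 ∧
      ∀ f : SmoothFn n U, HasCompactSupport f.1 →
        HasAsymptoticExpansion (oscillatoryIntegral dx φ ρ f)
          (c * K (HahnModule.of ℂ (HahnSeries.single (0 : ℤ) f))) := by
  obtain ⟨⟨S, κ, hκ, hS, hS0, hSd⟩, hdivision⟩ :=
    exists_expIntegral_expansion dx hre hcrit hnondeg.2 hzero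
  have hSloc : ∀ f : SmoothFn n U, (∀ᶠ x in 𝓝 x_c, f.1 x = 0) → S f = 0 := fun f hf => by
    ext r
    exact (hSd r).1 f hf
  set s := symbolSeries S ρcoeff with hs
  have hs0 : ∀ f, PowerSeries.constantCoeff (s f) = κ * ((ρcoeff 0).1 x_c * f.1 x_c) := fun f => by
    rw [← PowerSeries.coeff_zero_eq_constantCoeff_apply, hs, coeff_symbolSeries]
    simpa using hS0 (ρcoeff 0 * f)
  -- This makes `s 1` invertible as a power series, so that `s` can be normalized; it is here that
  -- `ρ_0` must not vanish at the critical point.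
  have hs1 : PowerSeries.constantCoeff (s 1) ≠ 0 := by
    rw [hs0]
    exact mul_ne_zero hκ (mul_ne_zero hρ0 one_ne_zero)
  have hsd : ∀ r, IsDistributionSupportedAt x_c (PowerSeries.coeff r ∘ₗ s) := fun r => by
    have h1 : PowerSeries.coeff r ∘ₗ s = ∑ i ∈ Finset.range (r + 1),
        (PowerSeries.coeff (r - i) ∘ₗ S) ∘ₗ LinearMap.mulLeft ℂ (ρcoeff i) := by
      refine LinearMap.ext fun f => ?_
      rw [LinearMap.sum_apply]
      exact coeff_symbolSeries S ρcoeff f r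
    rw [h1]
    exact IsDistributionSupportedAt.sum _ fun i _ => (hSd (r - i)).comp_mul (ρcoeff i)
  -- The coefficients of `s(1)⁻¹ s`. Each is a finite combination of coefficients of `s`, hence
  -- again a distribution supported at the critical point.
  let T : ℕ → SmoothFn n U →ₗ[ℂ] ℂ := fun r =>
    PowerSeries.coeff r ∘ₗ LinearMap.mulLeft ℂ (s 1)⁻¹ ∘ₗ s
  have hTd : ∀ r, IsDistributionSupportedAt x_c (T r) := fun r => by
    have h1 : T r = ∑ j ∈ Finset.range (r + 1),
        PowerSeries.coeff j (s 1)⁻¹ • (PowerSeries.coeff (r - j) ∘ₗ s) := by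
      refine LinearMap.ext fun f => ?_
      rw [LinearMap.sum_apply]
      show PowerSeries.coeff r ((s 1)⁻¹ * s f) = _
      rw [PowerSeries.coeff_mul, Finset.Nat.sum_antidiagonal_eq_sum_range_succ
        (fun i j => PowerSeries.coeff i (s 1)⁻¹ * PowerSeries.coeff j (s f))]
      rfl
    rw [h1]
    exact IsDistributionSupportedAt.sum _ fun j _ => (hsd (r - j)).smul _
  obtain ⟨K, hK⟩ := exists_formalExtension T
  have hKsingle : ∀ f : SmoothFn n U, K (HahnModule.of ℂ (HahnSeries.single (0 : ℤ) f)) =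
      (((s 1)⁻¹ * s f : PowerSeries ℂ) : LaurentSeries ℂ) := fun f => by
    ext k
    rw [hK, finsum_single_coeff, PowerSeries.coeff_coe]
    split_ifs with h1 h2 h2
    · omega
    · rw [show k.natAbs = k.toNat by omega]
      rfl
    · rfl
    · omega
  have hKint : IsFormalIntegral x_c (HahnSeries.single (-1) φ) dx ρcoeff K :=
    { coeff_eq_zero := fun r hr => HahnSeries.coeff_single_of_ne hr.ne
      nondegenerate := by rwa [HahnSeries.coeff_single_same]
      leading_ne_zero := hρ0
      expansion := ⟨T, hTd, hK, fun f => by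
        show PowerSeries.coeff 0 ((s 1)⁻¹ * s f) = f.1 x_c
        rw [PowerSeries.coeff_zero_eq_constantCoeff_apply, map_mul,
          PowerSeries.constantCoeff_inv, hs0, hs0]
        have h1 : (1 : SmoothFn n U).1 x_c = 1 := rfl
        rw [h1]
        field_simp⟩
      normalized := by
        have h1 : (1 : FormalFn n U) = HahnSeries.single 0 1 := rfl
        rw [h1, hKsingle, PowerSeries.inv_mul_cancel _ hs1, map_one]
      stokes := fun ξ F h hh => by
        ext l
        rw [hK, map_single_op, HahnSeries.coeff_zero]
        refine finsum_stokes_eq_zero hh.1 (fun f => ?_) l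
        -- The divergence identity for the expansions supplies both hypotheses: its constant
        -- coefficient gives the first, its coefficient of index `k + 1` the second.
        refine IsStokesFamily.mul (isStokesFamily_symbolSeries (fun r => ?_) fun r k => ?_) _
        · have := congrArg (PowerSeries.coeff 0) (expansion_divergence_eq_zero dx hS hSloc hh f r)
          simpa using this
        · have := congrArg (PowerSeries.coeff (k + 1))
            (expansion_divergence_eq_zero dx hS hSloc hh f r)
          rw [map_add, PowerSeries.coeff_succ_X_mul, map_add, map_sum, map_zero] at this
          rw [add_assoc]
          exact this }
  -- The constant restores what was divided out: `ν^n` for the factor `m ^ n`, and `s(1)` for the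
  -- normalization of `K`.
  refine ⟨K, HahnSeries.single (n : ℤ) 1 * ((s 1 : PowerSeries ℂ) : LaurentSeries ℂ), hKint,
    fun K' hK' => hK'.unique hdivision hKint, ?_, fun f hf => ?_⟩
  · refine mul_ne_zero (HahnSeries.single_ne_zero one_ne_zero) fun h => hs1 ?_
    have h1 : ((s 1 : PowerSeries ℂ) : LaurentSeries ℂ).coeff (0 : ℕ) = 0 := by rw [h]; rfl
    rw [LaurentSeries.coeff_coe_powerSeries] at h1
    rwa [← PowerSeries.coeff_zero_eq_constantCoeff_apply]
  · have h1 : HahnSeries.single (n : ℤ) 1 * ((s 1 : PowerSeries ℂ) : LaurentSeries ℂ) *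
        K (HahnModule.of ℂ (HahnSeries.single (0 : ℤ) f)) =
        HahnSeries.single (n : ℤ) 1 * ((s f : PowerSeries ℂ) : LaurentSeries ℂ) := by
      rw [hKsingle, mul_assoc, ← map_mul, ← mul_assoc, PowerSeries.mul_inv_cancel _ hs1, one_mul]
    rw [h1]
    exact (powerAsymp_oscillatoryIntegral dx hre hρ hexp hS hf).hasAsymptoticExpansion
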